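/- Let $\mathbb{N}=\{0,1,2,\dots\}$ and $\mathbb{N}^*=\{1,2,\dots\}$. For a semigroup $P$ with identity $e$ and a homomorphism $d:P\to(\mathbb{N}^*,\cdot)$, the \emph{lexicographic product system} determined by $d$ is $E(d)=\bigsqcup_{s\in P}\{s\}\times\mathbb{C}^{d(s)}$, with the associative multiplication obtained by bilinear extension from $$(r,\delta_j)(s,\delta_k)=(rs,\delta_{j\,d(s)+k}),\qquad 0\le j<d(r),\ 0\le k<d(s),$$ where $\delta_0,\dots,\delta_{d(s)-1}$ is the standard basis of $\mathbb{C}^{d(s)}$. Its identity is $1=(e,\delta_0)$. A \emph{Cuntz representation} of a product system $E$ of finite-dimensional Hilbert spaces $E_t$ ($t\in P$) in a $C^*$-algebra $B$ is a map $\phi:E\to B$ such that $\phi(xy)=\phi(x)\phi(y)$ for all $x,y\in E$; $\phi(y)^*\phi(x)=(x\mid y)\,\phi(1)$ whenever $x,y$ lie in the same fiber; and $\sum_{f\in\mathcal{B}}\phi(f)\phi(f)^*=\phi(1)$ for every orthonormal basis $\mathcal{B}$ of a fiber $E_t$. Let $\mathcal{O}_E$ be the $C^*$-algebra generated by a universal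 Cuntz representation of $E$. For $m,n\in\mathbb{N}^*$ let $E(m,n)$ be the lexicographic product system over $\mathbb{N}^2$ determined by $(a,b)\mapsto m^an^b$. For $l\in\mathbb{N}^*$ let $\mathcal{O}_l$ be the universal unital $C^*$-algebra generated by $l$ isometries whose range projections sum to $1$ (the Cuntz algebra for $l\ge 2$; $\mathcal{O}_1=C(\mathbb{T})$). \textbf{Theorem.} Let $m,n\in\mathbb{N}^*$. \begin{enumerate} \item If $m=1$, then $\mathcal{O}_{E(m,n)}\cong\mathcal{O}_n\otimes C(\mathbb{T})$. \item If $m,n\ge 2$ and $\log_m n$ is irrational, then $\mathcal{O}_{E(m,n)}$ is simple, that is, nonzero and without nontrivial closed two-sided ideals. \item If $m,n\ge 2$ and $\log_m n$ is rational, then there exists a unique positive integer $l$ such that $m=l^a$ and $n=l^b$ for some relatively prime positive integers $a$ and $b$; for this $l$ we have $\mathcal{O}_{E(m,n)}\cong\mathcal{O}_l\otimes C(\mathbb{T})$. \end{enumerate} Here $\cong$ is $*$-isomorphism, and $\otimes$ is the $C^*$-tensor product (unambiguous, since $C(\mathbb{T})$ is nuclear). -/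

import Mathlib

open scoped TensorProduct

noncomputable section

/-! ### Universal C*-algebras of generators and relations -/

/-- Formal noncommutative `*`-polynomials over `ℂ` in the variables `X`. -/
inductive StarPoly (X : Type) : Type
  | gen (x : X) : StarPoly X
  | const (c : ℂ) : StarPoly X
  | add (p q : StarPoly X) : StarPoly X
  | mul (p q : StarPoly X) : StarPoly X
  | conj (p : StarPoly X) : StarPoly X

/-- The value of a `*`-polynomial in a unital C*-algebra. -/
def StarPoly.eval {X B : Type} [CStarAlgebra B] (φ : X → B) : StarPoly X → B
  | .gen x => φ x
  | .const c => algebraMap ℂ B c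
  | .add p q => p.eval φ + q.eval φ
  | .mul p q => p.eval φ * q.eval φ
  | .conj p => star (p.eval φ)

/-- A class of maps ("representations") from a set `X` of generators to unital C*-algebras, under
which the norm of the image of every single generator is bounded. -/
structure CStarRelations (X : Type) : Type 1 where
  /-- `Rep B φ` says that the elements `φ x` of `B` satisfy the relations. -/
  Rep : ∀ (B : Type) [CStarAlgebra B], (X → B) → Prop
  bounded : ∀ x : X, ∃ C : ℝ, ∀ (B : Type) [CStarAlgebra B] (φ : X → B), Rep B φ → ‖φ x‖ ≤ C

namespace CStarRelations

variable {X : Type} (R : CStarRelations X)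

/-- A unital C*-algebra with a representation of the relations in it. -/
structure Model : Type 1 where
  B : Type
  [str : CStarAlgebra B]
  φ : X → B
  rep : R.Rep B φ

instance (M : R.Model) : CStarAlgebra M.B := M.str

/-- Two `*`-polynomials are identified if they have the same value in all representations. -/
def setoid : Setoid (StarPoly X) where
  r p q := ∀ M : R.Model, p.eval M.φ = q.eval M.φ
  iseqv := ⟨fun _ _ => rfl, fun h M => (h M).symm, fun h k M => (h M).trans (k M)⟩

/-- The unital `*`-algebra generated by `X` subject to all relations that hold in every
representation. -/
def Pre : Type := Quotient R.setoid

namespace Pre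

variable {R}

/-- The class of a `*`-polynomial. -/
def mk (p : StarPoly X) : R.Pre := Quotient.mk R.setoid p

/-- The value of a class in a representation. -/
def eval (M : R.Model) (a : R.Pre) : M.B :=
  Quotient.lift (s := R.setoid) (fun p => p.eval M.φ) (fun _ _ h => h M) a

theorem eval_mk (M : R.Model) (p : StarPoly X) : eval M (mk p : R.Pre) = p.eval M.φ := rfl

theorem ind {motive : R.Pre → Prop} (h : ∀ p, motive (mk p)) (a : R.Pre) : motive a :=
  Quotient.ind h a

/-- The values of a class in all representations at once. -/
def evalAll (a : R.Pre) : ∀ M : R.Model, M.B := fun M => eval M a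

theorem evalAll_injective : Function.Injective (evalAll (R := R)) := by
  intro a b
  induction a using Pre.ind with | h p
  induction b using Pre.ind with | h q
  intro h
  exact Quotient.sound (s := R.setoid) fun M => congrFun h M

theorem ext {a b : R.Pre} (h : ∀ M, eval M a = eval M b) : a = b :=
  evalAll_injective (funext h)

instance : Zero R.Pre := ⟨mk (.const 0)⟩
instance : One R.Pre := ⟨mk (.const 1)⟩
instance : Add R.Pre :=
  ⟨Quotient.map₂ (sa := R.setoid) (sb := R.setoid) (sc := R.setoid) .add
    fun _ _ h _ _ k M => congrArg₂ (· + ·) (h M) (k M)⟩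
instance : Mul R.Pre :=
  ⟨Quotient.map₂ (sa := R.setoid) (sb := R.setoid) (sc := R.setoid) .mul
    fun _ _ h _ _ k M => congrArg₂ (· * ·) (h M) (k M)⟩
instance : Star R.Pre :=
  ⟨Quotient.map (sa := R.setoid) (sb := R.setoid) .conj fun _ _ h M => congrArg star (h M)⟩
instance : SMul ℂ R.Pre := ⟨fun c a => mk (.const c) * a⟩
instance : Neg R.Pre := ⟨fun a => (-1 : ℂ) • a⟩
instance : Sub R.Pre := ⟨fun a b => a + -b⟩
instance : SMul ℕ R.Pre := ⟨fun n a => (n : ℂ) • a⟩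
instance : SMul ℤ R.Pre := ⟨fun n a => (n : ℂ) • a⟩
instance : Pow R.Pre ℕ := ⟨fun a n => npowRec n a⟩
instance : NatCast R.Pre := ⟨fun n => mk (.const n)⟩
instance : IntCast R.Pre := ⟨fun n => mk (.const n)⟩

variable (M : R.Model) (a b : R.Pre)

theorem eval_zero : eval M (0 : R.Pre) = 0 := map_zero (algebraMap ℂ M.B)
theorem eval_one : eval M (1 : R.Pre) = 1 := map_one (algebraMap ℂ M.B)
theorem eval_add : eval M (a + b) = eval M a + eval M b := by
  induction a using Pre.ind
  induction b using Pre.ind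
  rfl
theorem eval_mul : eval M (a * b) = eval M a * eval M b := by
  induction a using Pre.ind
  induction b using Pre.ind
  rfl
theorem eval_star : eval M (star a) = star (eval M a) := by
  induction a using Pre.ind
  rfl
theorem eval_const (c : ℂ) : eval M (mk (.const c) : R.Pre) = algebraMap ℂ M.B c := rfl
theorem eval_smul (c : ℂ) : eval M (c • a) = c • eval M a := by
  rw [Algebra.smul_def]
  exact eval_mul M _ _
theorem eval_neg : eval M (-a) = -eval M a := by
  rw [← neg_one_smul ℂ (eval M a)]
  exact eval_smul M a _
theorem eval_sub : eval M (a - b) = eval M a - eval M b := by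
  rw [sub_eq_add_neg, ← eval_neg]
  exact eval_add M _ _
theorem eval_pow (n : ℕ) : eval M (a ^ n) = eval M a ^ n := by
  induction n with
  | zero => rw [pow_zero]; exact eval_one M
  | succ n ih => rw [pow_succ, ← ih]; exact eval_mul M _ _

instance : Ring R.Pre :=
  Function.Injective.ring evalAll evalAll_injective
    (funext fun M => eval_zero M) (funext fun M => eval_one M)
    (fun a b => funext fun M => eval_add M a b) (fun a b => funext fun M => eval_mul M a b)
    (fun a => funext fun M => eval_neg M a) (fun a b => funext fun M => eval_sub M a b)
    (fun n a => funext fun M => (eval_smul M a n).trans (Nat.cast_smul_eq_nsmul ℂ n _))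
    (fun n a => funext fun M => (eval_smul M a n).trans (Int.cast_smul_eq_zsmul ℂ n _))
    (fun a n => funext fun M => eval_pow M a n)
    (fun n => funext fun M => map_natCast (algebraMap ℂ M.B) n)
    (fun n => funext fun M => map_intCast (algebraMap ℂ M.B) n)

instance : Algebra ℂ R.Pre :=
  letI : Module ℂ R.Pre :=
    Function.Injective.module ℂ
      (⟨⟨evalAll, funext fun M => eval_zero M⟩, fun a b => funext fun M => eval_add M a b⟩ :
        R.Pre →+ ∀ M : R.Model, M.B)
      evalAll_injective (fun c a => funext fun M => eval_smul M a c)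
  Algebra.ofModule
    (fun c a b => ext fun M => by simp [eval_smul, eval_mul])
    (fun c a b => ext fun M => by simp [eval_smul, eval_mul])

instance : StarRing R.Pre where
  star_involutive a := ext fun M => by simp [eval_star]
  star_mul a b := ext fun M => by simp [eval_star, eval_mul]
  star_add a b := ext fun M => by simp [eval_star, eval_add]

instance : StarModule ℂ R.Pre where
  star_smul c a := ext fun M => by simp [eval_star, eval_smul]

theorem bounded (a : R.Pre) : ∃ C : ℝ, ∀ M : R.Model, ‖eval M a‖ ≤ C := by
  induction a using Pre.ind with | h p
  induction p with
  | gen x =>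
    obtain ⟨C, hC⟩ := R.bounded x
    exact ⟨C, fun M => hC M.B M.φ M.rep⟩
  | const c =>
    refine ⟨‖c‖ * 1, fun M => ?_⟩
    rw [eval_const, Algebra.algebraMap_eq_smul_one, norm_smul]
    refine mul_le_mul_of_nonneg_left ?_ (norm_nonneg c)
    have h := CStarRing.norm_star_mul_self (x := (1 : M.B))
    rw [star_one, one_mul] at h
    nlinarith [sq_nonneg (‖(1 : M.B)‖ - 1)]
  | add p q hp hq =>
    obtain ⟨C, hC⟩ := hp
    obtain ⟨D, hD⟩ := hq
    exact ⟨C + D, fun M => (norm_add_le _ _).trans (add_le_add (hC M) (hD M))⟩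
  | mul p q hp hq =>
    obtain ⟨C, hC⟩ := hp
    obtain ⟨D, hD⟩ := hq
    exact ⟨C * D, fun M => (norm_mul_le _ _).trans
      (mul_le_mul (hC M) (hD M) (norm_nonneg _) ((norm_nonneg _).trans (hC M)))⟩
  | conj p hp =>
    obtain ⟨C, hC⟩ := hp
    exact ⟨C, fun M => (norm_star (p.eval M.φ)).trans_le (hC M)⟩

/-- The largest C*-norm: the supremum of the norms of the values in all representations. -/
instance : Norm R.Pre := ⟨fun a => ⨆ M : R.Model, ‖eval M a‖⟩

theorem norm_def : ‖a‖ = ⨆ M : R.Model, ‖eval M a‖ := rfl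

theorem norm_eval_le : ‖eval M a‖ ≤ ‖a‖ :=
  le_ciSup (f := fun M : R.Model => ‖eval M a‖)
    (let ⟨C, hC⟩ := bounded a; ⟨C, Set.forall_mem_range.2 hC⟩) M

theorem norm_nonneg' : 0 ≤ ‖a‖ := Real.iSup_nonneg fun _ => norm_nonneg _

variable {a} in
theorem norm_le {C : ℝ} (hC : 0 ≤ C) (h : ∀ M, ‖eval M a‖ ≤ C) : ‖a‖ ≤ C := Real.iSup_le h hC

/-- The largest C*-norm as a bundled ring norm. -/
def ringNorm : RingNorm R.Pre where
  toFun a := ‖a‖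
  map_zero' := le_antisymm (norm_le le_rfl fun M => by simp [eval_zero]) (norm_nonneg' 0)
  add_le' a b := norm_le (add_nonneg (norm_nonneg' a) (norm_nonneg' b)) fun M => by
    rw [eval_add]
    exact (norm_add_le _ _).trans (add_le_add (norm_eval_le M a) (norm_eval_le M b))
  neg' a := by simp only [norm_def, eval_neg, norm_neg]
  mul_le' a b := norm_le (mul_nonneg (norm_nonneg' a) (norm_nonneg' b)) fun M => by
    rw [eval_mul]
    exact (norm_mul_le _ _).trans
      (mul_le_mul (norm_eval_le M a) (norm_eval_le M b) (norm_nonneg _) (norm_nonneg' a))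
  eq_zero_of_map_eq_zero' a h := ext fun M => by
    rw [eval_zero]
    exact norm_le_zero_iff.1 ((norm_eval_le M a).trans h.le)

instance : NormedRing R.Pre := ringNorm.toNormedRing

theorem norm_eq : ‖a‖ = ⨆ M : R.Model, ‖eval M a‖ := rfl

instance : NormedAlgebra ℂ R.Pre where
  norm_smul_le c a := norm_le (mul_nonneg (norm_nonneg c) (norm_nonneg a)) fun M => by
    rw [eval_smul, norm_smul]
    exact mul_le_mul_of_nonneg_left (norm_eval_le M a) (norm_nonneg c)

theorem norm_star' : ‖star a‖ = ‖a‖ := by simp only [norm_eq, eval_star, norm_star]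

theorem norm_mul_self_le : ‖a‖ * ‖a‖ ≤ ‖star a * a‖ := by
  have h : ‖a‖ ≤ √‖star a * a‖ := norm_le (Real.sqrt_nonneg _) fun M => by
    refine Real.le_sqrt_of_sq_le ?_
    rw [sq, ← CStarRing.norm_star_mul_self, ← eval_star, ← eval_mul]
    exact norm_eval_le M _
  calc ‖a‖ * ‖a‖ ≤ √‖star a * a‖ * √‖star a * a‖ :=
        mul_le_mul h h (norm_nonneg a) (Real.sqrt_nonneg _)
    _ = ‖star a * a‖ := Real.mul_self_sqrt (norm_nonneg _)

instance : CStarRing R.Pre := ⟨norm_mul_self_le⟩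

end Pre

/-- The universal unital C*-algebra of the relations `R`. -/
def Universal : Type := UniformSpace.Completion R.Pre

namespace Universal

open UniformSpace

instance : NormedRing R.Universal := inferInstanceAs (NormedRing (Completion R.Pre))

instance : CompleteSpace R.Universal := inferInstanceAs (CompleteSpace (Completion R.Pre))

instance : Algebra ℂ R.Universal := inferInstanceAs (Algebra ℂ (Completion R.Pre))

instance : NormedAlgebra ℂ R.Universal where
  norm_smul_le c a := norm_smul_le (α := ℂ) (β := Completion R.Pre) c a

variable {R}

/-- The canonical map from the dense `*`-subalgebra. -/
def of (a : R.Pre) : R.Universal := (a : Completion R.Pre)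

theorem ind {motive : R.Universal → Prop} (hc : IsClosed {a | motive a})
    (h : ∀ a : R.Pre, motive (of a)) (a : R.Universal) : motive a :=
  Completion.induction_on (α := R.Pre) a hc h

theorem of_add (a b : R.Pre) : of (a + b) = of a + of b := Completion.coe_add a b
theorem of_mul (a b : R.Pre) : of (a * b) = of a * of b := Completion.coe_mul a b
theorem of_smul (c : ℂ) (a : R.Pre) : of (c • a) = c • of a := Completion.coe_smul c a
theorem norm_of (a : R.Pre) : ‖of a‖ = ‖a‖ := Completion.norm_coe a

instance : Star R.Universal := ⟨Completion.map (star : R.Pre → R.Pre)⟩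

theorem continuous_star' : Continuous (star : R.Universal → R.Universal) :=
  Completion.continuous_map

theorem star_of (a : R.Pre) : star (of a) = of (star a) :=
  Completion.map_coe (Isometry.of_dist_eq fun a b => by
    rw [dist_eq_norm, dist_eq_norm, ← star_sub]; exact Pre.norm_star' _).uniformContinuous a

instance : StarRing R.Universal where
  star_involutive a := by
    induction a using ind with
    | hc =>
      exact isClosed_eq (continuous_star'.comp continuous_star') continuous_id
    | h a => rw [star_of, star_of, star_star]
  star_mul a b := by
    induction a using ind with
    | hc =>
      exact isClosed_eq (continuous_star'.comp (continuous_id.mul continuous_const))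
        (continuous_const.mul continuous_star')
    | h a =>
      induction b using ind with
      | hc =>
        exact isClosed_eq (continuous_star'.comp (continuous_const.mul continuous_id))
          (continuous_star'.mul continuous_const)
      | h b => rw [← of_mul, star_of, star_of, star_of, ← of_mul, star_mul]
  star_add a b := by
    induction a using ind with
    | hc =>
      exact isClosed_eq (continuous_star'.comp (continuous_id.add continuous_const))
        (continuous_star'.add continuous_const)
    | h a =>
      induction b using ind with
      | hc =>
        exact isClosed_eq (continuous_star'.comp (continuous_const.add continuous_id))
          (continuous_const.add continuous_star')
      | h b => rw [← of_add, star_of, star_of, star_of, ← of_add, star_add]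

instance : StarModule ℂ R.Universal where
  star_smul c a := by
    induction a using ind with
    | hc =>
      exact isClosed_eq (continuous_star'.comp (continuous_const_smul c))
        (continuous_star'.const_smul (star c))
    | h a => rw [← of_smul, star_of, star_of, ← of_smul, star_smul]

instance : CStarRing R.Universal where
  norm_mul_self_le a := by
    induction a using ind with
    | hc =>
      exact isClosed_le (continuous_norm.mul continuous_norm)
        (continuous_norm.comp (continuous_star'.mul continuous_id))
    | h a =>
      rw [star_of, ← of_mul, norm_of, norm_of]
      exact CStarRing.norm_mul_self_le a

instance : CStarAlgebra R.Universal where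

/-- The universal representation. -/
def ι (x : X) : R.Universal := of (Pre.mk (.gen x))

end Universal

end CStarRelations

/-! ### Cuntz algebras and tensor products -/

/-- `s 0, …, s (n - 1)` are isometries in `B` whose range projections sum to `1`. -/
def IsCuntzFamily (n : ℕ) (B : Type) [CStarAlgebra B] (s : Fin n → B) : Prop :=
  (∀ i, star (s i) * s i = 1) ∧ ∑ i, s i * star (s i) = 1

theorem norm_one_le (B : Type) [CStarAlgebra B] : ‖(1 : B)‖ ≤ 1 := by
  have h := CStarRing.norm_star_mul_self (x := (1 : B))
  rw [star_one, one_mul] at h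
  nlinarith [sq_nonneg (‖(1 : B)‖ - 1)]

/-- The relations of the Cuntz algebra. -/
def cuntzRelations (n : ℕ) : CStarRelations (Fin n) where
  Rep B _ s := IsCuntzFamily n B s
  bounded i := ⟨1, fun B _ s hs => by
    have h := CStarRing.norm_star_mul_self (x := s i)
    rw [hs.1 i] at h
    nlinarith [norm_one_le B, norm_nonneg (s i)]⟩

/-- The Cuntz algebra `𝓞ₙ`: the universal unital C*-algebra generated by `n` isometries whose
range projections sum to `1`. -/
abbrev CuntzAlgebra (n : ℕ) : Type := (cuntzRelations n).Universal

/-- The `*`-homomorphisms of the algebraic tensor product into unital C*-algebras. -/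
def tensorRelations (A B : Type) [CStarAlgebra A] [CStarAlgebra B] :
    CStarRelations (A ⊗[ℂ] B) where
  Rep D _ φ := ∃ π : (A ⊗[ℂ] B) →⋆ₐ[ℂ] D, ⇑π = φ
  bounded x := by
    induction x using TensorProduct.induction_on with
    | zero => exact ⟨0, by rintro D _ _ ⟨π, rfl⟩; simp⟩
    | tmul a b =>
      refine ⟨‖a‖ * ‖b‖, ?_⟩
      rintro D _ _ ⟨π, rfl⟩
      let πA : A →⋆ₐ[ℂ] D :=
        { π.toAlgHom.comp Algebra.TensorProduct.includeLeft with
          map_star' := fun a => by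
            change π (star a ⊗ₜ 1) = star (π (a ⊗ₜ 1))
            rw [← map_star, TensorProduct.star_tmul, star_one] }
      let πB : B →⋆ₐ[ℂ] D :=
        { π.toAlgHom.comp Algebra.TensorProduct.includeRight with
          map_star' := fun b => by
            change π (1 ⊗ₜ star b) = star (π (1 ⊗ₜ b))
            rw [← map_star, TensorProduct.star_tmul, star_one] }
      have h : π (a ⊗ₜ b) = πA a * πB b := by
        change _ = π (a ⊗ₜ 1) * π (1 ⊗ₜ b)
        rw [← map_mul, Algebra.TensorProduct.tmul_mul_tmul, mul_one, one_mul]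
      rw [h]
      exact (norm_mul_le _ _).trans (mul_le_mul (NonUnitalStarAlgHom.norm_apply_le πA a)
        (NonUnitalStarAlgHom.norm_apply_le πB b) (norm_nonneg _) (norm_nonneg _))
    | add x y hx hy =>
      obtain ⟨C, hC⟩ := hx
      obtain ⟨D, hD⟩ := hy
      refine ⟨C + D, ?_⟩
      rintro E _ _ ⟨π, rfl⟩
      rw [map_add]
      exact (norm_add_le _ _).trans (add_le_add (hC E π ⟨π, rfl⟩) (hD E π ⟨π, rfl⟩))

/-- The (maximal) C*-tensor product of unital C*-algebras: the completion of the algebraic tensor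
product in its largest C*-norm. If one factor is nuclear, for example commutative, this is the
only C*-tensor product. -/
abbrev CStarTensor (A B : Type) [CStarAlgebra A] [CStarAlgebra B] : Type :=
  (tensorRelations A B).Universal

/-- A C*-algebra is simple if it is nonzero and has no nontrivial closed two-sided ideals. -/
def IsSimpleCStarAlgebra (A : Type) [NonUnitalCStarAlgebra A] : Prop :=
  Nontrivial A ∧ ∀ I : TwoSidedIdeal A, IsClosed (I : Set A) → I = ⊥ ∨ I = ⊤

/-! ### Product systems and their Cuntz algebras -/

/-- A product system over `P` of finite-dimensional (complex) Hilbert spaces. -/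
structure ProductSystem (P : Type) [Monoid P] : Type 1 where
  /-- the fibers -/
  E : P → Type
  [normed : ∀ s, NormedAddCommGroup (E s)]
  [inner : ∀ s, InnerProductSpace ℂ (E s)]
  [finite : ∀ s, FiniteDimensional ℂ (E s)]
  nontrivial : ∀ s, Nontrivial (E s)
  /-- the multiplication, bilinear on each pair of fibers -/
  mul : ∀ {s t : P}, E s →ₗ[ℂ] E t →ₗ[ℂ] E (s * t)
  mul_assoc : ∀ {r s t : P} (x : E r) (y : E s) (z : E t),
    (⟨r * s * t, mul (mul x y) z⟩ : Σ s, E s) = ⟨r * (s * t), mul x (mul y z)⟩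
  inner_mul : ∀ {s t : P} (x x' : E s) (y y' : E t),
    Inner.inner ℂ (mul x y) (mul x' y') = Inner.inner ℂ x x' * Inner.inner ℂ y y'
  span_mul : ∀ s t : P, Submodule.span ℂ {z : E (s * t) | ∃ x y, z = mul x y} = ⊤
  finrank_one : Module.finrank ℂ (E 1) = 1
  /-- the identity -/
  one : E 1
  one_mul : ∀ {s : P} (x : E s), (⟨1 * s, mul one x⟩ : Σ s, E s) = ⟨s, x⟩
  mul_one : ∀ {s : P} (x : E s), (⟨s * 1, mul x one⟩ : Σ s, E s) = ⟨s, x⟩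

attribute [instance] ProductSystem.normed ProductSystem.inner ProductSystem.finite

namespace ProductSystem

variable {P : Type} [Monoid P] (S : ProductSystem P)

/-- Representations of a product system in a C*-algebra, as maps on the total space. Mathlib's
inner product is conjugate-linear in its first argument. -/
structure IsRepresentation {B : Type} [NonUnitalCStarAlgebra B] (φ : (Σ s, S.E s) → B) :
    Prop where
  map_mul : ∀ {s t : P} (x : S.E s) (y : S.E t),
    φ ⟨s * t, S.mul x y⟩ = φ ⟨s, x⟩ * φ ⟨t, y⟩
  star_mul : ∀ {s : P} (x y : S.E s),
    star (φ ⟨s, y⟩) * φ ⟨s, x⟩ = (Inner.inner ℂ y x : ℂ) • φ ⟨1, S.one⟩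

/-- Cuntz representations: the range projections of every orthonormal basis of a fiber sum to the
image of the identity. -/
structure IsCuntzRepresentation {B : Type} [NonUnitalCStarAlgebra B] (φ : (Σ s, S.E s) → B) :
    Prop extends S.IsRepresentation φ where
  sum_basis : ∀ {t : P} {ι : Type} [Fintype ι] (f : OrthonormalBasis ι ℂ (S.E t)),
    ∑ i, φ ⟨t, f i⟩ * star (φ ⟨t, f i⟩) = φ ⟨1, S.one⟩

theorem one_eq_zero_or_norm_one : S.one = 0 ∨ ‖S.one‖ = 1 := by
  by_cases h : S.one = 0
  · exact Or.inl h
  right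
  have h1 : ∀ {s : P} (x : S.E s) (y : S.E 1), (⟨s, x⟩ : Σ s, S.E s) = ⟨1, y⟩ → ‖x‖ = ‖y‖ := by
    intro s x y hxy
    cases hxy
    rfl
  have h2 := h1 _ _ (S.one_mul S.one)
  have h3 := S.inner_mul S.one S.one S.one S.one
  simp only [inner_self_eq_norm_sq_to_K] at h3
  rw [h2] at h3
  have h4 : ‖S.one‖ ^ 2 = ‖S.one‖ ^ 2 * ‖S.one‖ ^ 2 := by exact_mod_cast h3
  have h5 : 0 < ‖S.one‖ := norm_pos_iff.2 h
  have h6 : ‖S.one‖ ^ 2 = 1 := by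
    have : ‖S.one‖ ^ 2 ≠ 0 := by positivity
    field_simp at h4
    linarith
  nlinarith

variable {S} in
theorem IsRepresentation.norm_le {B : Type} [NonUnitalCStarAlgebra B] {φ : (Σ s, S.E s) → B}
    (hφ : S.IsRepresentation φ) {s : P} (x : S.E s) : ‖φ ⟨s, x⟩‖ ≤ ‖x‖ := by
  have key : ‖φ ⟨1, S.one⟩‖ ≤ 1 := by
    have h := CStarRing.norm_star_mul_self (x := φ ⟨1, S.one⟩)
    rw [hφ.star_mul, inner_self_eq_norm_sq_to_K, norm_smul] at h
    have h0 := norm_nonneg (φ ⟨1, S.one⟩)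
    rcases S.one_eq_zero_or_norm_one with h1 | h1
    · rw [h1] at h ⊢
      simp at h
      simp [h]
    · rw [h1] at h
      simp at h
      by_contra! hc
      nlinarith
  have h := CStarRing.norm_star_mul_self (x := φ ⟨s, x⟩)
  rw [hφ.star_mul, inner_self_eq_norm_sq_to_K, norm_smul] at h
  simp only [Complex.coe_algebraMap, norm_pow, Complex.norm_real, norm_norm] at h
  have h1 : ‖φ ⟨s, x⟩‖ ^ 2 ≤ ‖x‖ ^ 2 := by
    rw [sq, ← h]
    nlinarith [sq_nonneg ‖x‖]
  exact (sq_le_sq₀ (norm_nonneg _) (norm_nonneg _)).1 h1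

/-- The Cuntz representations in unital C*-algebras. (The image of the identity of the product
system is a projection and need not be the unit.) -/
def relations : CStarRelations (Σ s, S.E s) where
  Rep _ _ φ := S.IsCuntzRepresentation φ
  bounded x := ⟨‖x.2‖, fun _ _ _ hφ => hφ.norm_le x.2⟩

/-- The Cuntz algebra `𝓞_E` of a product system: the C*-subalgebra generated by the universal
Cuntz representation. -/
def cuntzSubalgebra : NonUnitalStarSubalgebra ℂ S.relations.Universal :=
  (NonUnitalStarAlgebra.adjoin ℂ
    (Set.range (CStarRelations.Universal.ι (R := S.relations)))).topologicalClosure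

instance : IsClosed (S.cuntzSubalgebra : Set S.relations.Universal) :=
  NonUnitalStarSubalgebra.isClosed_topologicalClosure _

/-- The Cuntz algebra `𝓞_E` of a product system. -/
abbrev CuntzAlg : Type := S.cuntzSubalgebra

end ProductSystem

/-! ### Lexicographic product systems -/

section Lexicographic

variable {P : Type} [Monoid P] (d : P →* ℕ+)

/-- The bijection `(j, k) ↦ j * d t + k` given by the lexicographic order. -/
def lexEquiv (s t : P) : Fin (d s) × Fin (d t) ≃ Fin (d (s * t)) :=
  finProdFinEquiv.trans (finCongr (by rw [map_mul, PNat.mul_coe]))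

theorem lexEquiv_apply (s t : P) (j : Fin (d s)) (k : Fin (d t)) :
    (lexEquiv d s t (j, k) : ℕ) = j * d t + k := by
  simp [lexEquiv, mul_comm, add_comm]

theorem lexEquiv_symm_fst (s t : P) (i : Fin (d (s * t))) :
    (((lexEquiv d s t).symm i).1 : ℕ) = i / d t := rfl

theorem lexEquiv_symm_snd (s t : P) (i : Fin (d (s * t))) :
    (((lexEquiv d s t).symm i).2 : ℕ) = i % d t := rfl

/-- The bilinear map determined by `δ j * δ k = δ (j * d t + k)` on basis vectors. -/
def lexMul (s t : P) : EuclideanSpace ℂ (Fin (d s)) →ₗ[ℂ]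
    EuclideanSpace ℂ (Fin (d t)) →ₗ[ℂ] EuclideanSpace ℂ (Fin (d (s * t))) :=
  LinearMap.mk₂ ℂ
    (fun x y => WithLp.toLp 2 fun i =>
      x ((lexEquiv d s t).symm i).1 * y ((lexEquiv d s t).symm i).2)
    (fun x x' y => by ext i; simp [add_mul])
    (fun c x y => by ext i; simp [mul_assoc])
    (fun x y y' => by ext i; simp [mul_add])
    (fun c x y => by ext i; simp [mul_left_comm])

theorem lexMul_apply (s t : P) (x : EuclideanSpace ℂ (Fin (d s)))
    (y : EuclideanSpace ℂ (Fin (d t))) (i : Fin (d (s * t))) :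
    lexMul d s t x y i = x ((lexEquiv d s t).symm i).1 * y ((lexEquiv d s t).symm i).2 := rfl

theorem lexMul_single (s t : P) (j : Fin (d s)) (k : Fin (d t)) :
    lexMul d s t (EuclideanSpace.single j 1) (EuclideanSpace.single k 1) =
      EuclideanSpace.single (lexEquiv d s t (j, k)) 1 := by
  ext i
  obtain ⟨⟨j', k'⟩, rfl⟩ := (lexEquiv d s t).surjective i
  by_cases h : j' = j <;> by_cases h' : k' = k <;> simp [lexMul_apply, h, h']

theorem lex_sigma_ext {s t : P} (h : s = t) (x : EuclideanSpace ℂ (Fin (d s)))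
    (y : EuclideanSpace ℂ (Fin (d t)))
    (hxy : ∀ (i : Fin (d s)) (j : Fin (d t)), (i : ℕ) = j → x i = y j) :
    (⟨s, x⟩ : Σ s, EuclideanSpace ℂ (Fin (d s))) = ⟨t, y⟩ := by
  subst h
  congr 1
  ext i
  exact hxy i i rfl

/-- The lexicographic product system `E(d)` determined by a homomorphism `d` from `P` to the
multiplicative semigroup of positive integers. -/
def lexicographic : ProductSystem P where
  E s := EuclideanSpace ℂ (Fin (d s))
  nontrivial s :=
    haveI : Nonempty (Fin (d s)) := ⟨⟨0, (d s).pos⟩⟩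
    inferInstance
  mul {s t} := lexMul d s t
  mul_assoc {r s t} x y z := by
    refine lex_sigma_ext d (mul_assoc r s t) _ _ fun i j hij => ?_
    simp only [lexMul_apply]
    rw [mul_assoc]
    refine congrArg₂ _ (congrArg x.ofLp (Fin.ext ?_))
      (congrArg₂ _ (congrArg y.ofLp (Fin.ext ?_)) (congrArg z.ofLp (Fin.ext ?_)))
    · simp only [lexEquiv_symm_fst, hij, map_mul, PNat.mul_coe]
      rw [Nat.div_div_eq_div_mul, mul_comm]
    · simp only [lexEquiv_symm_fst, lexEquiv_symm_snd, hij, map_mul, PNat.mul_coe]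
      rw [mul_comm, Nat.mod_mul_right_div_self]
    · simp only [lexEquiv_symm_snd, hij, map_mul, PNat.mul_coe]
      rw [Nat.mod_mul_left_mod]
  inner_mul {s t} x x' y y' := by
    simp only [PiLp.inner_apply, lexMul_apply, RCLike.inner_apply]
    rw [← (lexEquiv d s t).sum_comp, Fintype.sum_prod_type, Finset.sum_mul_sum]
    simp only [Equiv.symm_apply_apply, map_mul]
    exact Finset.sum_congr rfl fun i _ => Finset.sum_congr rfl fun j _ => by ring
  span_mul s t := by
    rw [eq_top_iff, ← (EuclideanSpace.basisFun (Fin (d (s * t))) ℂ).toBasis.span_eq]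
    refine Submodule.span_mono ?_
    rintro _ ⟨i, rfl⟩
    obtain ⟨⟨j, k⟩, rfl⟩ := (lexEquiv d s t).surjective i
    exact ⟨_, _, by simpa using (lexMul_single d s t j k).symm⟩
  finrank_one := by simp
  -- the basis vector `δ 0` of the one-dimensional fiber
  one := WithLp.toLp 2 fun _ => 1
  one_mul {s} x := by
    refine lex_sigma_ext d (one_mul s) _ _ fun i j hij => ?_
    simp only [lexMul_apply, _root_.one_mul]
    refine congrArg x.ofLp (Fin.ext ?_)
    rw [lexEquiv_symm_snd, hij, Nat.mod_eq_of_lt j.2]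
  mul_one {s} x := by
    refine lex_sigma_ext d (mul_one s) _ _ fun i j hij => ?_
    simp only [lexMul_apply, _root_.mul_one]
    refine congrArg x.ofLp (Fin.ext ?_)
    rw [lexEquiv_symm_fst, hij]
    simp

end Lexicographic

/-- The homomorphism `(a, b) ↦ m ^ a * n ^ b` from the additive monoid `ℕ²`. -/
def powHom (m n : ℕ+) : Multiplicative (ℕ × ℕ) →* ℕ+ where
  toFun p := m ^ p.toAdd.1 * n ^ p.toAdd.2
  map_one' := by simp
  map_mul' p q := by
    simp only [toAdd_mul, Prod.fst_add, Prod.snd_add, pow_add]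
    exact mul_mul_mul_comm _ _ _ _

/-- The C*-algebra `𝓞_{E(m, n)}` of the lexicographic product system `E(m, n)` over `ℕ²`
determined by `(a, b) ↦ m ^ a * n ^ b`. -/
abbrev CuntzAlgebra₂ (m n : ℕ+) : Type := (lexicographic (powHom m n)).CuntzAlg

end

/-! Evaluated on basis vectors, a unital Cuntz representation of a lexicographic product system is a
family of isometries `S t j`, `j < d t`, with `S s j * S t k = S (s * t) (j * d t + k)`, whose
ranges are, for each `t`, orthogonal with projections summing to 1. The Cuntz algebra of the system
is unital and is generated by the universal family of this kind (`isUniversalLexFamily_lexGen`); the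
rest of the proof works with such families. The guiding picture is that `S t j` is the contraction y
↦ (y + j) / d t of [0, 1). On ℓ²([0, 1)) these contractions give an actual family, so the algebra is
nonzero.

Irrational case. The map d is then injective on ℕ². The products `S p j * star (S q k)` span a dense
subspace, graded by deg p - deg q in ℤ². Given b ≠ 0, approximate `star b * b` by a finite sum a' of
homogeneous terms. Averaging over roots of unity in the torus, which acts by the gauge action,
isolates the degree-0 term of a'; positivity and continuity bound the averages of `star b * b` below
independently of the order of the roots (`exists_lower_bound`), so this term is not small. It lies
in a matrix algebra, and multiplication by two elements of a fiber compresses it to a scalar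
(`exists_compression`). The remaining terms are affine maps of slope different from 1 with rational
coefficients. They move an irrational point, so compression to a small enough interval around it
kills them (`star_mul_mul_eq_zero`, `eventually_cut_eq_zero`). What remains of `star b * b` is close
to a nonzero scalar, hence invertible, and every nonzero ideal contains a unit (`exists_isUnit`).

Powers of a common base. Let m = l^a and n = l^b with a, b coprime and x a + y b = 1. The family
extends to those fractions p / q of degrees for which d q divides d p (`lexQuot`), and the extension
depends only on the class of p / q in ℤ². The vector (x, y) has dimension l and gives a Cuntz
family; (-b, a) has dimension 1 and gives a unitary commuting with it. These two vectors form a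
basis of ℤ², so the original family is recovered as words in the Cuntz family times powers of the
unitary, and comparing universal properties gives the isomorphism with 𝓞ₗ ⊗ C(𝕋) (`exists_inverse`).
The case m = 1 is l = n, a = 0, b = 1. -/

open scoped CStarAlgebra

noncomputable section

/-! ### Universal property of the C*-algebra of generators and relations -/

namespace CStarRelations

variable {X : Type} {R : CStarRelations X}

/-- Evaluation in a representation as a `*`-homomorphism. -/
def Pre.evalHom (M : R.Model) : R.Pre →⋆ₐ[ℂ] M.B where
  toFun := Pre.eval M
  map_one' := Pre.eval_one M
  map_mul' := Pre.eval_mul M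
  map_zero' := Pre.eval_zero M
  map_add' := Pre.eval_add M
  commutes' c := by
    rw [Algebra.algebraMap_eq_smul_one, Pre.eval_smul, Pre.eval_one,
      Algebra.algebraMap_eq_smul_one]
  map_star' := Pre.eval_star M

/-- The class of a generator. -/
def Pre.gen (x : X) : R.Pre := Pre.mk (.gen x)

@[simp] theorem Pre.evalHom_gen (M : R.Model) (x : X) : Pre.evalHom M (Pre.gen x) = M.φ x := rfl

theorem Pre.hom_ext {a b : R.Pre} (h : ∀ M, Pre.evalHom M a = Pre.evalHom M b) : a = b :=
  Pre.ext h

namespace Universal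

/-- The canonical map from the dense `*`-subalgebra as a `*`-homomorphism. -/
def ofHom : R.Pre →⋆ₐ[ℂ] R.Universal where
  toFun := of
  map_one' := rfl
  map_mul' := of_mul
  map_zero' := rfl
  map_add' := of_add
  commutes' c := by
    rw [Algebra.algebraMap_eq_smul_one, of_smul, Algebra.algebraMap_eq_smul_one]
    rfl
  map_star' a := (star_of a).symm

theorem ofHom_gen (x : X) : ofHom (Pre.gen x : R.Pre) = ι x := rfl

theorem continuous_eval (M : R.Model) : UniformContinuous (Pre.eval M) :=
  (LipschitzWith.of_dist_le_mul (K := 1) fun a b => by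
    rw [dist_eq_norm, dist_eq_norm, ← Pre.eval_sub, NNReal.coe_one, one_mul]
    exact Pre.norm_eval_le M _).uniformContinuous

/-- The extension of the evaluation in a model to the universal C*-algebra. -/
def liftFun (M : R.Model) : R.Universal → M.B := UniformSpace.Completion.extension (Pre.eval M)

theorem liftFun_of (M : R.Model) (a : R.Pre) : liftFun M (of a) = Pre.eval M a :=
  UniformSpace.Completion.extension_coe (continuous_eval M) a

theorem continuous_liftFun (M : R.Model) : Continuous (liftFun M) :=
  UniformSpace.Completion.continuous_extension

/-- The universal property of the universal C*-algebra. -/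
def lift (M : R.Model) : R.Universal →⋆ₐ[ℂ] M.B where
  toFun := liftFun M
  map_one' := (liftFun_of M 1).trans (Pre.eval_one M)
  map_zero' := (liftFun_of M 0).trans (Pre.eval_zero M)
  map_mul' a b := by
    induction a using ind with
    | hc =>
      exact isClosed_eq ((continuous_liftFun M).comp (continuous_id.mul continuous_const))
        ((continuous_liftFun M).mul continuous_const)
    | h a =>
      induction b using ind with
      | hc =>
        exact isClosed_eq ((continuous_liftFun M).comp (continuous_const.mul continuous_id))
          (continuous_const.mul (continuous_liftFun M))
      | h b => rw [← of_mul, liftFun_of, liftFun_of, liftFun_of, Pre.eval_mul]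
  map_add' a b := by
    induction a using ind with
    | hc =>
      exact isClosed_eq ((continuous_liftFun M).comp (continuous_id.add continuous_const))
        ((continuous_liftFun M).add continuous_const)
    | h a =>
      induction b using ind with
      | hc =>
        exact isClosed_eq ((continuous_liftFun M).comp (continuous_const.add continuous_id))
          (continuous_const.add (continuous_liftFun M))
      | h b => rw [← of_add, liftFun_of, liftFun_of, liftFun_of, Pre.eval_add]
  commutes' c := by
    rw [Algebra.algebraMap_eq_smul_one, Algebra.algebraMap_eq_smul_one]
    exact ((congrArg _ (of_smul c 1).symm).trans (liftFun_of M _)).trans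
      ((Pre.eval_smul M 1 c).trans (by rw [Pre.eval_one]))
  map_star' a := by
    induction a using ind with
    | hc =>
      exact isClosed_eq ((continuous_liftFun M).comp continuous_star')
        ((continuous_liftFun M).star)
    | h a => rw [star_of, liftFun_of, liftFun_of, Pre.eval_star]

theorem lift_ι (M : R.Model) (x : X) : lift M (ι x) = M.φ x := liftFun_of M _

theorem of_gen_add (p q : StarPoly X) : of (R := R) (Pre.mk (.add p q)) =
    of (Pre.mk p) + of (Pre.mk q) := of_add (R := R) (Pre.mk p) (Pre.mk q)
theorem of_gen_mul (p q : StarPoly X) : of (R := R) (Pre.mk (.mul p q)) =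
    of (Pre.mk p) * of (Pre.mk q) := of_mul (R := R) (Pre.mk p) (Pre.mk q)
theorem of_gen_conj (p : StarPoly X) : of (R := R) (Pre.mk (.conj p)) =
    star (of (Pre.mk p)) := (star_of (R := R) (Pre.mk p)).symm
theorem of_gen_const (c : ℂ) : of (R := R) (Pre.mk (.const c)) = algebraMap ℂ _ c := by
  rw [Algebra.algebraMap_eq_smul_one]
  change _ = c • of (1 : R.Pre)
  rw [← of_smul]
  congr 1
  exact Pre.ext fun M => by rw [Pre.eval_const, Pre.eval_smul, Pre.eval_one,
    Algebra.algebraMap_eq_smul_one]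

theorem hom_ext {B : Type} [CStarAlgebra B] {f g : R.Universal →⋆ₐ[ℂ] B}
    (h : ∀ x, f (ι x) = g (ι x)) : f = g := by
  ext a
  induction a using ind with
  | hc => exact isClosed_eq (map_continuous f) (map_continuous g)
  | h a =>
    induction a using Pre.ind with | h p
    induction p with
    | gen x => exact h x
    | const c => rw [of_gen_const, AlgHomClass.commutes f, AlgHomClass.commutes g]
    | add p q hp hq => rw [of_gen_add, map_add, map_add, hp, hq]
    | mul p q hp hq => rw [of_gen_mul, map_mul, map_mul, hp, hq]
    | conj p hp => rw [of_gen_conj, map_star, map_star, hp]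

end Universal

end CStarRelations

/-! ### Universal properties of Cuntz algebras and tensor products -/

/-- The generators of the Cuntz algebra form a Cuntz family. -/
theorem isCuntzFamily_ι (n : ℕ) :
    IsCuntzFamily n (CuntzAlgebra n) (CStarRelations.Universal.ι (R := cuntzRelations n)) := by
  constructor
  · intro i
    rw [← CStarRelations.Universal.ofHom_gen, ← map_star, ← map_mul, ← map_one
      (CStarRelations.Universal.ofHom (R := cuntzRelations n))]
    congr 1
    exact CStarRelations.Pre.hom_ext fun M => by
      rw [map_mul, map_star, map_one]
      exact M.rep.1 i
  · simp_rw [← CStarRelations.Universal.ofHom_gen, ← map_star, ← map_mul, ← map_sum]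
    rw [← map_one (CStarRelations.Universal.ofHom (R := cuntzRelations n))]
    congr 1
    exact CStarRelations.Pre.hom_ext fun M => by
      rw [map_sum, map_one]
      simp_rw [map_mul, map_star]
      exact M.rep.2

/-- The homomorphism of the Cuntz algebra determined by a Cuntz family. -/
def CuntzAlgebra.lift {n : ℕ} {B : Type} [CStarAlgebra B] {s : Fin n → B}
    (hs : IsCuntzFamily n B s) : CuntzAlgebra n →⋆ₐ[ℂ] B :=
  CStarRelations.Universal.lift (R := cuntzRelations n) ⟨B, s, hs⟩

theorem CuntzAlgebra.lift_ι {n : ℕ} {B : Type} [CStarAlgebra B] {s : Fin n → B}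
    (hs : IsCuntzFamily n B s) (i : Fin n) :
    CuntzAlgebra.lift hs (CStarRelations.Universal.ι i) = s i :=
  CStarRelations.Universal.lift_ι (R := cuntzRelations n) ⟨B, s, hs⟩ i

namespace CStarTensor

variable {A B : Type} [CStarAlgebra A] [CStarAlgebra B]

open CStarRelations

/-- The canonical homomorphism from the algebraic tensor product. -/
def incl : A ⊗[ℂ] B →⋆ₐ[ℂ] CStarTensor A B where
  toFun := Universal.ι (R := tensorRelations A B)
  map_one' := by
    rw [← Universal.ofHom_gen, ← map_one (Universal.ofHom (R := tensorRelations A B))]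
    refine congrArg _ (Pre.hom_ext fun M => ?_)
    obtain ⟨π, hπ⟩ := M.rep
    simp [← hπ]
  map_zero' := by
    rw [← Universal.ofHom_gen, ← map_zero (Universal.ofHom (R := tensorRelations A B))]
    refine congrArg _ (Pre.hom_ext fun M => ?_)
    obtain ⟨π, hπ⟩ := M.rep
    simp [← hπ]
  map_mul' x y := by
    simp only [← Universal.ofHom_gen]
    rw [← map_mul (Universal.ofHom (R := tensorRelations A B))]
    refine congrArg _ (Pre.hom_ext fun M => ?_)
    obtain ⟨π, hπ⟩ := M.rep
    simp [← hπ]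
  map_add' x y := by
    simp only [← Universal.ofHom_gen]
    rw [← map_add (Universal.ofHom (R := tensorRelations A B))]
    refine congrArg _ (Pre.hom_ext fun M => ?_)
    obtain ⟨π, hπ⟩ := M.rep
    simp [← hπ]
  commutes' c := by
    rw [← Universal.ofHom_gen, ← AlgHomClass.commutes (Universal.ofHom (R := tensorRelations A B))]
    refine congrArg _ (Pre.hom_ext fun M => ?_)
    obtain ⟨π, hπ⟩ := M.rep
    rw [Pre.evalHom_gen, ← hπ, AlgHomClass.commutes, AlgHomClass.commutes]
  map_star' x := by
    simp only [← Universal.ofHom_gen]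
    rw [← map_star (Universal.ofHom (R := tensorRelations A B))]
    refine congrArg _ (Pre.hom_ext fun M => ?_)
    obtain ⟨π, hπ⟩ := M.rep
    simp [← hπ, map_star]

/-- The first factor of a C*-tensor product. -/
def inclLeft : A →⋆ₐ[ℂ] CStarTensor A B :=
  { (incl : A ⊗[ℂ] B →⋆ₐ[ℂ] CStarTensor A B).toAlgHom.comp Algebra.TensorProduct.includeLeft with
    map_star' := fun a => by
      change incl (star a ⊗ₜ 1) = star (incl (a ⊗ₜ 1))
      rw [← map_star, TensorProduct.star_tmul, star_one] }

/-- The second factor of a C*-tensor product. -/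
def inclRight : B →⋆ₐ[ℂ] CStarTensor A B :=
  { (incl : A ⊗[ℂ] B →⋆ₐ[ℂ] CStarTensor A B).toAlgHom.comp Algebra.TensorProduct.includeRight with
    map_star' := fun b => by
      change incl (1 ⊗ₜ star b) = star (incl (1 ⊗ₜ b))
      rw [← map_star, TensorProduct.star_tmul, star_one] }

theorem inclLeft_apply (a : A) : (inclLeft a : CStarTensor A B) = incl (a ⊗ₜ 1) := rfl
theorem inclRight_apply (b : B) : (inclRight b : CStarTensor A B) = incl (1 ⊗ₜ b) := rfl

theorem commute_incl (a : A) (b : B) :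
    Commute (inclLeft a : CStarTensor A B) (inclRight b) := by
  rw [Commute, SemiconjBy, inclLeft_apply, inclRight_apply, ← map_mul, ← map_mul]
  simp

theorem ι_tmul (a : A) (b : B) :
    (Universal.ι (R := tensorRelations A B) (a ⊗ₜ b)) = inclLeft a * inclRight b := by
  rw [inclLeft_apply, inclRight_apply, ← map_mul]
  simp [incl]

/-- The homomorphism determined by commuting homomorphisms of the factors. -/
def liftAlg {D : Type} [CStarAlgebra D] (f : A →⋆ₐ[ℂ] D) (g : B →⋆ₐ[ℂ] D)
    (h : ∀ a b, Commute (f a) (g b)) : A ⊗[ℂ] B →⋆ₐ[ℂ] D :=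
  { Algebra.TensorProduct.lift f.toAlgHom g.toAlgHom h with
    map_star' := fun x => by
      change Algebra.TensorProduct.lift f.toAlgHom g.toAlgHom h (star x) =
        star (Algebra.TensorProduct.lift f.toAlgHom g.toAlgHom h x)
      induction x using TensorProduct.induction_on with
      | zero => simp
      | tmul a b =>
        rw [TensorProduct.star_tmul, Algebra.TensorProduct.lift_tmul,
          Algebra.TensorProduct.lift_tmul, star_mul]
        change f (star a) * g (star b) = star (g b) * star (f a)
        rw [← map_star, ← map_star]
        exact h _ _
      | add x y hx hy => rw [star_add, map_add, map_add, star_add, hx, hy] }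

/-- The homomorphism determined by commuting homomorphisms of the factors. -/
def lift {D : Type} [CStarAlgebra D] (f : A →⋆ₐ[ℂ] D) (g : B →⋆ₐ[ℂ] D)
    (h : ∀ a b, Commute (f a) (g b)) : CStarTensor A B →⋆ₐ[ℂ] D :=
  Universal.lift (R := tensorRelations A B) ⟨D, liftAlg f g h, liftAlg f g h, rfl⟩

theorem lift_ι {D : Type} [CStarAlgebra D] (f : A →⋆ₐ[ℂ] D) (g : B →⋆ₐ[ℂ] D)
    (h : ∀ a b, Commute (f a) (g b)) (x : A ⊗[ℂ] B) :
    lift f g h (Universal.ι x) = liftAlg f g h x :=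
  Universal.lift_ι (R := tensorRelations A B) ⟨D, liftAlg f g h, liftAlg f g h, rfl⟩ x

theorem lift_inclLeft {D : Type} [CStarAlgebra D] (f : A →⋆ₐ[ℂ] D) (g : B →⋆ₐ[ℂ] D)
    (h : ∀ a b, Commute (f a) (g b)) (a : A) : lift f g h (inclLeft a) = f a := by
  refine (lift_ι f g h (a ⊗ₜ 1)).trans ?_
  change Algebra.TensorProduct.lift f.toAlgHom g.toAlgHom h (a ⊗ₜ 1) = f a
  rw [Algebra.TensorProduct.lift_tmul, map_one, mul_one]
  rfl

theorem lift_inclRight {D : Type} [CStarAlgebra D] (f : A →⋆ₐ[ℂ] D) (g : B →⋆ₐ[ℂ] D)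
    (h : ∀ a b, Commute (f a) (g b)) (b : B) : lift f g h (inclRight b) = g b := by
  refine (lift_ι f g h (1 ⊗ₜ b)).trans ?_
  change Algebra.TensorProduct.lift f.toAlgHom g.toAlgHom h (1 ⊗ₜ b) = g b
  rw [Algebra.TensorProduct.lift_tmul, map_one, one_mul]
  rfl

theorem hom_ext {D : Type} [CStarAlgebra D] {f g : CStarTensor A B →⋆ₐ[ℂ] D}
    (hl : ∀ a, f (inclLeft a) = g (inclLeft a)) (hr : ∀ b, f (inclRight b) = g (inclRight b)) :
    f = g := by
  refine Universal.hom_ext fun x => ?_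
  have key : ∀ x : A ⊗[ℂ] B, f (incl x) = g (incl x) := fun x => by
    induction x using TensorProduct.induction_on with
    | zero => simp
    | tmul a b =>
      have := ι_tmul a b
      change incl (a ⊗ₜ b) = _ at this
      rw [this, map_mul, map_mul, hl, hr]
    | add x y hx hy => rw [map_add, map_add, map_add, hx, hy]
  exact key x

end CStarTensor

/-! ### Lexicographic families of isometries -/

/-- A C*-algebra with an identity element is a unital C*-algebra. -/
abbrev CStarAlgebra.ofIdentity (A : Type) [h : NonUnitalCStarAlgebra A] (e : A)
    (hl : ∀ a, e * a = a) (hr : ∀ a, a * e = a) : CStarAlgebra A :=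
  letI r : NormedRing A :=
    { h.toNonUnitalNormedRing with
      one := e
      one_mul := hl
      mul_one := hr }
  letI alg : Algebra ℂ A := Algebra.ofModule (fun c a b => smul_mul_assoc c a b)
    (fun c a b => mul_smul_comm c a b)
  { h, r with
    toAlgebra := alg
    norm_smul_le := fun c a => norm_smul_le c a }

/-- A lexicographic family: elements `S t j`, `j < d t`, of a C*-algebra which are the images of the
basis vectors under a unital Cuntz representation of the lexicographic product system of `d`. -/
structure IsLexFamily {P : Type} [Monoid P] (d : P →* ℕ+) {B : Type} [CStarAlgebra B]
    (S : P → ℕ → B) : Prop where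
  map_mul : ∀ {s t : P} {j k : ℕ}, j < d s → k < d t → S s j * S t k = S (s * t) (j * d t + k)
  star_mul : ∀ {t : P} {j k : ℕ}, j < d t → k < d t →
    star (S t j) * S t k = if j = k then 1 else 0
  sum_mul_star : ∀ t : P, ∑ j ∈ Finset.range (d t), S t j * star (S t j) = 1

/-- A universal lexicographic family. -/
structure IsUniversalLexFamily {P : Type} [Monoid P] (d : P →* ℕ+) {A : Type} [CStarAlgebra A]
    (S : P → ℕ → A) : Prop extends IsLexFamily d S where
  exists_lift : ∀ {B : Type} [CStarAlgebra B] {T : P → ℕ → B}, IsLexFamily d T →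
    ∃ f : A →⋆ₐ[ℂ] B, ∀ (t : P) (j : ℕ), j < d t → f (S t j) = T t j
  dense : (StarAlgebra.adjoin ℂ {x | ∃ (t : P) (j : ℕ), j < d t ∧ x = S t j}).topologicalClosure = ⊤

theorem IsUniversalLexFamily.hom_ext {P : Type} [Monoid P] {d : P →* ℕ+} {A : Type}
    [CStarAlgebra A] {S : P → ℕ → A} (hS : IsUniversalLexFamily d S) {B : Type} [CStarAlgebra B]
    {f g : A →⋆ₐ[ℂ] B} (h : ∀ (t : P) (j : ℕ), j < d t → f (S t j) = g (S t j)) : f = g := by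
  ext a
  have ha : a ∈ (StarAlgebra.adjoin ℂ {x | ∃ (t : P) (j : ℕ), j < d t ∧ x = S t j}).topologicalClosure := by
    rw [hS.dense]; trivial
  have hle : (StarAlgebra.adjoin ℂ {x | ∃ (t : P) (j : ℕ), j < d t ∧ x = S t j}).topologicalClosure ≤
      StarAlgHom.equalizer f g := by
    refine StarSubalgebra.topologicalClosure_minimal ?_
      (isClosed_eq (map_continuous f) (map_continuous g))
    refine StarAlgebra.adjoin_le ?_
    rintro _ ⟨t, j, hj, rfl⟩
    exact h t j hj
  exact hle ha

/-! ### From lexicographic families to Cuntz representations -/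

section Representation

variable {P : Type} [Monoid P] (d : P →* ℕ+)

/-- The map on the total space determined by a lexicographic family. -/
def lexRep {B : Type} [CStarAlgebra B] (S : P → ℕ → B) :
    (Σ s, (lexicographic d).E s) → B :=
  fun x => ∑ i : Fin (d x.1), WithLp.ofLp (p := 2) (V := Fin (d x.1) → ℂ) x.2 i • S x.1 i

theorem lexRep_apply {B : Type} [CStarAlgebra B] (S : P → ℕ → B) (t : P)
    (x : EuclideanSpace ℂ (Fin (d t))) : lexRep d S ⟨t, x⟩ = ∑ i, x i • S t i := rfl

variable {d}

/-- An idempotent isometry is the identity. -/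
theorem IsLexFamily.one {B : Type} [CStarAlgebra B] {S : P → ℕ → B}
    (hS : IsLexFamily d S) : S 1 0 = 1 := by
  have h1 : (d 1 : ℕ) = 1 := by simp
  have h2 := hS.map_mul (s := 1) (t := 1) (j := 0) (k := 0) (by simp) (by simp)
  have h3 := hS.star_mul (t := 1) (j := 0) (k := 0) (by simp) (by simp)
  simp only [mul_one, zero_mul, add_zero, if_true] at h2 h3
  calc S 1 0 = 1 * S 1 0 := (one_mul _).symm
    _ = star (S 1 0) * S 1 0 * S 1 0 := by rw [h3]
    _ = 1 := by rw [mul_assoc, h2, h3]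

theorem lexRep_one {B : Type} [CStarAlgebra B] {S : P → ℕ → B}
    (hS : IsLexFamily d S) : lexRep d S ⟨1, (lexicographic d).one⟩ = 1 := by
  have h1 : (d 1 : ℕ) = 1 := by simp
  have : lexRep d S ⟨1, (lexicographic d).one⟩ = ∑ i : Fin (d 1), S 1 i := by
    refine Finset.sum_congr rfl fun i _ => ?_
    exact one_smul ℂ (S 1 i)
  rw [this, Finset.sum_eq_single (⟨0, by simp⟩ : Fin (d 1)), hS.one]
  · intro i _ hi
    exact absurd (Fin.ext (by have := i.2; simp; omega)) hi
  · simp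

theorem IsLexFamily.sum_mul {B : Type} [CStarAlgebra B] {S : P → ℕ → B}
    (hS : IsLexFamily d S) {s t : P} (x : EuclideanSpace ℂ (Fin (d s)))
    (y : EuclideanSpace ℂ (Fin (d t))) :
    ∑ i, lexMul d s t x y i • S (s * t) i = (∑ i, x i • S s i) * ∑ i, y i • S t i := by
  rw [← (lexEquiv d s t).sum_comp, Fintype.sum_prod_type, Finset.sum_mul_sum]
  refine Finset.sum_congr rfl fun i _ => Finset.sum_congr rfl fun j _ => ?_
  rw [lexMul_apply, Equiv.symm_apply_apply, lexEquiv_apply, smul_mul_smul_comm,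
    hS.map_mul i.2 j.2]

theorem IsLexFamily.star_sum_mul_sum {B : Type} [CStarAlgebra B] {S : P → ℕ → B}
    (hS : IsLexFamily d S) {s : P} (x y : EuclideanSpace ℂ (Fin (d s))) :
    star (∑ i, y i • S s i) * ∑ i, x i • S s i = (inner ℂ y x : ℂ) • 1 := by
  rw [star_sum, Finset.sum_mul_sum, PiLp.inner_apply, Finset.sum_smul]
  refine Finset.sum_congr rfl fun i _ => ?_
  rw [Finset.sum_eq_single i]
  · rw [star_smul, smul_mul_smul_comm, hS.star_mul i.2 i.2, if_pos rfl]
    simp [mul_comm]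
  · intro j _ hj
    rw [star_smul, smul_mul_smul_comm, hS.star_mul i.2 j.2,
      if_neg fun h => hj (Fin.ext h.symm), smul_zero]
  · simp

/-- The matrix passing from the standard basis to `f` is unitary, so the mixed terms `S t j * star
(S t k)` cancel and the sum is the one for the standard basis. -/
theorem IsLexFamily.sum_orthonormalBasis {B : Type} [CStarAlgebra B] {S : P → ℕ → B}
    (hS : IsLexFamily d S) {t : P} {ι : Type} [Fintype ι]
    (f : OrthonormalBasis ι ℂ (EuclideanSpace ℂ (Fin (d t)))) :
    ∑ i, (∑ j, f i j • S t j) * star (∑ j, f i j • S t j) = 1 := by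
  have key : ∀ j k : Fin (d t), ∑ i, f i j * star (f i k) = if j = k then 1 else 0 := by
    intro j k
    have := f.sum_inner_mul_inner (EuclideanSpace.single j (1 : ℂ)) (EuclideanSpace.single k 1)
    simp only [EuclideanSpace.inner_single_left, EuclideanSpace.inner_single_right] at this
    simpa [Pi.single_apply, eq_comm] using this
  calc _ = ∑ i, ∑ j : Fin (d t), ∑ k : Fin (d t),
        (f i j * star (f i k)) • (S t j * star (S t k)) := by
        refine Finset.sum_congr rfl fun i _ => ?_
        rw [star_sum, Finset.sum_mul_sum]
        refine Finset.sum_congr rfl fun j _ => Finset.sum_congr rfl fun k _ => ?_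
        rw [star_smul, smul_mul_smul_comm]
    _ = ∑ j : Fin (d t), ∑ k : Fin (d t),
        (∑ i, f i j * star (f i k)) • (S t j * star (S t k)) := by
        rw [Finset.sum_comm]
        refine Finset.sum_congr rfl fun j _ => ?_
        rw [Finset.sum_comm]
        refine Finset.sum_congr rfl fun k _ => ?_
        rw [Finset.sum_smul]
    _ = ∑ j : Fin (d t), S t j * star (S t j) := by
        refine Finset.sum_congr rfl fun j _ => ?_
        simp_rw [key]
        simp
    _ = 1 := by
        rw [← hS.sum_mul_star t, Finset.sum_range]

theorem IsLexFamily.isCuntzRepresentation {B : Type} [CStarAlgebra B] {S : P → ℕ → B}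
    (hS : IsLexFamily d S) : (lexicographic d).IsCuntzRepresentation (lexRep d S) where
  map_mul x y := hS.sum_mul x y
  star_mul x y := by
    rw [lexRep_one hS]
    exact hS.star_sum_mul_sum x y
  sum_basis f := by
    rw [lexRep_one hS]
    exact hS.sum_orthonormalBasis f

end Representation

/-! ### The universal Cuntz representation -/

namespace ProductSystem

variable {P : Type} [Monoid P] (S : ProductSystem P)

/-- Each relation is an identity of `*`-polynomials that holds in every model, hence already in the
dense subalgebra `Pre`. -/
theorem isCuntzRepresentation_ι :
    S.IsCuntzRepresentation (CStarRelations.Universal.ι (R := S.relations)) where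
  map_mul x y := by
    simp only [← CStarRelations.Universal.ofHom_gen]
    rw [← map_mul]
    refine congrArg _ (CStarRelations.Pre.hom_ext fun M => ?_)
    rw [map_mul]
    exact M.rep.map_mul x y
  star_mul x y := by
    simp only [← CStarRelations.Universal.ofHom_gen]
    rw [← map_star, ← map_mul, ← map_smul]
    refine congrArg _ (CStarRelations.Pre.hom_ext fun M => ?_)
    rw [map_mul, map_star, map_smul]
    exact M.rep.star_mul x y
  sum_basis f := by
    simp only [← CStarRelations.Universal.ofHom_gen]
    simp_rw [← map_star, ← map_mul, ← map_sum]
    refine congrArg _ (CStarRelations.Pre.hom_ext fun M => ?_)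
    rw [map_sum]
    simp_rw [map_mul, map_star]
    exact M.rep.sum_basis f

/-- The universal Cuntz representation. -/
def cuntzRep (x : Σ s, S.E s) : S.CuntzAlg :=
  ⟨CStarRelations.Universal.ι (R := S.relations) x,
    NonUnitalStarSubalgebra.le_topologicalClosure _
      (NonUnitalStarAlgebra.subset_adjoin ℂ _ (Set.mem_range_self x))⟩

theorem isCuntzRepresentation_cuntzRep : S.IsCuntzRepresentation S.cuntzRep where
  map_mul x y := Subtype.ext (S.isCuntzRepresentation_ι.map_mul x y)
  star_mul x y := Subtype.ext (S.isCuntzRepresentation_ι.star_mul x y)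
  sum_basis f := Subtype.ext (by
    refine (map_sum (NonUnitalStarSubalgebraClass.subtype S.cuntzSubalgebra) _ _).trans ?_
    exact S.isCuntzRepresentation_ι.sum_basis f)

theorem cuntzAlg_induction {motive : S.CuntzAlg → Prop} (hc : IsClosed {a | motive a})
    (gen : ∀ x, motive (S.cuntzRep x)) (zero : motive 0)
    (add : ∀ a b, motive a → motive b → motive (a + b))
    (mul : ∀ a b, motive a → motive b → motive (a * b))
    (smul : ∀ (c : ℂ) a, motive a → motive (c • a))
    (star : ∀ a, motive a → motive (star a)) (a : S.CuntzAlg) : motive a := by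
  have hle : ∀ x (hx : x ∈ NonUnitalStarAlgebra.adjoin ℂ
      (Set.range (CStarRelations.Universal.ι (R := S.relations)))),
      motive ⟨x, NonUnitalStarSubalgebra.le_topologicalClosure _ hx⟩ := by
    intro x hx
    induction hx using NonUnitalStarAlgebra.adjoin_induction with
    | mem x hx => obtain ⟨y, rfl⟩ := hx; exact gen y
    | zero => exact zero
    | add x y hx hy h1 h2 => exact add _ _ h1 h2
    | mul x y hx hy h1 h2 => exact mul _ _ h1 h2
    | smul c x hx h => exact smul c _ h
    | star x hx h => exact star _ h
  have hd : ∀ a : S.CuntzAlg, a ∈ closure {b : S.CuntzAlg |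
      (b : S.relations.Universal) ∈ NonUnitalStarAlgebra.adjoin ℂ
        (Set.range (CStarRelations.Universal.ι (R := S.relations)))} := by
    intro a
    rw [closure_subtype]
    have : (a : S.relations.Universal) ∈ closure ((NonUnitalStarAlgebra.adjoin ℂ
        (Set.range (CStarRelations.Universal.ι (R := S.relations))) :
          Set S.relations.Universal)) := a.2
    refine closure_mono ?_ this
    intro x hx
    exact ⟨⟨x, NonUnitalStarSubalgebra.le_topologicalClosure _ hx⟩, hx, rfl⟩
  exact (hc.closure_subset_iff.2 fun b hb => hle b.1 hb) (hd a)

end ProductSystem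

/-! ### The Cuntz algebra is generated by a universal lexicographic family -/

section UniversalLex

variable {P : Type} [Monoid P] (d : P →* ℕ+)

/-- The identity of the Cuntz algebra of a lexicographic product system. -/
def lexUnit : (lexicographic d).CuntzAlg :=
  (lexicographic d).cuntzRep ⟨1, (lexicographic d).one⟩

theorem inner_lexOne :
    (inner ℂ (lexicographic d).one (lexicographic d).one : ℂ) = 1 := by
  change (inner ℂ (WithLp.toLp 2 fun _ => 1 : EuclideanSpace ℂ (Fin (d 1)))
    (WithLp.toLp 2 fun _ => 1) : ℂ) = 1
  rw [PiLp.inner_apply]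
  simp

theorem star_lexUnit_mul : star (lexUnit d) * lexUnit d = lexUnit d := by
  have h := (lexicographic d).isCuntzRepresentation_cuntzRep.star_mul
    (lexicographic d).one (lexicographic d).one
  rwa [inner_lexOne, one_smul] at h

theorem star_lexUnit : star (lexUnit d) = lexUnit d := by
  rw [← star_lexUnit_mul, star_mul, star_star]

theorem lexUnit_mul_cuntzRep (x) :
    lexUnit d * (lexicographic d).cuntzRep x = (lexicographic d).cuntzRep x := by
  obtain ⟨s, x⟩ := x
  have h := (lexicographic d).isCuntzRepresentation_cuntzRep.map_mul (lexicographic d).one x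
  rw [(lexicographic d).one_mul] at h
  exact h.symm

theorem cuntzRep_mul_lexUnit (x) :
    (lexicographic d).cuntzRep x * lexUnit d = (lexicographic d).cuntzRep x := by
  obtain ⟨s, x⟩ := x
  have h := (lexicographic d).isCuntzRepresentation_cuntzRep.map_mul x (lexicographic d).one
  rw [(lexicographic d).mul_one] at h
  exact h.symm

/-- Both sides are proved together because the adjoint exchanges them in the induction. -/
theorem lexUnit_mul_and (a : (lexicographic d).CuntzAlg) :
    lexUnit d * a = a ∧ a * lexUnit d = a := by
  induction a using (lexicographic d).cuntzAlg_induction with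
  | hc =>
    exact (isClosed_eq (continuous_const.mul continuous_id) continuous_id).inter
      (isClosed_eq (continuous_id.mul continuous_const) continuous_id)
  | gen x => exact ⟨lexUnit_mul_cuntzRep d x, cuntzRep_mul_lexUnit d x⟩
  | zero => simp
  | add a b ha hb => rw [mul_add, add_mul, ha.1, ha.2, hb.1, hb.2]; simp
  | mul a b ha hb => rw [← mul_assoc, ha.1, mul_assoc, hb.2]; simp
  | smul c a ha => rw [mul_smul_comm, smul_mul_assoc, ha.1, ha.2]; simp
  | star a ha =>
    constructor
    · rw [← star_lexUnit, ← star_mul, ha.2]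
    · rw [← star_lexUnit, ← star_mul, ha.1]

/-- The Cuntz algebra of a lexicographic product system is unital. -/
abbrev lexCStarAlgebra : CStarAlgebra (lexicographic d).CuntzAlg :=
  CStarAlgebra.ofIdentity _ (lexUnit d) (fun a => (lexUnit_mul_and d a).1)
    fun a => (lexUnit_mul_and d a).2

/-- The images of the basis vectors in the Cuntz algebra. -/
def lexGen (t : P) (j : ℕ) : (lexicographic d).CuntzAlg :=
  if h : j < d t then
    (lexicographic d).cuntzRep ⟨t, (EuclideanSpace.single ⟨j, h⟩ 1 : EuclideanSpace ℂ (Fin (d t)))⟩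
  else 0

theorem lexGen_of_lt {t : P} {j : ℕ} (h : j < d t) : lexGen d t j = (lexicographic d).cuntzRep
    ⟨t, (EuclideanSpace.single ⟨j, h⟩ 1 : EuclideanSpace ℂ (Fin (d t)))⟩ := dif_pos h

theorem lexGen_fin {t : P} (j : Fin (d t)) : lexGen d t j = (lexicographic d).cuntzRep
    ⟨t, (EuclideanSpace.single j 1 : EuclideanSpace ℂ (Fin (d t)))⟩ := dif_pos j.2

theorem isLexFamily_lexGen :
    letI := lexCStarAlgebra d
    IsLexFamily d (lexGen d) := by
  let _ := lexCStarAlgebra d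
  have hrep := (lexicographic d).isCuntzRepresentation_cuntzRep
  constructor
  · intro s t j k hj hk
    have hjk : j * d t + k < d (s * t) := by
      have := (lexEquiv d s t (⟨j, hj⟩, ⟨k, hk⟩)).2
      rwa [lexEquiv_apply] at this
    rw [lexGen_of_lt d hj, lexGen_of_lt d hk, lexGen_of_lt d hjk]
    refine (hrep.map_mul _ _).symm.trans (congrArg _ ?_)
    refine congrArg (Sigma.mk (s * t)) ((lexMul_single d s t _ _).trans ?_)
    congr 1
    exact Fin.ext (lexEquiv_apply d s t _ _)
  · intro t j k hj hk
    rw [lexGen_of_lt d hj, lexGen_of_lt d hk]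
    refine (hrep.star_mul _ _).trans ?_
    have : (inner ℂ (EuclideanSpace.single ⟨j, hj⟩ 1 : EuclideanSpace ℂ (Fin (d t)))
        (EuclideanSpace.single ⟨k, hk⟩ 1) : ℂ) = if j = k then 1 else 0 := by
      simp [EuclideanSpace.inner_single_left, Fin.ext_iff]
    change (inner ℂ (EuclideanSpace.single ⟨j, hj⟩ 1 : EuclideanSpace ℂ (Fin (d t)))
        (EuclideanSpace.single ⟨k, hk⟩ 1) : ℂ) • lexUnit d = _
    rw [this]
    split_ifs
    · exact one_smul ℂ _
    · exact zero_smul ℂ _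
  · intro t
    rw [Finset.sum_range]
    simp_rw [lexGen_fin]
    refine Eq.trans ?_ (hrep.sum_basis (EuclideanSpace.basisFun (Fin (d t)) ℂ))
    refine Finset.sum_congr rfl fun i _ => ?_
    have h : (EuclideanSpace.basisFun (Fin (d t)) ℂ) i = EuclideanSpace.single i 1 :=
      EuclideanSpace.basisFun_apply _ _ _
    have h' : (lexicographic d).cuntzRep ⟨t, (EuclideanSpace.basisFun (Fin (d t)) ℂ) i⟩ =
      (lexicographic d).cuntzRep ⟨t, (EuclideanSpace.single i 1 : EuclideanSpace ℂ (Fin (d t)))⟩ :=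
      congrArg (fun x => (lexicographic d).cuntzRep ⟨t, x⟩) h
    exact congrArg (fun x => x * star x) h'.symm

/-- Linearity on fibers is automatic: the inner product formula makes the defect `z` orthogonal to
the image of every vector of the fiber, so `star z * z = 0`. -/
theorem ProductSystem.IsRepresentation.map_linear {S : ProductSystem P} {B : Type}
    [NonUnitalCStarAlgebra B] {φ : (Σ s, S.E s) → B} (hφ : S.IsRepresentation φ) {s : P}
    {ι : Type} (I : Finset ι) (c : ι → ℂ) (v : ι → S.E s) :
    φ ⟨s, ∑ i ∈ I, c i • v i⟩ = ∑ i ∈ I, c i • φ ⟨s, v i⟩ := by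
  set z := φ ⟨s, ∑ i ∈ I, c i • v i⟩ - ∑ i ∈ I, c i • φ ⟨s, v i⟩ with hz
  have h : ∀ w, star (φ ⟨s, w⟩) * z = 0 := fun w => by
    rw [hz, mul_sub, Finset.mul_sum, hφ.star_mul, inner_sum, Finset.sum_smul, sub_eq_zero]
    refine Finset.sum_congr rfl fun i _ => ?_
    rw [mul_smul_comm, hφ.star_mul, inner_smul_right, mul_smul]
  rw [← sub_eq_zero, ← hz, ← CStarRing.star_mul_self_eq_zero_iff]
  nth_rewrite 1 [hz]
  rw [star_sub, sub_mul, h, star_sum, Finset.sum_mul, Finset.sum_eq_zero, sub_zero]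
  intro i _
  rw [star_smul, smul_mul_assoc, h, smul_zero]

theorem isUniversalLexFamily_lexGen :
    letI := lexCStarAlgebra d
    IsUniversalLexFamily d (lexGen d) := by
  let _ := lexCStarAlgebra d
  have hrep := (lexicographic d).isCuntzRepresentation_cuntzRep
  refine { isLexFamily_lexGen d with exists_lift := ?_, dense := ?_ }
  · intro B _ T hT
    let F := CStarRelations.Universal.lift (R := (lexicographic d).relations)
      ⟨B, lexRep d T, hT.isCuntzRepresentation⟩
    have hF : ∀ x, F ((lexicographic d).cuntzRep x : (lexicographic d).CuntzAlg).1 =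
      lexRep d T x := fun x => CStarRelations.Universal.lift_ι
        (R := (lexicographic d).relations) ⟨B, lexRep d T, hT.isCuntzRepresentation⟩ x
    -- The identity of the Cuntz algebra need not be that of the ambient universal algebra, so
    -- unitality of the restriction of `F` is checked on `lexUnit`.
    have h1 : F (lexUnit d).1 = 1 := (hF _).trans (lexRep_one hT)
    refine ⟨{ toFun := fun a => F a.1
              map_one' := h1
              map_mul' := fun a b => map_mul F a.1 b.1
              map_zero' := map_zero F
              map_add' := fun a b => map_add F a.1 b.1
              commutes' := fun c => ?_
              map_star' := fun a => map_star F a.1 }, fun t j hj => ?_⟩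
    · rw [Algebra.algebraMap_eq_smul_one, Algebra.algebraMap_eq_smul_one]
      exact (map_smul F c (lexUnit d).1).trans (congrArg _ h1)
    · refine ((congrArg (fun a => F a.1) (lexGen_of_lt d hj)).trans (hF _)).trans ?_
      refine (lexRep_apply d T t _).trans ?_
      rw [Finset.sum_eq_single ⟨j, hj⟩]
      · simp
      · intro i _ hi
        simp [hi]
      · simp
  · refine eq_top_iff.2 fun a ha => ?_
    clear ha
    induction a using (lexicographic d).cuntzAlg_induction with
    | hc => exact StarSubalgebra.isClosed_topologicalClosure _
    | gen x =>
      obtain ⟨t, x⟩ := x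
      refine StarSubalgebra.le_topologicalClosure _ ?_
      have hx : (⟨t, x⟩ : Σ s, (lexicographic d).E s) = ⟨t, ∑ i : Fin (d t),
        WithLp.ofLp (p := 2) (V := Fin (d t) → ℂ) x i •
          (EuclideanSpace.single i 1 : EuclideanSpace ℂ (Fin (d t)))⟩ := by
        refine congrArg (Sigma.mk t) ?_
        have := (EuclideanSpace.basisFun (Fin (d t)) ℂ).sum_repr x
        simp only [EuclideanSpace.basisFun_apply] at this
        exact this.symm
      rw [hx]
      refine (congrArg (· ∈ _) (hrep.map_linear (S := lexicographic d) (s := t) Finset.univ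
        (fun i : Fin (d t) => WithLp.ofLp (p := 2) (V := Fin (d t) → ℂ) x i)
        (fun i => (EuclideanSpace.single i 1 : EuclideanSpace ℂ (Fin (d t)))))).mpr ?_
      refine sum_mem fun i _ => ?_
      refine SMulMemClass.smul_mem _ (StarAlgebra.subset_adjoin ℂ _ ⟨t, i, i.2, ?_⟩)
      exact (lexGen_fin d i).symm
    | zero => exact zero_mem _
    | add a b ha hb => exact add_mem ha hb
    | mul a b ha hb => exact mul_mem ha hb
    | smul c a ha => exact SMulMemClass.smul_mem c ha
    | star a ha => exact star_mem ha

end UniversalLex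

/-! ### Products of isometries, matrix units and compressions -/

section Families

variable {P : Type} [CommMonoid P] {d : P →* ℕ+} {A : Type} [CStarAlgebra A] {S : P → ℕ → A}

theorem lexIndex_lt (d : P →* ℕ+) {s t : P} {j k : ℕ} (hj : j < d s) (hk : k < d t) :
    j * d t + k < d (s * t) := by
  have := (lexEquiv d s t (⟨j, hj⟩, ⟨k, hk⟩)).2
  rwa [lexEquiv_apply] at this

theorem IsLexFamily.expand (hS : IsLexFamily d S) {p : P} (q : P) {j : ℕ} (hj : j < d p) :
    S p j = ∑ e ∈ Finset.range (d q), S (p * q) (j * d q + e) * star (S q e) := by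
  conv_lhs => rw [← mul_one (S p j), ← hS.sum_mul_star q, Finset.mul_sum]
  refine Finset.sum_congr rfl fun e he => ?_
  rw [← mul_assoc, hS.map_mul hj (Finset.mem_range.1 he)]

/-- Both factors are refined to the common degree `p * q`, where orthogonality decides which pairs
survive. This lets adjoints be moved to the right in any product. -/
theorem IsLexFamily.star_mul_eq (hS : IsLexFamily d S) {p q : P} {j k : ℕ} (hj : j < d p)
    (hk : k < d q) : star (S q k) * S p j =
      ∑ e ∈ Finset.range (d p), ∑ e' ∈ Finset.range (d q),
        if k * d p + e = j * d q + e' then S p e * star (S q e') else 0 := by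
  rw [hS.expand p hk, hS.expand q hj, star_sum, Finset.sum_mul_sum]
  refine Finset.sum_congr rfl fun e he => Finset.sum_congr rfl fun e' he' => ?_
  rw [Finset.mem_range] at he he'
  have h1 := lexIndex_lt d hk he
  have h2 := lexIndex_lt d hj he'
  rw [mul_comm p q] at h2 ⊢
  rw [StarMul.star_mul, star_star, mul_assoc, ← mul_assoc (star (S (q * p) _)), hS.star_mul h1 h2]
  split_ifs <;> simp

/-- Inserting the resolution of 1 of degree `r` refines a product without changing its degree; for
`p = q` this is the embedding of matrix units of size `d p` into those of size `d (p * r)`. -/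
theorem IsLexFamily.mul_star_expand (hS : IsLexFamily d S) {p q : P} (r : P) {j k : ℕ}
    (hj : j < d p) (hk : k < d q) : S p j * star (S q k) =
      ∑ e ∈ Finset.range (d r), S (p * r) (j * d r + e) * star (S (q * r) (k * d r + e)) := by
  conv_lhs => rw [← mul_one (S p j), ← hS.sum_mul_star r, Finset.mul_sum, Finset.sum_mul]
  refine Finset.sum_congr rfl fun e he => ?_
  rw [← mul_assoc, hS.map_mul hj (Finset.mem_range.1 he), mul_assoc, ← StarMul.star_mul,
    hS.map_mul hk (Finset.mem_range.1 he)]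

/-- The matrix units `S t j * star (S t k)` define a homomorphism. -/
def IsLexFamily.matrixHom (hS : IsLexFamily d S) (t : P) :
    Matrix (Fin (d t)) (Fin (d t)) ℂ →⋆ₐ[ℂ] A where
  toFun M := ∑ j, ∑ k, M j k • (S t j * star (S t k))
  map_one' := by
    rw [← hS.sum_mul_star t, Finset.sum_range]
    simp [Matrix.one_apply]
  map_zero' := by simp
  map_add' M N := by simp [add_smul, Finset.sum_add_distrib]
  map_mul' M N := by
    have key : ∀ j k j' k' : Fin (d t), (S t j * star (S t k)) * (S t j' * star (S t k')) =
        if k = j' then S t j * star (S t k') else 0 := fun j k j' k' => by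
      rw [mul_assoc, ← mul_assoc (star (S t k)), hS.star_mul k.2 j'.2]
      simp only [Fin.ext_iff]
      split_ifs <;> simp
    rw [Finset.sum_mul]
    refine Finset.sum_congr rfl fun j _ => ?_
    simp only [Matrix.mul_apply, Finset.sum_smul]
    rw [Finset.sum_comm, Finset.sum_mul]
    refine Finset.sum_congr rfl fun k _ => Eq.symm ?_
    rw [Finset.mul_sum, Finset.sum_eq_single k]
    · rw [Finset.mul_sum]
      refine Finset.sum_congr rfl fun k' _ => ?_
      rw [smul_mul_smul_comm, key, if_pos rfl]
    · intro j' _ hj'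
      rw [Finset.mul_sum]
      refine Finset.sum_eq_zero fun k' _ => ?_
      rw [smul_mul_smul_comm, key, if_neg (Ne.symm hj'), smul_zero]
    · simp
  commutes' c := by
    rw [Algebra.algebraMap_eq_smul_one (A := A), ← hS.sum_mul_star t, Finset.sum_range,
      Finset.smul_sum]
    simp [Matrix.algebraMap_matrix_apply]
  map_star' M := by
    rw [star_sum]
    refine (Finset.sum_comm).trans (Finset.sum_congr rfl fun j _ => ?_)
    rw [star_sum]
    refine Finset.sum_congr rfl fun k _ => ?_
    rw [star_smul, StarMul.star_mul, star_star, Matrix.star_apply]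

theorem IsLexFamily.matrixHom_apply (hS : IsLexFamily d S) (t : P)
    (M : Matrix (Fin (d t)) (Fin (d t)) ℂ) :
    hS.matrixHom t M = ∑ j, ∑ k, M j k • (S t j * star (S t k)) := rfl

theorem IsLexFamily.matrixHom_single (hS : IsLexFamily d S) (t : P) (j k : Fin (d t)) :
    hS.matrixHom t (Matrix.single j k 1) = S t j * star (S t k) := by
  rw [hS.matrixHom_apply, Finset.sum_eq_single j, Finset.sum_eq_single k]
  · simp
  · intro b _ hb
    simp [hb.symm]
  · simp
  · intro b _ hb
    simp [hb.symm]
  · simp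

/-- The image of the fiber at `t` is the standard module of the matrix algebra at `t`. -/
theorem IsLexFamily.matrixHom_mul_sum (hS : IsLexFamily d S) (t : P)
    (M : Matrix (Fin (d t)) (Fin (d t)) ℂ) (x : EuclideanSpace ℂ (Fin (d t))) :
    hS.matrixHom t M * ∑ i, x i • S t i =
      ∑ i, (Matrix.toEuclideanCLM (𝕜 := ℂ) M x) i • S t i := by
  have key : ∀ j k i : Fin (d t), (S t j * star (S t k)) * S t i =
      if k = i then S t j else 0 := fun j k i => by
    rw [mul_assoc, hS.star_mul k.2 i.2]
    simp only [Fin.ext_iff]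
    split_ifs <;> simp
  rw [hS.matrixHom_apply]
  rw [Finset.sum_mul]
  refine Finset.sum_congr rfl fun j _ => ?_
  rw [Matrix.ofLp_toEuclideanCLM, Matrix.mulVec, dotProduct, Finset.sum_smul, Finset.sum_mul]
  refine Finset.sum_congr rfl fun k _ => ?_
  rw [Finset.mul_sum, Finset.sum_eq_single k]
  · rw [smul_mul_smul_comm, key, if_pos rfl]
  · intro i _ hi
    rw [smul_mul_smul_comm, key, if_neg (Ne.symm hi), smul_zero]
  · simp

theorem IsLexFamily.norm_sum_le (hS : IsLexFamily d S) {t : P}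
    (x : EuclideanSpace ℂ (Fin (d t))) : ‖∑ i, x i • S t i‖ ≤ ‖x‖ := by
  have h := CStarRing.norm_star_mul_self (x := ∑ i, x i • S t i)
  rw [hS.star_sum_mul_sum, inner_self_eq_norm_sq_to_K, norm_smul] at h
  simp only [Complex.coe_algebraMap, norm_pow, Complex.norm_real, norm_norm] at h
  have h1 : ‖∑ i, x i • S t i‖ ^ 2 ≤ ‖x‖ ^ 2 := by
    rw [sq, ← h]
    nlinarith [sq_nonneg ‖x‖, norm_one_le A]
  exact (sq_le_sq₀ (norm_nonneg _) (norm_nonneg _)).1 h1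

-- The operator norm of `M` is at least that of its image in `A`, so some vector y of the unit ball
-- has an image under `M` of length above r; pairing with the normalised image gives that length as
-- a scalar.
open scoped Matrix.Norms.L2Operator in
theorem IsLexFamily.exists_compression (hS : IsLexFamily d S) {t : P}
    (M : Matrix (Fin (d t)) (Fin (d t)) ℂ) {r : ℝ} (hr0 : 0 ≤ r) (hr : r < ‖hS.matrixHom t M‖) :
    ∃ (x y : EuclideanSpace ℂ (Fin (d t))) (c : ℝ), ‖x‖ ≤ 1 ∧ ‖y‖ ≤ 1 ∧ r < c ∧
      star (∑ i, x i • S t i) * hS.matrixHom t M * (∑ i, y i • S t i) = (c : ℂ) • 1 := by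
  have h1 : r < ‖Matrix.toEuclideanCLM (n := Fin (d t)) (𝕜 := ℂ) M‖ := by
    rw [Matrix.l2_opNorm_toEuclideanCLM]
    exact hr.trans_le (NonUnitalStarAlgHom.norm_apply_le (hS.matrixHom t) M)
  obtain ⟨y, hy, hyr⟩ := ContinuousLinearMap.exists_lt_apply_of_lt_opNorm _ h1
  set z := Matrix.toEuclideanCLM (n := Fin (d t)) (𝕜 := ℂ) M y with hz
  have hz0 : (‖z‖ : ℂ) ≠ 0 := by
    exact_mod_cast (hr0.trans_lt hyr).ne'
  refine ⟨(‖z‖⁻¹ : ℂ) • z, y, ‖z‖, ?_, hy.le, hyr, ?_⟩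
  · rw [norm_smul, norm_inv, Complex.norm_real, norm_norm, inv_mul_cancel₀]
    exact (hr0.trans_lt hyr).ne'
  · rw [mul_assoc, hS.matrixHom_mul_sum, ← hz, hS.star_sum_mul_sum, inner_smul_left,
      inner_self_eq_norm_sq_to_K]
    congr 1
    simp only [map_inv₀, Complex.conj_ofReal, Complex.coe_algebraMap]
    field_simp

end Families

/-! ### The grading by ℤ² -/

section Graded

variable {d : Multiplicative (ℕ × ℕ) →* ℕ+} {A : Type} [CStarAlgebra A]
  (S : Multiplicative (ℕ × ℕ) → ℕ → A)

/-- The degree of an element of `ℕ²` in `ℤ²`. -/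
def lexDeg (p : Multiplicative (ℕ × ℕ)) : ℤ × ℤ := (p.toAdd.1, p.toAdd.2)

theorem lexDeg_mul (p q : Multiplicative (ℕ × ℕ)) : lexDeg (p * q) = lexDeg p + lexDeg q := by
  simp [lexDeg]

theorem lexDeg_one : lexDeg 1 = 0 := by simp [lexDeg]

theorem lexDeg_injective : Function.Injective lexDeg := by
  intro p q h
  simp only [lexDeg, Prod.mk.injEq, Nat.cast_inj] at h
  exact Multiplicative.toAdd.injective (Prod.ext h.1 h.2)

variable (d) in
/-- The homogeneous component of degree `g`. -/
def lexComponent (g : ℤ × ℤ) : Submodule ℂ A :=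
  Submodule.span ℂ {x | ∃ (p q : Multiplicative (ℕ × ℕ)) (j k : ℕ), j < d p ∧ k < d q ∧
    lexDeg p - lexDeg q = g ∧ x = S p j * star (S q k)}

variable {S}

theorem mem_lexComponent {p q : Multiplicative (ℕ × ℕ)} {j k : ℕ} (hj : j < d p) (hk : k < d q) :
    S p j * star (S q k) ∈ lexComponent d S (lexDeg p - lexDeg q) :=
  Submodule.subset_span ⟨p, q, j, k, hj, hk, rfl, rfl⟩

theorem star_mem_lexComponent {g : ℤ × ℤ} {x : A} (hx : x ∈ lexComponent d S g) :
    star x ∈ lexComponent d S (-g) := by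
  induction hx using Submodule.span_induction with
  | mem x hx =>
    obtain ⟨p, q, j, k, hj, hk, rfl, rfl⟩ := hx
    rw [StarMul.star_mul, star_star, neg_sub]
    exact mem_lexComponent hk hj
  | zero => simp
  | add x y _ _ hx hy => rw [star_add]; exact add_mem hx hy
  | smul c x _ hx => rw [star_smul]; exact Submodule.smul_mem _ _ hx

theorem IsLexFamily.gen_mem_lexComponent (hS : IsLexFamily d S) {p : Multiplicative (ℕ × ℕ)}
    {j : ℕ} (hj : j < d p) : S p j ∈ lexComponent d S (lexDeg p) := by
  have h := mem_lexComponent (S := S) (d := d) (q := 1) (k := 0) hj (by simp)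
  rwa [hS.one, star_one, mul_one, lexDeg_one, sub_zero] at h

theorem IsLexFamily.one_mem_lexComponent (hS : IsLexFamily d S) :
    (1 : A) ∈ lexComponent d S 0 := by
  have h := hS.gen_mem_lexComponent (p := 1) (j := 0) (by simp)
  rwa [hS.one, lexDeg_one] at h

theorem IsLexFamily.mul_mem_lexComponent (hS : IsLexFamily d S) {g h : ℤ × ℤ} {x y : A}
    (hx : x ∈ lexComponent d S g) (hy : y ∈ lexComponent d S h) :
    x * y ∈ lexComponent d S (g + h) := by
  induction hx using Submodule.span_induction with
  | mem x hx =>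
    obtain ⟨p, q, j, k, hj, hk, rfl, rfl⟩ := hx
    induction hy using Submodule.span_induction with
    | mem y hy =>
      obtain ⟨p', q', j', k', hj', hk', rfl, rfl⟩ := hy
      rw [mul_assoc, ← mul_assoc (star (S q k)), hS.star_mul_eq hj' hk, Finset.sum_mul,
        Finset.mul_sum]
      refine sum_mem fun e he => ?_
      rw [Finset.sum_mul, Finset.mul_sum]
      refine sum_mem fun e' he' => ?_
      rw [Finset.mem_range] at he he'
      split_ifs
      · rw [mul_assoc, ← mul_assoc (S p j), ← StarMul.star_mul, hS.map_mul hj he, hS.map_mul hk' he']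
        convert mem_lexComponent (S := S) (lexIndex_lt d hj he) (lexIndex_lt d hk' he') using 2
        rw [lexDeg_mul, lexDeg_mul]
        abel
      · simp
    | zero => simp
    | add x y _ _ hx hy => rw [mul_add]; exact add_mem hx hy
    | smul c x _ hx => rw [mul_smul_comm]; exact Submodule.smul_mem _ _ hx
  | zero => simp
  | add x y _ _ hx hy => rw [add_mul]; exact add_mem hx hy
  | smul c x _ hx => rw [smul_mul_assoc]; exact Submodule.smul_mem _ _ hx

variable (S d) in
/-- The linear span of the homogeneous elements. -/
def lexSpan : Submodule ℂ A := ⨆ g, lexComponent d S g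

theorem mem_lexSpan {g : ℤ × ℤ} {x : A} (hx : x ∈ lexComponent d S g) : x ∈ lexSpan d S :=
  Submodule.mem_iSup_of_mem g hx

theorem IsLexFamily.adjoin_le (hS : IsLexFamily d S) {x : A}
    (hx : x ∈ StarAlgebra.adjoin ℂ {x | ∃ (t : _) (j : ℕ), j < d t ∧ x = S t j}) :
    x ∈ lexSpan d S := by
  induction hx using StarAlgebra.adjoin_induction with
  | mem x hx =>
    obtain ⟨t, j, hj, rfl⟩ := hx
    exact mem_lexSpan (hS.gen_mem_lexComponent hj)
  | algebraMap c =>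
    rw [Algebra.algebraMap_eq_smul_one]
    exact Submodule.smul_mem _ _ (mem_lexSpan hS.one_mem_lexComponent)
  | add x y _ _ hx hy => exact add_mem hx hy
  | mul x y _ _ hx hy =>
    refine Submodule.iSup_induction (motive := fun x => x * y ∈ lexSpan d S) _ hx ?_ ?_ ?_
    · intro g x hx
      refine Submodule.iSup_induction (motive := fun y => x * y ∈ lexSpan d S) _ hy ?_ ?_ ?_
      · intro h y hy
        exact mem_lexSpan (hS.mul_mem_lexComponent hx hy)
      · simp
      · intro a b ha hb
        rw [mul_add]; exact add_mem ha hb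
    · simp
    · intro a b ha hb
      rw [add_mul]; exact add_mem ha hb
  | star x _ hx =>
    refine Submodule.iSup_induction (motive := fun x => star x ∈ lexSpan d S) _ hx ?_ ?_ ?_
    · intro g x hx
      exact mem_lexSpan (star_mem_lexComponent hx)
    · simp
    · intro a b ha hb
      rw [star_add]; exact add_mem ha hb

/-- Only a choice of homogeneous summands is needed; independence of the components plays no role.
-/
theorem IsUniversalLexFamily.exists_approx (hS : IsUniversalLexFamily d S) (a : A) {ε : ℝ}
    (hε : 0 < ε) : ∃ f : ℤ × ℤ →₀ A, (∀ g, f g ∈ lexComponent d S g) ∧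
      ‖a - f.sum fun _ x => x‖ < ε := by
  have ha : a ∈ (StarAlgebra.adjoin ℂ {x | ∃ (t : _) (j : ℕ), j < d t ∧ x = S t j}
    ).topologicalClosure := by
    rw [hS.dense]; trivial
  obtain ⟨b, hb, hab⟩ := Metric.mem_closure_iff.1 ha ε hε
  obtain ⟨f, hf, rfl⟩ := (Submodule.mem_iSup_iff_exists_finsupp _ _).1 (hS.adjoin_le hb)
  exact ⟨f, hf, by rwa [dist_eq_norm] at hab⟩

/-- Degree 0 forces `p = q` in each spanning product, which is then a matrix unit. The matrix
algebras are directed, since those at `t` and `r` both embed in the one at `t * r`. -/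
theorem IsLexFamily.exists_matrix (hS : IsLexFamily d S) {x : A}
    (hx : x ∈ lexComponent d S 0) : ∃ t M, x = hS.matrixHom t M := by
  have mono : ∀ (t r : Multiplicative (ℕ × ℕ)) (M), ∃ N, hS.matrixHom t M =
      hS.matrixHom (t * r) N := by
    intro t r M
    refine ⟨∑ j, ∑ k, M j k • ∑ e : Fin (d r), Matrix.single
      (⟨j * d r + e, lexIndex_lt d j.2 e.2⟩ : Fin (d (t * r)))
      ⟨k * d r + e, lexIndex_lt d k.2 e.2⟩ 1, ?_⟩
    rw [map_sum, hS.matrixHom_apply]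
    refine Finset.sum_congr rfl fun j _ => ?_
    rw [map_sum]
    refine Finset.sum_congr rfl fun k _ => ?_
    rw [map_smul, map_sum, hS.mul_star_expand r j.2 k.2, Finset.sum_range]
    simp_rw [hS.matrixHom_single]
  induction hx using Submodule.span_induction with
  | mem x hx =>
    obtain ⟨p, q, j, k, hj, hk, h, rfl⟩ := hx
    obtain rfl := lexDeg_injective (sub_eq_zero.1 h)
    exact ⟨p, Matrix.single ⟨j, hj⟩ ⟨k, hk⟩ 1, (hS.matrixHom_single p ⟨j, hj⟩ ⟨k, hk⟩).symm⟩
  | zero => exact ⟨1, 0, (map_zero _).symm⟩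
  | add x y _ _ hx hy =>
    obtain ⟨t, M, rfl⟩ := hx
    obtain ⟨r, N, rfl⟩ := hy
    obtain ⟨M', hM⟩ := mono t r M
    obtain ⟨N', hN⟩ : ∃ N', hS.matrixHom r N = hS.matrixHom (t * r) N' := by
      have := mono r t N
      rwa [mul_comm] at this
    exact ⟨t * r, M' + N', by rw [map_add, hM, hN]⟩
  | smul c x _ hx =>
    obtain ⟨t, M, rfl⟩ := hx
    exact ⟨t, c • M, (map_smul _ _ _).symm⟩

end Graded

/-! ### Compressing away the terms of nonzero degree -/

section Aperiodic

open Filter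

variable {A : Type} [CStarAlgebra A]

/-- On [0, 1), `S p j * star (S q k)` is the affine map of the k-th interval of length 1 / d q onto
the j-th of length 1 / d p, and the compression sees only the part of its graph in the square over
the i-th interval of length 1 / D, with D = d (p * p'). Up to sign and the factor D * d p, the
quantity in `h` is the displacement of the left end of that interval; if it is large, the graph
misses the square. -/
theorem star_mul_mul_eq_zero {P : Type} [CommMonoid P] {d : P →* ℕ+} {S : P → ℕ → A}
    (hS : IsLexFamily d S) {p q p' q' : P} (hw : p * p' = q * q') {i j k : ℕ}
    (hj : j < d p) (hk : k < d q) (hi : i < d (p * p'))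
    (h : (d p + d q : ℤ) ≤ |(i : ℤ) * (d p - d q) + (k - j) * d (p * p')|) :
    star (S (p * p') i) * (S p j * star (S q k)) * S (p * p') i = 0 := by
  have split : ∀ {r r' : P}, r * r' = p * p' → ∀ {l : ℕ}, l < d r →
      star (S (p * p') i) * S r l = if i / d r' = l then star (S r' (i % d r')) else 0 := by
    intro r r' hr l hl
    have h1 : i / d r' < d r := by
      rw [Nat.div_lt_iff_lt_mul (d r').pos, ← PNat.mul_coe, ← map_mul, hr]
      exact hi
    have h2 : i % d r' < d r' := Nat.mod_lt _ (d r').pos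
    have h3 : S (p * p') i = S r (i / d r') * S r' (i % d r') := by
      rw [hS.map_mul h1 h2, hr, Nat.div_add_mod']
    rw [h3, star_mul, mul_assoc, hS.star_mul h1 hl]
    split_ifs <;> simp
  have hd1 : (d p * d p' : ℤ) = d (p * p') := by push_cast [map_mul]; rfl
  have hd2 : (d q * d q' : ℤ) = d (p * p') := by rw [hw]; push_cast [map_mul]; rfl
  have e1 := split rfl hj
  have e2 : star (S q k) * S (p * p') i = if i / d q' = k then S q' (i % d q') else 0 := by
    rw [← star_inj, star_mul, star_star, split hw.symm hk]
    split_ifs <;> simp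
  rw [← mul_assoc, e1, mul_assoc, e2]
  split_ifs with hij hik
  · have h2 : i % d q' < d q' := Nat.mod_lt _ (d q').pos
    have h2' : i % d p' < d p' := Nat.mod_lt _ (d p').pos
    rw [hS.star_mul_eq h2 h2']
    refine Finset.sum_eq_zero fun e he => Finset.sum_eq_zero fun e' he' => ?_
    rw [Finset.mem_range] at he he'
    refine if_neg fun heq => ?_
    have f1 := Nat.div_add_mod' i (d p')
    have f2 := Nat.div_add_mod' i (d q')
    rw [hij] at f1
    rw [hik] at f2
    set X : ℤ := (i : ℤ) * (d p - d q) + (k - j) * d (p * p') with hX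
    set D : ℤ := ((d (p * p') : ℕ) : ℤ) with hD
    have hDpos : 0 < D := by rw [hD]; exact_mod_cast (d (p * p')).pos
    have hp := (d p).pos
    have hq := (d q).pos
    -- A surviving term requires `heq`, which determines X from e' - e; the ranges `e < d q'` and
    -- `e' < d p'` then force |X| < d p + d q.
    have key : D * X = d p * d q * ((e' : ℤ) - e) := by
      zify at f1 f2 heq
      have g1 : ((i % d p' : ℕ) : ℤ) = i - j * d p' := by push_cast; linarith
      have g2 : ((i % d q' : ℕ) : ℤ) = i - k * d q' := by push_cast; linarith
      have h5 : (e' : ℤ) - e = (i - j * d p') * d q' - (i - k * d q') * d p' := by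
        push_cast at g1 g2
        rw [g1, g2] at heq
        linarith
      rw [h5, hX]
      have : (d p * d q : ℤ) * ((i - j * d p') * d q' - (i - k * d q') * d p') =
        (i - j * d p') * (d q * d q') * d p - (i - k * d q') * (d p * d p') * d q := by ring
      rw [this, hd1, hd2]
      have : ((i - j * d p') * D * d p - (i - k * d q') * D * d q : ℤ) =
        D * (i * (d p - d q) - j * (d p * d p') + k * (d q * d q')) := by ring
      rw [this, hd1, hd2]
      ring
    have b1 : D * X < D * (d p + d q) := by
      rw [key]
      have : ((e' : ℤ) - e) < d p' := by
        have : (e' : ℤ) < d p' := by exact_mod_cast he'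
        linarith [Int.natCast_nonneg e]
      calc (d p * d q * ((e' : ℤ) - e)) < d p * d q * d p' := by gcongr
        _ = D * d q := by rw [← hd1]; ring
        _ ≤ D * (d p + d q) := by gcongr; linarith [Int.natCast_nonneg (d p : ℕ)]
    have b2 : D * (-X) < D * (d p + d q) := by
      have : D * -X = d p * d q * ((e : ℤ) - e') := by linear_combination -key
      rw [this]
      have : ((e : ℤ) - e') < d q' := by
        have : (e : ℤ) < d q' := by exact_mod_cast he
        linarith [Int.natCast_nonneg e']
      calc (d p * d q * ((e : ℤ) - e')) < d p * d q * d q' := by gcongr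
        _ = D * d p := by rw [← hd2]; ring
        _ ≤ D * (d p + d q) := by gcongr; linarith [Int.natCast_nonneg (d q : ℕ)]
    have b1' := lt_of_mul_lt_mul_left b1 hDpos.le
    have b2' := lt_of_mul_lt_mul_left b2 hDpos.le
    have := abs_lt.2 ⟨by linarith, b1'⟩
    linarith
  all_goals simp

/-- Irrationality gives x (a - b) + c ≠ 0, so D times this number grows linearly, while rounding x D
down changes the expression by at most a + b. -/
theorem eventually_le_abs {x : ℝ} (hx : Irrational x) (hx0 : 0 ≤ x) {a b : ℕ} (hab : a ≠ b)
    (c : ℤ) : ∀ᶠ D : ℕ in atTop,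
      (a + b : ℤ) ≤ |(⌊x * D⌋₊ : ℤ) * (a - b) + c * D| := by
  have h0 : 0 < |x * (a - b) + c| := by
    refine abs_pos.2 fun h => ?_
    have hab' : ((a : ℤ) - b) ≠ 0 := by
      rw [sub_ne_zero]; exact_mod_cast hab
    have := (hx.mul_intCast hab').add_intCast c
    push_cast at this
    rw [h] at this
    exact not_irrational_zero this
  filter_upwards [eventually_ge_atTop ⌈(2 * (a + b)) / |x * (a - b) + c|⌉₊] with D hD
  have hD' : (2 * (a + b) : ℝ) ≤ D * |x * (a - b) + c| := by
    rw [← div_le_iff₀ h0]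
    exact Nat.ceil_le.1 hD
  have f1 := Nat.floor_le (mul_nonneg hx0 (Nat.cast_nonneg D))
  have f2 := Nat.lt_floor_add_one (x * D)
  set i : ℕ := ⌊x * D⌋₊
  have key : ((a : ℝ) + b) ≤ |(i : ℝ) * (a - b) + c * D| := by
    have e : D * (x * (a - b) + c) = ((i : ℝ) * (a - b) + c * D) + (x * D - i) * (a - b) := by
      ring
    have e2 : D * |x * (a - b) + c| = |D * (x * (a - b) + c)| := by
      rw [abs_mul, Nat.abs_cast]
    have e3 : |(x * D - i) * ((a : ℝ) - b)| ≤ a + b := by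
      rw [abs_mul]
      have g1 : |x * D - i| ≤ 1 := abs_le.2 ⟨by linarith, by linarith⟩
      have g2 : |(a : ℝ) - b| ≤ a + b :=
        abs_le.2 ⟨by linarith [Nat.cast_nonneg (α := ℝ) a], by linarith [Nat.cast_nonneg (α := ℝ) b]⟩
      calc _ ≤ 1 * ((a : ℝ) + b) := mul_le_mul g1 g2 (abs_nonneg _) zero_le_one
        _ = _ := one_mul _
    rw [e2, e] at hD'
    linarith [abs_add_le ((i : ℝ) * (a - b) + c * D) ((x * D - i) * (a - b))]
  exact_mod_cast key

/-- The isometries of the diagonal degree `(N, N)` around the point `x` of the unit interval. -/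
def lexCut (d : Multiplicative (ℕ × ℕ) →* ℕ+) (S : Multiplicative (ℕ × ℕ) → ℕ → A) (x : ℝ)
    (N : ℕ) : A :=
  S (Multiplicative.ofAdd (N, N)) ⌊x * d (Multiplicative.ofAdd (N, N))⌋₊

variable {d : Multiplicative (ℕ × ℕ) →* ℕ+} {S : Multiplicative (ℕ × ℕ) → ℕ → A}

theorem floor_mul_lt {x : ℝ} (hx : x < 1) (n : ℕ+) : ⌊x * n⌋₊ < n := by
  have hn : (0 : ℝ) < n := by exact_mod_cast n.pos
  rcases le_or_gt 0 x with h0 | h0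
  · rw [Nat.floor_lt (by positivity)]
    nlinarith
  · rw [Nat.floor_of_nonpos (by nlinarith)]
    exact n.pos

theorem IsLexFamily.star_lexCut_mul (hS : IsLexFamily d S) {x : ℝ} (hx : x < 1) (N : ℕ) :
    star (lexCut d S x N) * lexCut d S x N = 1 := by
  have h := hS.star_mul (floor_mul_lt hx (d (Multiplicative.ofAdd (N, N))))
    (floor_mul_lt hx (d (Multiplicative.ofAdd (N, N))))
  rwa [if_pos rfl] at h

theorem IsLexFamily.eventually_cut_eq_zero (hS : IsLexFamily d S) (hd : Function.Injective d)
    (hD : Tendsto (fun N : ℕ => (d (Multiplicative.ofAdd (N, N)) : ℕ)) atTop atTop)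
    {x : ℝ} (hx : Irrational x) (hx0 : 0 ≤ x) (hx1 : x < 1) {g : ℤ × ℤ} (hg : g ≠ 0) {y : A}
    (hy : y ∈ lexComponent d S g) :
    ∀ᶠ N in atTop, star (lexCut d S x N) * y * lexCut d S x N = 0 := by
  induction hy using Submodule.span_induction with
  | mem y hy =>
    obtain ⟨p, q, j, k, hj, hk, hpq, rfl⟩ := hy
    have hne : p ≠ q := fun h => hg (by rw [← hpq, h, sub_self])
    have hdne : (d p : ℕ) ≠ d q := fun h => hne (hd (PNat.coe_injective h))
    filter_upwards [hD.eventually (eventually_le_abs hx hx0 hdne (k - j)),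
      -- This makes (N, N) a common multiple of `p` and `q` in ℕ².
      eventually_ge_atTop (p.toAdd.1 + p.toAdd.2 + q.toAdd.1 + q.toAdd.2)] with N hN hN'
    have hle : ∀ r : Multiplicative (ℕ × ℕ), r.toAdd.1 ≤ N → r.toAdd.2 ≤ N →
        r * Multiplicative.ofAdd (N - r.toAdd.1, N - r.toAdd.2) = Multiplicative.ofAdd (N, N) := by
      intro r h1 h2
      refine Multiplicative.toAdd.injective (Prod.ext ?_ ?_)
      · simp; omega
      · simp; omega
    have hp := hle p (by omega) (by omega)
    have hq := hle q (by omega) (by omega)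
    have h := star_mul_mul_eq_zero hS (hp.trans hq.symm) (i := ⌊x * d (Multiplicative.ofAdd (N, N))⌋₊)
      hj hk (by rw [hp]; exact floor_mul_lt hx1 _) (by rw [hp]; exact hN)
    rwa [hp] at h
  | zero => simp
  | add y z _ _ hy hz =>
    filter_upwards [hy, hz] with N h1 h2
    rw [mul_add, add_mul, h1, h2, add_zero]
  | smul c y _ hy =>
    filter_upwards [hy] with N h1
    rw [mul_smul_comm, smul_mul_assoc, h1, smul_zero]

end Aperiodic

/-! ### The gauge action and averaging over roots of unity -/

section Gauge

variable {A : Type} [CStarAlgebra A] {d : Multiplicative (ℕ × ℕ) →* ℕ+}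
  {S : Multiplicative (ℕ × ℕ) → ℕ → A}

/-- The character of `ℤ²` determined by a point of the torus. -/
def torusChar (z : Circle × Circle) (g : ℤ × ℤ) : Circle := z.1 ^ g.1 * z.2 ^ g.2

theorem torusChar_add (z : Circle × Circle) (g h : ℤ × ℤ) :
    torusChar z (g + h) = torusChar z g * torusChar z h := by
  simp only [torusChar, Prod.fst_add, Prod.snd_add, zpow_add]
  exact mul_mul_mul_comm _ _ _ _

theorem torusChar_neg (z : Circle × Circle) (g : ℤ × ℤ) :
    torusChar z (-g) = (torusChar z g)⁻¹ := by
  simp [torusChar, mul_comm]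

theorem star_coe_circle (z : Circle) : star (z : ℂ) = ((z⁻¹ : Circle) : ℂ) :=
  (Circle.coe_inv_eq_conj z).symm

theorem coe_inv_mul_coe (z : Circle) : ((z⁻¹ : Circle) : ℂ) * z = 1 := by
  rw [← Circle.coe_mul, inv_mul_cancel, Circle.coe_one]

theorem coe_mul_coe_inv (z : Circle) : (z : ℂ) * ((z⁻¹ : Circle) : ℂ) = 1 := by
  rw [← Circle.coe_mul, mul_inv_cancel, Circle.coe_one]

theorem IsLexFamily.gauge (hS : IsLexFamily d S) (z : Circle × Circle) :
    IsLexFamily d fun p j => (torusChar z (lexDeg p) : ℂ) • S p j where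
  map_mul hj hk := by
    rw [smul_mul_smul_comm, hS.map_mul hj hk, lexDeg_mul, torusChar_add, Circle.coe_mul]
  star_mul hj hk := by
    rw [star_smul, smul_mul_smul_comm, hS.star_mul hj hk, star_coe_circle, coe_inv_mul_coe,
      one_smul]
  sum_mul_star t := by
    rw [← hS.sum_mul_star t]
    refine Finset.sum_congr rfl fun j _ => ?_
    rw [star_smul, smul_mul_smul_comm, star_coe_circle, coe_mul_coe_inv, one_smul]

/-- The gauge action of the torus. -/
def IsUniversalLexFamily.gaugeHom (hS : IsUniversalLexFamily d S) (z : Circle × Circle) :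
    A →⋆ₐ[ℂ] A :=
  (hS.exists_lift (hS.gauge z)).choose

theorem IsUniversalLexFamily.gaugeHom_gen (hS : IsUniversalLexFamily d S) (z : Circle × Circle)
    {p : Multiplicative (ℕ × ℕ)} {j : ℕ} (hj : j < d p) :
    hS.gaugeHom z (S p j) = (torusChar z (lexDeg p) : ℂ) • S p j :=
  (hS.exists_lift (hS.gauge z)).choose_spec p j hj

theorem IsUniversalLexFamily.gaugeHom_apply (hS : IsUniversalLexFamily d S) (z : Circle × Circle)
    {g : ℤ × ℤ} {x : A} (hx : x ∈ lexComponent d S g) :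
    hS.gaugeHom z x = (torusChar z g : ℂ) • x := by
  induction hx using Submodule.span_induction with
  | mem x hx =>
    obtain ⟨p, q, j, k, hj, hk, rfl, rfl⟩ := hx
    rw [map_mul, map_star, hS.gaugeHom_gen z hj, hS.gaugeHom_gen z hk, star_smul,
      smul_mul_smul_comm, star_coe_circle, ← torusChar_neg, ← Circle.coe_mul, ← torusChar_add,
      sub_eq_add_neg]
  | zero => simp
  | add x y _ _ hx hy => rw [map_add, hx, hy, smul_add]
  | smul c x _ hx => rw [map_smul, hx, smul_comm]

/-- On finite sums of homogeneous elements the orbit is a trigonometric polynomial. Since the action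
is contractive, general orbits are uniform limits of these. -/
theorem IsUniversalLexFamily.continuous_gaugeHom (hS : IsUniversalLexFamily d S) (a : A) :
    Continuous fun z => hS.gaugeHom z a := by
  refine continuous_of_uniform_approx_of_continuous ?_
  rw [Metric.uniformity_basis_dist_le.forall_iff (by
    intro s t hst h
    obtain ⟨F, h1, h2⟩ := h
    exact ⟨F, h1, fun y => hst (h2 y)⟩)]
  intro ε hε
  obtain ⟨f, hf, hfa⟩ := hS.exists_approx a hε
  refine ⟨fun z => hS.gaugeHom z (f.sum fun _ x => x), ?_, fun z => ?_⟩
  · simp only [Finsupp.sum, map_sum]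
    refine continuous_finsetSum _ fun g _ => ?_
    simp only [hS.gaugeHom_apply _ (hf g)]
    have h : Continuous fun z : Circle × Circle => torusChar z g :=
      (continuous_fst.zpow _).mul (continuous_snd.zpow _)
    exact (continuous_subtype_val.comp h).smul continuous_const
  · simp only [Set.mem_ofPred_eq, dist_eq_norm, ← map_sub]
    exact (NonUnitalStarAlgHom.norm_apply_le _ _).trans hfa.le

/-- A point of order `N` on the circle. -/
def rootPoint (N : ℕ) (k : ℕ) : Circle := Circle.exp (2 * Real.pi * k / N)

/-- For 0 < |g| < N the terms are the powers of an N-th root of unity different from 1, so the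
geometric sum vanishes. -/
theorem sum_rootPoint_zpow {N : ℕ} {g : ℤ} (hg : |g| < N) :
    ∑ k ∈ Finset.range N, ((rootPoint N k ^ g : Circle) : ℂ) = if g = 0 then (N : ℂ) else 0 := by
  split_ifs with h
  · simp [h]
  · have hN : (N : ℝ) ≠ 0 := by
      have : (0 : ℤ) < N := (abs_nonneg g).trans_lt hg
      have : 0 < N := by exact_mod_cast this
      positivity
    set w : Circle := Circle.exp (2 * Real.pi * g / N) with hw
    have e : ∀ k : ℕ, ((rootPoint N k ^ g : Circle) : ℂ) = (w : ℂ) ^ k := fun k => by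
      rw [← Circle.coe_pow]
      congr 1
      rw [rootPoint, hw, ← Circle.exp_nsmul, ← Circle.exp_zsmul]
      congr 1
      simp
      ring
    simp_rw [e]
    have hw1 : (w : ℂ) ≠ 1 := by
      intro h1
      have h1' : w = 1 := Circle.ext (by simpa using h1)
      rw [hw, Circle.exp_eq_one] at h1'
      obtain ⟨n, hn⟩ := h1'
      have hpi := Real.pi_pos
      have : (g : ℝ) = n * N := by
        field_simp at hn
        nlinarith
      have h2 : g = n * N := by exact_mod_cast this
      have hn0 : n ≠ 0 := by rintro rfl; simp at h2; exact h h2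
      rw [h2, abs_mul, Nat.abs_cast] at hg
      have : 1 ≤ |n| := Int.one_le_abs hn0
      nlinarith
    have hwN : (w : ℂ) ^ N = 1 := by
      rw [← Circle.coe_pow, hw, ← Circle.exp_nsmul, Circle.coe_eq_one, Circle.exp_eq_one]
      exact ⟨g, by simp; field_simp⟩
    have := geom_sum_mul (w : ℂ) N
    rw [hwN, sub_self] at this
    exact (mul_eq_zero.1 this).resolve_right (sub_ne_zero.2 hw1)

/-- A finite substitute for integration over the torus, exact on degrees with both coordinates
smaller than N. -/
theorem IsUniversalLexFamily.sum_gaugeHom (hS : IsUniversalLexFamily d S) {N : ℕ} {g : ℤ × ℤ}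
    (hg1 : |g.1| < N) (hg2 : |g.2| < N) {x : A} (hx : x ∈ lexComponent d S g) :
    ∑ k ∈ Finset.range N ×ˢ Finset.range N, hS.gaugeHom (rootPoint N k.1, rootPoint N k.2) x =
      if g = 0 then ((N : ℂ) * N) • x else 0 := by
  simp_rw [hS.gaugeHom_apply _ hx, torusChar]
  rw [← Finset.sum_smul, Finset.sum_product]
  simp_rw [Circle.coe_mul, ← Finset.mul_sum, sum_rootPoint_zpow hg2]
  rw [← Finset.sum_mul, sum_rootPoint_zpow hg1]
  simp only [Prod.ext_iff, Prod.fst_zero, Prod.snd_zero]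
  split_ifs <;> simp_all

/-- A fixed arc contains a fixed proportion of the N-th roots of unity, uniformly in N. -/
theorem exists_card_near {δ : ℝ} (hδ : 0 < δ) : ∃ c : ℝ, 0 < c ∧ c ≤ 1 ∧ ∀ N : ℕ, 0 < N →
    c * N ≤ ((Finset.range N).filter fun k : ℕ => 2 * Real.pi * k / N < δ).card := by
  have hpi := Real.pi_pos
  refine ⟨min 1 (δ / (2 * Real.pi)), by positivity, min_le_left _ _, fun N hN => ?_⟩
  set c := min 1 (δ / (2 * Real.pi))
  have hN' : (0 : ℝ) < N := by exact_mod_cast hN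
  have hsub : Finset.range ⌈c * N⌉₊ ⊆
      (Finset.range N).filter fun k : ℕ => 2 * Real.pi * k / N < δ := by
    intro k hk
    rw [Finset.mem_range, Nat.lt_ceil] at hk
    rw [Finset.mem_filter, Finset.mem_range]
    constructor
    · have : c * N ≤ 1 * N := by gcongr; exact min_le_left _ _
      exact_mod_cast (show (k : ℝ) < N by linarith)
    · have : c * N ≤ δ / (2 * Real.pi) * N := by gcongr; exact min_le_right _ _
      rw [div_lt_iff₀ hN']
      calc 2 * Real.pi * k < 2 * Real.pi * (δ / (2 * Real.pi) * N) := by gcongr; linarith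
        _ = δ * N := by field_simp
  calc c * N ≤ ⌈c * N⌉₊ := Nat.le_ceil _
    _ = ((Finset.range ⌈c * N⌉₊).card : ℝ) := by simp
    _ ≤ _ := by exact_mod_cast Finset.card_le_card hsub

-- This is faithfulness of averaging, uniformly in N. Near the identity of the torus the translates
-- of `star b * b` stay close to it, and a fixed proportion of the root points lies there; all other
-- translates are positive, so adding them cannot lower the norm.
open scoped ComplexOrder in
theorem IsUniversalLexFamily.exists_lower_bound (hS : IsUniversalLexFamily d S) {b : A}
    (hb : b ≠ 0) : ∃ c : ℝ, 0 < c ∧ ∀ N : ℕ, 0 < N → c * (N * N) ≤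
      ‖∑ k ∈ Finset.range N ×ˢ Finset.range N,
        hS.gaugeHom (rootPoint N k.1, rootPoint N k.2) (star b * b)‖ := by
  let _ := CStarAlgebra.spectralOrder A
  have := CStarAlgebra.spectralOrderedRing A
  set a := star b * b with ha
  have ha0 : 0 < ‖a‖ := by
    rw [ha, CStarRing.norm_star_mul_self]
    have := norm_pos_iff.2 hb
    positivity
  have hone : hS.gaugeHom (1, 1) a = a := by
    have : hS.gaugeHom (1, 1) = StarAlgHom.id ℂ A := hS.hom_ext fun t j hj => by
      rw [hS.gaugeHom_gen _ hj]
      simp [torusChar]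
    rw [this]; rfl
  have hcont : Continuous fun θ : ℝ × ℝ => hS.gaugeHom (Circle.exp θ.1, Circle.exp θ.2) a :=
    (hS.continuous_gaugeHom a).comp (f := fun θ : ℝ × ℝ => (Circle.exp θ.1, Circle.exp θ.2))
      (by fun_prop)
  obtain ⟨δ, hδ, hnear⟩ := Metric.continuous_iff.1 hcont (0, 0) (‖a‖ / 2) (by positivity)
  simp only [Circle.exp_zero, hone] at hnear
  obtain ⟨c, hc0, -, hc⟩ := exists_card_near hδ
  refine ⟨c * c * (‖a‖ / 2), by positivity, fun N hN => ?_⟩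
  set K := (Finset.range N).filter fun k : ℕ => 2 * Real.pi * k / N < δ with hK
  have hsub : K ×ˢ K ⊆ Finset.range N ×ˢ Finset.range N :=
    Finset.product_subset_product (Finset.filter_subset _ _) (Finset.filter_subset _ _)
  have hpos : ∀ z, 0 ≤ hS.gaugeHom z a := fun z => by
    rw [ha, map_mul, map_star]
    exact star_mul_self_nonneg _
  have h1 : ‖∑ k ∈ K ×ˢ K, hS.gaugeHom (rootPoint N k.1, rootPoint N k.2) a‖ ≤
      ‖∑ k ∈ Finset.range N ×ˢ Finset.range N,
        hS.gaugeHom (rootPoint N k.1, rootPoint N k.2) a‖ :=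
    CStarAlgebra.norm_le_norm_of_nonneg_of_le (Finset.sum_nonneg fun k _ => hpos _)
      (Finset.sum_le_sum_of_subset_of_nonneg hsub fun k _ _ => hpos _)
  have h2 : ‖(∑ k ∈ K ×ˢ K, hS.gaugeHom (rootPoint N k.1, rootPoint N k.2) a) -
      ((K ×ˢ K).card : ℂ) • a‖ ≤ (K ×ˢ K).card * (‖a‖ / 2) := by
    have : ((K ×ˢ K).card : ℂ) • a = ∑ k ∈ K ×ˢ K, a := by
      rw [Finset.sum_const, Nat.cast_smul_eq_nsmul]
    rw [this, ← Finset.sum_sub_distrib, ← nsmul_eq_mul, ← Finset.sum_const]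
    refine norm_sum_le_of_le _ fun k hk => ?_
    rw [Finset.mem_product, hK, Finset.mem_filter, Finset.mem_filter] at hk
    have hn : ∀ l : ℕ, 2 * Real.pi * l / N < δ → |2 * Real.pi * l / N| < δ := fun l hl => by
      rwa [abs_of_nonneg (by positivity)]
    have := hnear (2 * Real.pi * k.1 / N, 2 * Real.pi * k.2 / N) (by
      rw [Prod.dist_eq, max_lt_iff]
      simp only [dist_zero_right, Real.norm_eq_abs]
      exact ⟨hn _ hk.1.2, hn _ hk.2.2⟩)
    rw [dist_eq_norm] at this
    exact this.le
  have h3 : ‖((K ×ˢ K).card : ℂ) • a‖ = (K ×ˢ K).card * ‖a‖ := by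
    rw [norm_smul]; simp
  have h4 : c * N * (c * N) ≤ (K ×ˢ K).card := by
    rw [Finset.card_product, Nat.cast_mul]
    exact mul_le_mul (hc N hN) (hc N hN) (by positivity) (by positivity)
  have h5 := norm_sub_norm_le (((K ×ˢ K).card : ℂ) • a)
    (∑ k ∈ K ×ˢ K, hS.gaugeHom (rootPoint N k.1, rootPoint N k.2) a)
  rw [norm_sub_rev, h3] at h5
  nlinarith

end Gauge

/-! ### Invertible elements in ideals -/

section Simple

open Filter

variable {A : Type} [CStarAlgebra A] {d : Multiplicative (ℕ × ℕ) →* ℕ+}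
  {S : Multiplicative (ℕ × ℕ) → ℕ → A}

theorem norm_le_one_of_isometry {w : A} (hw : star w * w = 1) : ‖w‖ ≤ 1 := by
  have h := CStarRing.norm_star_mul_self (x := w)
  rw [hw] at h
  nlinarith [norm_one_le A, norm_nonneg w]

/-- A nonzero element of the Cuntz algebra of an aperiodic lexicographic family generates an ideal
which contains an invertible element. -/
theorem IsUniversalLexFamily.exists_isUnit (hS : IsUniversalLexFamily d S)
    (hd : Function.Injective d)
    (hD : Tendsto (fun N : ℕ => (d (Multiplicative.ofAdd (N, N)) : ℕ)) atTop atTop)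
    {b : A} (hb : b ≠ 0) : ∃ u v : A, IsUnit (u * b * v) := by
  obtain ⟨c, hc0, hc⟩ := hS.exists_lower_bound hb
  set a := star b * b with ha
  -- The bound `c` is uniform in N, so the error can be fixed before N is chosen to exceed all
  -- degrees in `f`.
  obtain ⟨f, hf, hfa⟩ := hS.exists_approx a (ε := c / 4) (by positivity)
  set a' := f.sum fun _ x => x with ha'
  obtain ⟨N, hN0, hN⟩ : ∃ N : ℕ, 0 < N ∧ ∀ g ∈ f.support, |g.1| < N ∧ |g.2| < N := by
    refine ⟨(f.support.sup fun g => g.1.natAbs + g.2.natAbs) + 1, Nat.succ_pos _, fun g hg => ?_⟩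
    have := Finset.le_sup (f := fun g : ℤ × ℤ => g.1.natAbs + g.2.natAbs) hg
    rw [Int.abs_eq_natAbs, Int.abs_eq_natAbs]
    constructor <;> omega
  have hN' : (0 : ℝ) < N := by exact_mod_cast hN0
  have hsum : ∑ k ∈ Finset.range N ×ˢ Finset.range N,
      hS.gaugeHom (rootPoint N k.1, rootPoint N k.2) a' = ((N : ℂ) * N) • f 0 := by
    simp only [ha', Finsupp.sum, map_sum]
    rw [Finset.sum_comm, Finset.sum_eq_single 0]
    · by_cases h0 : (0 : ℤ × ℤ) ∈ f.support
      · rw [hS.sum_gaugeHom (hN 0 h0).1 (hN 0 h0).2 (hf 0), if_pos rfl]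
      · rw [Finsupp.notMem_support_iff.1 h0]; simp
    · intro g hg hg0
      rw [hS.sum_gaugeHom (hN g hg).1 (hN g hg).2 (hf g), if_neg hg0]
    · intro h0
      rw [Finsupp.notMem_support_iff.1 h0]; simp
  -- The sums over `a` and `a'` differ by at most N² c / 4, and the latter sum is N² times `f 0`.
  have hbound : c - c / 4 ≤ ‖f 0‖ := by
    have h1 : ‖(∑ k ∈ Finset.range N ×ˢ Finset.range N,
        hS.gaugeHom (rootPoint N k.1, rootPoint N k.2) a) - ((N : ℂ) * N) • f 0‖ ≤
        (N * N) * (c / 4) := by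
      rw [← hsum, ← Finset.sum_sub_distrib]
      calc _ ≤ ∑ k ∈ Finset.range N ×ˢ Finset.range N, c / 4 := by
            refine norm_sum_le_of_le _ fun k _ => ?_
            rw [← map_sub]
            exact (NonUnitalStarAlgHom.norm_apply_le _ _).trans hfa.le
        _ = _ := by simp
    have h2 := hc N hN0
    have h3 := norm_sub_norm_le (∑ k ∈ Finset.range N ×ˢ Finset.range N,
        hS.gaugeHom (rootPoint N k.1, rootPoint N k.2) a) (((N : ℂ) * N) • f 0)
    have h4 : ‖((N : ℂ) * N) • f 0‖ = (N * N) * ‖f 0‖ := by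
      rw [norm_smul]; simp
    rw [h4] at h3
    have h5 : (N * N : ℝ) * (c - c / 4) ≤ (N * N) * ‖f 0‖ := by nlinarith
    exact le_of_mul_le_mul_left h5 (by positivity)
  -- Since ‖f 0‖ ≥ 3c/4 > c/2, the compression of `f 0` is a scalar r > c/2, which dominates the
  -- approximation error c/4.
  obtain ⟨t, M, hM⟩ := hS.exists_matrix (hf 0)
  obtain ⟨x, y, r, hx, hy, hr, hxy⟩ := hS.exists_compression M (r := c / 2) (by positivity)
    (by rw [← hM]; linarith)
  rw [← hM] at hxy
  set X := ∑ i, x i • S t i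
  set Y := ∑ i, y i • S t i
  have hX : X ∈ lexComponent d S (lexDeg t) := sum_mem fun i _ =>
    Submodule.smul_mem _ _ (hS.gen_mem_lexComponent i.2)
  have hY : Y ∈ lexComponent d S (lexDeg t) := sum_mem fun i _ =>
    Submodule.smul_mem _ _ (hS.gen_mem_lexComponent i.2)
  have hXn : ‖X‖ ≤ 1 := (hS.norm_sum_le x).trans hx
  have hYn : ‖Y‖ ≤ 1 := (hS.norm_sum_le y).trans hy
  have hirr : Irrational (√2 - 1) := by
    have := irrational_sqrt_two.sub_natCast 1
    simpa using this
  have hs1 : 1 ≤ √2 := Real.one_le_sqrt.2 (by norm_num)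
  have hs2 : √2 < 2 := by
    rw [Real.sqrt_lt' (by norm_num)]; norm_num
  -- `X` and `Y` have the same degree, so `star X * f g * Y` still has degree g ≠ 0; finitely many
  -- such terms are cut off by one n.
  have hev : ∀ᶠ n in atTop, ∀ g ∈ f.support.erase 0,
      star (lexCut d S (√2 - 1) n) * (star X * f g * Y) * lexCut d S (√2 - 1) n = 0 := by
    rw [eventually_all_finset]
    intro g hg
    refine hS.eventually_cut_eq_zero hd hD hirr (by linarith) (by linarith) (g := g)
      (Finset.ne_of_mem_erase hg) ?_
    have := hS.mul_mem_lexComponent (hS.mul_mem_lexComponent (star_mem_lexComponent hX) (hf g)) hY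
    have e : -lexDeg t + g + lexDeg t = g := by abel
    rwa [e] at this
  obtain ⟨n, hn⟩ := hev.exists
  set W := lexCut d S (√2 - 1) n
  have hW : star W * W = 1 := hS.star_lexCut_mul (by linarith) n
  have hWn : ‖W‖ ≤ 1 := norm_le_one_of_isometry hW
  have hcomp : star W * (star X * a' * Y) * W = (r : ℂ) • 1 := by
    have e1 : a' = f 0 + ∑ g ∈ f.support.erase 0, f g := by
      rw [ha', Finsupp.sum]
      by_cases h0 : (0 : ℤ × ℤ) ∈ f.support
      · rw [Finset.add_sum_erase _ _ h0]
      · rw [Finset.erase_eq_of_notMem h0, Finsupp.notMem_support_iff.1 h0, zero_add]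
    rw [e1, mul_add, add_mul, mul_add, add_mul, hxy, mul_smul_comm, mul_one, smul_mul_assoc, hW,
      Finset.mul_sum _ _ (star X), Finset.sum_mul _ _ Y, Finset.mul_sum _ _ (star W),
      Finset.sum_mul _ _ W, Finset.sum_eq_zero hn, add_zero]
  have hr0 : 0 < r := by linarith
  refine ⟨(r⁻¹ : ℂ) • (star W * star X * star b), Y * W, ?_⟩
  -- Replacing `a'` by `a = star b * b` costs at most c/4 < r.
  have hclose : ‖1 - (r⁻¹ : ℂ) • (star W * star X * star b) * b * (Y * W)‖ < 1 := by
    have e2 : 1 - (r⁻¹ : ℂ) • (star W * star X * star b) * b * (Y * W) =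
        (r⁻¹ : ℂ) • (star W * (star X * (a' - a) * Y) * W) := by
      rw [mul_sub, sub_mul, mul_sub, sub_mul, hcomp, smul_sub, smul_smul, inv_mul_cancel₀, one_smul,
        ha]
      · simp only [smul_mul_assoc, mul_assoc]
      · exact_mod_cast hr0.ne'
    rw [e2, norm_smul]
    have hn1 : ‖star W * (star X * (a' - a) * Y) * W‖ ≤ c / 4 := by
      calc _ ≤ ‖star W‖ * (‖star X‖ * ‖a' - a‖ * ‖Y‖) * ‖W‖ := by
            refine (norm_mul_le _ _).trans (mul_le_mul_of_nonneg_right ?_ (norm_nonneg _))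
            refine (norm_mul_le _ _).trans (mul_le_mul_of_nonneg_left ?_ (norm_nonneg _))
            refine (norm_mul_le _ _).trans (mul_le_mul_of_nonneg_right ?_ (norm_nonneg _))
            exact norm_mul_le _ _
        _ ≤ 1 * (1 * (c / 4) * 1) * 1 := by
            rw [norm_star, norm_star]
            have : ‖a' - a‖ ≤ c / 4 := by rw [norm_sub_rev]; exact hfa.le
            gcongr
        _ = c / 4 := by ring
    have : ‖(r⁻¹ : ℂ)‖ = r⁻¹ := by
      rw [norm_inv, Complex.norm_real, Real.norm_of_nonneg hr0.le]
    rw [this, inv_mul_lt_iff₀ hr0]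
    linarith
  have := isUnit_one_sub_of_norm_lt_one hclose
  rwa [sub_sub_cancel] at this

end Simple

/-! ### Isometries permuting a Hilbert basis -/

section Hilbert

variable {X H : Type} [NormedAddCommGroup H] [InnerProductSpace ℂ H]
  (b : HilbertBasis X ℂ H)

theorem HilbertBasis.clm_ext {T T' : H →L[ℂ] H} (h : ∀ x, T (b x) = T' (b x)) : T = T' := by
  refine ContinuousLinearMap.ext_on (s := Set.range b)
    (Submodule.dense_iff_topologicalClosure_eq_top.2 b.dense_span) ?_
  rintro _ ⟨x, rfl⟩
  exact h x

theorem HilbertBasis.vec_ext {u v : H} (h : ∀ x, inner ℂ (b x) u = inner ℂ (b x) v) : u = v := by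
  refine b.repr.injective (lp.ext (funext fun x => ?_))
  rw [b.repr_apply_apply, b.repr_apply_apply, h]

variable [CompleteSpace H]

/-- The isometry which permutes the vectors of a Hilbert basis according to an injective map. -/
def HilbertBasis.shift (f : X → X) (hf : Function.Injective f) : H →L[ℂ] H :=
  ((b.orthonormal.comp f hf).orthogonalFamily.linearIsometry.comp
    b.repr.toLinearIsometry).toContinuousLinearMap

theorem HilbertBasis.shift_apply (f : X → X) (hf : Function.Injective f) (x : X) :
    b.shift f hf (b x) = b (f x) := by
  classical
  change (b.orthonormal.comp f hf).orthogonalFamily.linearIsometry (b.repr (b x)) = _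
  rw [b.repr_self, OrthogonalFamily.linearIsometry_apply_single]
  simp

theorem HilbertBasis.star_shift_apply (f : X → X) (hf : Function.Injective f) (x : X) :
    star (b.shift f hf) (b (f x)) = b x := by
  classical
  refine b.vec_ext fun y => ?_
  rw [ContinuousLinearMap.star_eq_adjoint, ContinuousLinearMap.adjoint_inner_right, b.shift_apply,
    orthonormal_iff_ite.1 b.orthonormal, orthonormal_iff_ite.1 b.orthonormal]
  simp [hf.eq_iff]

theorem HilbertBasis.star_shift_apply_of_notMem (f : X → X) (hf : Function.Injective f) {y : X}
    (hy : ∀ x, f x ≠ y) : star (b.shift f hf) (b y) = 0 := by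
  classical
  refine b.vec_ext fun x => ?_
  rw [ContinuousLinearMap.star_eq_adjoint, ContinuousLinearMap.adjoint_inner_right, b.shift_apply,
    orthonormal_iff_ite.1 b.orthonormal, if_neg (hy x), inner_zero_right]

end Hilbert

/-! ### The representation by affine contractions of [0, 1) -/

section AffineRep

variable {P : Type} [Monoid P] (d : P →* ℕ+)

/-- The affine contraction of the unit interval onto the `j`-th of `d t` equal parts. -/
def lexContract (t : P) (j : ℕ) (x : Set.Ico (0 : ℝ) 1) : Set.Ico (0 : ℝ) 1 :=
  -- Reduction of j modulo d t gives a self-map of [0, 1) for every j; the intended range is j < d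
  -- t.
  ⟨(x + (j % d t : ℕ)) / d t, by
    have hd : (0 : ℝ) < d t := by exact_mod_cast (d t).pos
    have hx := x.2
    have hj : ((j % d t : ℕ) : ℝ) + 1 ≤ d t := by exact_mod_cast Nat.mod_lt j (d t).pos
    constructor
    · have := hx.1
      positivity
    · rw [div_lt_one hd]
      linarith [hx.2]⟩

theorem lexContract_coe {t : P} {j : ℕ} (hj : j < d t) (x : Set.Ico (0 : ℝ) 1) :
    (lexContract d t j x : ℝ) = (x + j) / d t := by
  change ((x : ℝ) + (j % d t : ℕ)) / d t = _
  rw [Nat.mod_eq_of_lt hj]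

theorem lexContract_injective (t : P) (j : ℕ) : Function.Injective (lexContract d t j) := by
  intro x y h
  have hd : (d t : ℝ) ≠ 0 := by exact_mod_cast (d t).pos.ne'
  have := congrArg Subtype.val h
  simp only [lexContract] at this
  field_simp at this
  exact Subtype.ext (by linarith)

/-- A point determines the part it lies in, so the contractions of one degree have disjoint ranges;
this yields orthogonality of the shifts. -/
theorem lexContract_eq {t : P} {j : ℕ} (hj : j < d t) {x y : Set.Ico (0 : ℝ) 1}
    (h : lexContract d t j x = y) : j = ⌊(y : ℝ) * d t⌋₊ := by
  have hd : (d t : ℝ) ≠ 0 := by exact_mod_cast (d t).pos.ne'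
  rw [← h, lexContract_coe d hj, div_mul_cancel₀ _ hd, Nat.floor_add_natCast x.2.1,
    Nat.floor_eq_zero.2 x.2.2, zero_add]

theorem exists_lexContract (t : P) (y : Set.Ico (0 : ℝ) 1) :
    ∃ (j : ℕ) (x : _), j < d t ∧ lexContract d t j x = y := by
  have hd : (d t : ℝ) ≠ 0 := by exact_mod_cast (d t).pos.ne'
  have hj := floor_mul_lt y.2.2 (d t)
  have h0 : (0 : ℝ) ≤ y * d t := mul_nonneg y.2.1 (Nat.cast_nonneg _)
  refine ⟨⌊(y : ℝ) * d t⌋₊, ⟨y * d t - ⌊(y : ℝ) * d t⌋₊, ?_, ?_⟩, hj, ?_⟩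
  · linarith [Nat.floor_le h0]
  · linarith [Nat.lt_floor_add_one ((y : ℝ) * d t)]
  · refine Subtype.ext ?_
    rw [lexContract_coe d hj]
    field_simp
    ring

theorem lexContract_comp {s t : P} {j k : ℕ} (hj : j < d s) (hk : k < d t)
    (hjk : j * d t + k < d (s * t)) (x : Set.Ico (0 : ℝ) 1) :
    lexContract d s j (lexContract d t k x) = lexContract d (s * t) (j * d t + k) x := by
  have hs : (d s : ℝ) ≠ 0 := by exact_mod_cast (d s).pos.ne'
  have ht : (d t : ℝ) ≠ 0 := by exact_mod_cast (d t).pos.ne'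
  refine Subtype.ext ?_
  rw [lexContract_coe d hj, lexContract_coe d hk, lexContract_coe d hjk, map_mul]
  push_cast
  field_simp
  ring

/-- The Hilbert space `ℓ²([0, 1))`. -/
abbrev EllTwoIco : Type := lp (fun _ : Set.Ico (0 : ℝ) 1 => ℂ) 2

/-- The standard basis of `ℓ²([0, 1))`. -/
def ellTwoIcoBasis : HilbertBasis (Set.Ico (0 : ℝ) 1) ℂ EllTwoIco := default

theorem isLexFamily_shift : IsLexFamily d fun t j =>
    ellTwoIcoBasis.shift (lexContract d t j) (lexContract_injective d t j) where
  map_mul {s t j k} hj hk := by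
    have hjk : j * d t + k < d (s * t) := by
      have := (lexEquiv d s t (⟨j, hj⟩, ⟨k, hk⟩)).2
      rwa [lexEquiv_apply] at this
    refine ellTwoIcoBasis.clm_ext fun x => ?_
    rw [mul_apply_eq_comp, HilbertBasis.shift_apply, HilbertBasis.shift_apply,
      HilbertBasis.shift_apply, lexContract_comp d hj hk hjk]
  star_mul {t j k} hj hk := by
    refine ellTwoIcoBasis.clm_ext fun x => ?_
    rw [mul_apply_eq_comp, HilbertBasis.shift_apply]
    split_ifs with h
    · subst h
      rw [HilbertBasis.star_shift_apply]
      rfl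
    · refine HilbertBasis.star_shift_apply_of_notMem _ _ _ fun y hy => h ?_
      rw [lexContract_eq d hj hy, ← lexContract_eq d hk rfl]
  sum_mul_star t := by
    refine ellTwoIcoBasis.clm_ext fun y => ?_
    obtain ⟨j, x, hj, rfl⟩ := exists_lexContract d t y
    rw [_root_.sum_apply, Finset.sum_eq_single j]
    · rw [mul_apply_eq_comp, HilbertBasis.star_shift_apply, HilbertBasis.shift_apply]
      rfl
    · intro k hk hkj
      rw [mul_apply_eq_comp, HilbertBasis.star_shift_apply_of_notMem, map_zero]
      intro z hz
      refine hkj ?_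
      rw [lexContract_eq d (Finset.mem_range.1 hk) hz, ← lexContract_eq d hj rfl]
    · intro h
      exact absurd (Finset.mem_range.2 hj) h

/-- The unit is sent to the identity operator of ℓ²([0, 1)), which is not 0. -/
theorem IsUniversalLexFamily.nontrivial {d : P →* ℕ+} {A : Type} [CStarAlgebra A] {S : P → ℕ → A}
    (hS : IsUniversalLexFamily d S) : Nontrivial A := by
  obtain ⟨f, -⟩ := hS.exists_lift (isLexFamily_shift d)
  have : Nontrivial EllTwoIco :=
    ⟨⟨ellTwoIcoBasis ⟨0, by simp⟩, 0, ellTwoIcoBasis.orthonormal.ne_zero _⟩⟩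
  refine ⟨⟨1, 0, fun h => ?_⟩⟩
  have h1 := congrArg f h
  rw [map_one, map_zero] at h1
  exact one_ne_zero h1

end AffineRep

theorem isSimple_cuntzAlg {d : Multiplicative (ℕ × ℕ) →* ℕ+} (hd : Function.Injective d)
    (hD : Filter.Tendsto (fun N : ℕ => (d (Multiplicative.ofAdd (N, N)) : ℕ))
      Filter.atTop Filter.atTop) :
    IsSimpleCStarAlgebra (lexicographic d).CuntzAlg := by
  let inst := lexCStarAlgebra d
  have hS := isUniversalLexFamily_lexGen d
  refine ⟨hS.nontrivial, fun I _ => ?_⟩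
  by_cases h : ∀ x ∈ I, x = 0
  · left
    refine le_antisymm (fun x hx => ?_) bot_le
    rw [h x hx]
    exact zero_mem _
  · right
    push Not at h
    obtain ⟨b, hbI, hb⟩ := h
    obtain ⟨u, v, w, hw⟩ := hS.exists_isUnit hd hD hb
    refine le_antisymm le_top fun x _ => ?_
    have h1 : u * b * v ∈ I := I.mul_mem_right _ _ (I.mul_mem_left _ _ hbI)
    have h2 : x = x * (↑w⁻¹ : (lexicographic d).CuntzAlg) * (u * b * v) := by
      rw [← hw, mul_assoc, Units.inv_mul, mul_one]
    rw [h2]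
    exact I.mul_mem_left _ _ h1

/-! ### C(𝕋) as the algebra of a unitary, and maps out of 𝓞ₗ ⊗ C(𝕋) -/

section CircleAlgebra

/-- The inclusion of the circle in the complex plane. -/
def circleCoord : C(Circle, ℂ) := ⟨fun z => z, continuous_subtype_val⟩

theorem circleCoord_mem_unitary : circleCoord ∈ unitary C(Circle, ℂ) := by
  rw [Unitary.mem_iff]
  constructor <;> ext z
  · change star (z : ℂ) * z = 1
    rw [star_coe_circle, coe_inv_mul_coe]
  · change (z : ℂ) * star (z : ℂ) = 1
    rw [star_coe_circle, coe_mul_coe_inv]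

theorem adjoin_circleCoord_dense :
    (StarAlgebra.adjoin ℂ {circleCoord}).topologicalClosure = ⊤ := by
  refine ContinuousMap.starSubalgebra_topologicalClosure_eq_top_of_separatesPoints _ ?_
  intro x y hxy
  refine ⟨circleCoord, ⟨circleCoord, StarAlgebra.self_mem_adjoin_singleton ℂ _, rfl⟩, ?_⟩
  exact fun h => hxy (Circle.ext h)

variable {D : Type} [CStarAlgebra D]

theorem circle_hom_ext {f g : C(Circle, ℂ) →⋆ₐ[ℂ] D} (h : f circleCoord = g circleCoord) :
    f = g := by
  ext a
  have ha : a ∈ (StarAlgebra.adjoin ℂ {circleCoord}).topologicalClosure := by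
    rw [adjoin_circleCoord_dense]; trivial
  have hle : (StarAlgebra.adjoin ℂ {circleCoord}).topologicalClosure ≤
      StarAlgHom.equalizer f g := by
    refine StarSubalgebra.topologicalClosure_minimal ?_
      (isClosed_eq (map_continuous f) (map_continuous g))
    refine StarAlgebra.adjoin_le ?_
    rintro _ rfl
    exact h
  exact hle ha

/-- The homomorphism determined by a unitary. -/
def circleLift (u : unitary D) : C(Circle, ℂ) →⋆ₐ[ℂ] D :=
  (cfcHom (R := ℂ) (a := (u : D)) (p := IsStarNormal) inferInstance).comp
    (ContinuousMap.compStarAlgHom' ℂ ℂ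
      ⟨fun z : spectrum ℂ (u : D) => (⟨z, spectrum.subset_circle_of_unitary u.2 z.2⟩ : Circle),
        by fun_prop⟩)

theorem circleLift_coord (u : unitary D) : circleLift u circleCoord = u := by
  refine Eq.trans ?_ (cfcHom_id (R := ℂ) (a := (u : D)) (p := IsStarNormal) inferInstance)
  rfl

theorem commute_of_circleCoord (g : C(Circle, ℂ) →⋆ₐ[ℂ] D) {x : D}
    (h1 : Commute x (g circleCoord)) (h2 : Commute (star x) (g circleCoord)) (f : C(Circle, ℂ)) :
    Commute x (g f) := by
  have hle : StarAlgebra.adjoin ℂ {circleCoord} ≤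
      (StarSubalgebra.centralizer ℂ {x}).comap g := by
    refine StarAlgebra.adjoin_le ?_
    rintro _ rfl
    refine (StarSubalgebra.mem_comap _ _ _).2 ((StarSubalgebra.mem_centralizer_iff ℂ).2 ?_)
    rintro _ rfl
    exact ⟨h1, h2⟩
  have hf : f ∈ (StarAlgebra.adjoin ℂ {circleCoord}).topologicalClosure := by
    rw [adjoin_circleCoord_dense]; trivial
  have hc : (StarAlgebra.adjoin ℂ {circleCoord}).topologicalClosure ≤
      (StarSubalgebra.centralizer ℂ {x}).comap g := by
    refine StarSubalgebra.topologicalClosure_minimal hle ?_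
    exact (Set.isClosed_centralizer _).preimage (map_continuous g)
  exact ((StarSubalgebra.mem_centralizer_iff ℂ).1 ((StarSubalgebra.mem_comap _ _ _).1 (hc hf)) x rfl).1

/-- Commutation must be assumed for both `x` and `star x`: the adjoint step of the induction on
polynomials exchanges the two. -/
theorem CStarRelations.Universal.commute {X : Type} {R : CStarRelations X}
    (f : R.Universal →⋆ₐ[ℂ] D) {x : D} (h1 : ∀ g, Commute x (f (ι g)))
    (h2 : ∀ g, Commute (star x) (f (ι g))) (a : R.Universal) : Commute x (f a) := by
  induction a using ind with
  | hc =>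
    exact isClosed_eq (continuous_const.mul (map_continuous f))
      ((map_continuous f).mul continuous_const)
  | h a =>
    induction a using Pre.ind with | h p
    suffices Commute x (f (of (Pre.mk p))) ∧ Commute (star x) (f (of (Pre.mk p))) from this.1
    induction p with
    | gen y => exact ⟨h1 y, h2 y⟩
    | const c =>
      rw [of_gen_const, AlgHomClass.commutes f]
      exact ⟨(Algebra.commutes c x).symm, (Algebra.commutes c (star x)).symm⟩
    | add p q hp hq =>
      rw [of_gen_add, map_add]
      exact ⟨hp.1.add_right hq.1, hp.2.add_right hq.2⟩
    | mul p q hp hq =>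
      rw [of_gen_mul, map_mul]
      exact ⟨hp.1.mul_right hq.1, hp.2.mul_right hq.2⟩
    | conj p hp =>
      rw [of_gen_conj, map_star]
      exact ⟨by simpa using hp.2.star_star, hp.1.star_star⟩

theorem Commute.star_unitary_left {u : unitary D} {x : D} (h : Commute (u : D) x) :
    Commute (star (u : D)) x := by
  have h1 : star (u : D) * u = 1 := Unitary.coe_star_mul_self u
  have h2 : (u : D) * star (u : D) = 1 := Unitary.coe_mul_star_self u
  calc star (u : D) * x = star (u : D) * (x * (u * star (u : D))) := by rw [h2, mul_one]
    _ = star (u : D) * (x * u) * star (u : D) := by simp only [mul_assoc]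
    _ = star (u : D) * (u * x) * star (u : D) := by rw [h.eq]
    _ = x * star (u : D) := by rw [← mul_assoc, h1, one_mul]

theorem Commute.unitary_zpow_left {u : unitary D} {x : D} (h : Commute (u : D) x) (k : ℤ) :
    Commute ((u ^ k : unitary D) : D) x := by
  have h1 : Commute ((Unitary.toUnits u : Dˣ) : D) x := h
  have := h1.units_zpow_left k
  rwa [← map_zpow] at this

/-- The homomorphism of `𝓞ₗ ⊗ C(𝕋)` determined by a Cuntz family and a commuting unitary. -/
theorem exists_cuntzTensor_hom {l : ℕ} {s : Fin l → D} (hs : IsCuntzFamily l D s) {u : unitary D}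
    (hu : ∀ i, Commute (u : D) (s i)) :
    ∃ f : CStarTensor (CuntzAlgebra l) C(Circle, ℂ) →⋆ₐ[ℂ] D,
      (∀ i, f (CStarTensor.inclLeft (CStarRelations.Universal.ι i)) = s i) ∧
      f (CStarTensor.inclRight circleCoord) = u := by
  have hcomm : ∀ a, Commute (u : D) (CuntzAlgebra.lift hs a) :=
    CStarRelations.Universal.commute _ (fun i => by rw [CuntzAlgebra.lift_ι]; exact hu i)
      (fun i => by rw [CuntzAlgebra.lift_ι]; exact (hu i).star_unitary_left)
  have h : ∀ a b, Commute (CuntzAlgebra.lift hs a) (circleLift u b) := fun a b => by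
    refine commute_of_circleCoord _ ?_ ?_ b
    · rw [circleLift_coord]; exact (hcomm a).symm
    · rw [circleLift_coord, ← map_star]; exact (hcomm (star a)).symm
  refine ⟨CStarTensor.lift (CuntzAlgebra.lift hs) (circleLift u) h, fun i => ?_, ?_⟩
  · rw [CStarTensor.lift_inclLeft, CuntzAlgebra.lift_ι]
  · rw [CStarTensor.lift_inclRight, circleLift_coord]

theorem cuntzTensor_hom_ext {l : ℕ}
    {f g : CStarTensor (CuntzAlgebra l) C(Circle, ℂ) →⋆ₐ[ℂ] D}
    (h1 : ∀ i, f (CStarTensor.inclLeft (CStarRelations.Universal.ι i)) =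
      g (CStarTensor.inclLeft (CStarRelations.Universal.ι i)))
    (h2 : f (CStarTensor.inclRight circleCoord) = g (CStarTensor.inclRight circleCoord)) :
    f = g := by
  refine CStarTensor.hom_ext (fun a => ?_) fun b => ?_
  · exact DFunLike.congr_fun (CStarRelations.Universal.hom_ext
      (f := f.comp CStarTensor.inclLeft) (g := g.comp CStarTensor.inclLeft) h1) a
  · exact DFunLike.congr_fun (circle_hom_ext
      (f := f.comp CStarTensor.inclRight) (g := g.comp CStarTensor.inclRight) h2) b

end CircleAlgebra

/-! ### Extending a lexicographic family to fractions of degrees -/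

section Quotients

theorem sum_range_mul_eq {M : Type} [AddCommMonoid M] (a b : ℕ) (F : ℕ → M) :
    ∑ K ∈ Finset.range (a * b), F K =
      ∑ k ∈ Finset.range a, ∑ e ∈ Finset.range b, F (k * b + e) := by
  induction a with
  | zero => simp
  | succ a ih => rw [Nat.succ_mul, Finset.sum_range_add, ih, Finset.sum_range_succ]

theorem mul_add_lt {D a i k : ℕ} (hi : i < D) (hk : k < a) : i * a + k < D * a := by
  calc i * a + k < i * a + a := by omega
    _ = (i + 1) * a := by ring
    _ ≤ D * a := Nat.mul_le_mul_right _ hi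

theorem mul_add_inj {a i j k k' : ℕ} (hk : k < a) (hk' : k' < a) :
    i * a + k = j * a + k' ↔ i = j ∧ k = k' := by
  constructor
  · intro h
    have h1 := congrArg (· / a) h
    have h2 := congrArg (· % a) h
    rw [Nat.mul_add_mod_self_right, Nat.mul_add_mod_self_right, Nat.mod_eq_of_lt hk,
      Nat.mod_eq_of_lt hk'] at h2
    subst h2
    exact ⟨Nat.eq_of_mul_eq_mul_right (by omega) (Nat.add_right_cancel h), rfl⟩
  · rintro ⟨rfl, rfl⟩; rfl

variable {P : Type} [CommMonoid P] {d : P →* ℕ+} {A : Type} [CStarAlgebra A] {S : P → ℕ → A}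

variable (d S) in
/-- The elements which extend a lexicographic family to the quotients `p / q` of degrees for which
`d q` divides `d p`. -/
def lexQuot (p q : P) (i : ℕ) : A :=
  ∑ k ∈ Finset.range (d q), S p (i * d q + k) * star (S q k)

namespace IsLexFamily

theorem lexQuot_one (hS : IsLexFamily d S) (p : P) (i : ℕ) : lexQuot d S p 1 i = S p i := by
  simp [lexQuot, hS.one]

theorem lexQuot_self (hS : IsLexFamily d S) (p : P) : lexQuot d S p p 0 = 1 := by
  simp [lexQuot, hS.sum_mul_star]

/-- Cancelling a common factor is the refinement of each summand by degree `r`; regrouping the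
double index gives the sum for the larger fraction. -/
theorem lexQuot_mul_mul (hS : IsLexFamily d S) {p q : P} (r : P) {D i : ℕ}
    (hD : (d p : ℕ) = D * d q) (hi : i < D) :
    lexQuot d S (p * r) (q * r) i = lexQuot d S p q i := by
  simp only [lexQuot, _root_.map_mul, PNat.mul_coe]
  rw [sum_range_mul_eq]
  refine Finset.sum_congr rfl fun k hk => ?_
  rw [Finset.mem_range] at hk
  rw [hS.mul_star_expand r (by rw [hD]; exact mul_add_lt hi hk) hk]
  refine Finset.sum_congr rfl fun e _ => ?_
  congr 2
  ring

/-- The adjoints of degree `q` meet the isometries of degree `q`, and orthogonality leaves a single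
index for each `k`. -/
theorem lexQuot_mul_lexQuot_aux (hS : IsLexFamily d S) {p q r : P} {D' i j : ℕ}
    (hD' : (d q : ℕ) = D' * d r) (hj : j < D') :
    lexQuot d S p q i * lexQuot d S q r j = lexQuot d S p r (i * D' + j) := by
  rw [lexQuot, lexQuot, Finset.mul_sum, lexQuot]
  refine Finset.sum_congr rfl fun k hk => ?_
  rw [Finset.mem_range] at hk
  have hjk : j * d r + k < d q := by rw [hD']; exact mul_add_lt hj hk
  rw [Finset.sum_mul, Finset.sum_eq_single (j * d r + k)]
  · rw [mul_assoc, ← mul_assoc (star (S q _)), hS.star_mul hjk hjk, if_pos rfl, one_mul]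
    congr 2
    rw [hD']
    ring
  · intro e he hne
    rw [mul_assoc, ← mul_assoc (star (S q _)), hS.star_mul (Finset.mem_range.1 he) hjk, if_neg hne,
      zero_mul, mul_zero]
  · intro h
    exact absurd (Finset.mem_range.2 hjk) h

/-- Expanding the fractions to `p * p' / (q * p')` and `q * p' / (q * q')` makes the inner degrees
agree. -/
theorem lexQuot_mul_lexQuot (hS : IsLexFamily d S) {p q p' q' : P} {D D' i j : ℕ}
    (hD : (d p : ℕ) = D * d q) (hi : i < D) (hD' : (d p' : ℕ) = D' * d q') (hj : j < D') :
    lexQuot d S p q i * lexQuot d S p' q' j = lexQuot d S (p * p') (q * q') (i * D' + j) := by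
  rw [← hS.lexQuot_mul_mul p' hD hi, ← hS.lexQuot_mul_mul q hD' hj, mul_comm p' q, mul_comm q' q]
  refine hS.lexQuot_mul_lexQuot_aux ?_ hj
  simp only [_root_.map_mul, PNat.mul_coe, hD']; ring

theorem lexQuot_congr (hS : IsLexFamily d S) {p q p' q' : P} {D i : ℕ}
    (hD : (d p : ℕ) = D * d q) (hD' : (d p' : ℕ) = D * d q') (hi : i < D)
    (h : p * q' = p' * q) : lexQuot d S p q i = lexQuot d S p' q' i := by
  rw [← hS.lexQuot_mul_mul q' hD hi, ← hS.lexQuot_mul_mul q hD' hi, h, mul_comm q q']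

theorem star_lexQuot_mul (hS : IsLexFamily d S) {p q : P} {D i j : ℕ}
    (hD : (d p : ℕ) = D * d q) (hi : i < D) (hj : j < D) :
    star (lexQuot d S p q i) * lexQuot d S p q j = if i = j then 1 else 0 := by
  have key : ∀ k ∈ Finset.range (d q), ∀ k' ∈ Finset.range (d q),
      star (S p (i * d q + k) * star (S q k)) * (S p (j * d q + k') * star (S q k')) =
      if i = j ∧ k = k' then S q k * star (S q k) else 0 := by
    intro k hk k' hk'
    rw [Finset.mem_range] at hk hk'
    rw [StarMul.star_mul, star_star, mul_assoc, ← mul_assoc (star (S p _)),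
      hS.star_mul (by rw [hD]; exact mul_add_lt hi hk) (by rw [hD]; exact mul_add_lt hj hk')]
    simp only [mul_add_inj hk hk']
    split_ifs with h
    · rw [one_mul, h.2]
    · simp
  rw [lexQuot, lexQuot, star_sum, Finset.sum_mul_sum,
    Finset.sum_congr rfl fun k hk => Finset.sum_congr rfl (key k hk)]
  split_ifs with h
  · rw [← hS.sum_mul_star q]
    refine Finset.sum_congr rfl fun k hk => ?_
    rw [Finset.sum_eq_single k]
    · simp [h]
    · intro k' _ hne
      simp [hne.symm]
    · intro h'
      exact absurd hk h'
  · simp [h]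

theorem sum_lexQuot_mul_star (hS : IsLexFamily d S) {p q : P} {D : ℕ}
    (hD : (d p : ℕ) = D * d q) :
    ∑ i ∈ Finset.range D, lexQuot d S p q i * star (lexQuot d S p q i) = 1 := by
  rw [← hS.sum_mul_star p, hD, sum_range_mul_eq]
  refine Finset.sum_congr rfl fun i _ => ?_
  rw [lexQuot, star_sum, Finset.sum_mul_sum]
  refine Finset.sum_congr rfl fun k hk => ?_
  rw [Finset.sum_eq_single k]
  · rw [StarMul.star_mul, star_star, mul_assoc, ← mul_assoc (star (S q k)),
      hS.star_mul (Finset.mem_range.1 hk) (Finset.mem_range.1 hk), if_pos rfl, one_mul]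
  · intro k' hk' hne
    rw [StarMul.star_mul, star_star, mul_assoc, ← mul_assoc (star (S q k)),
      hS.star_mul (Finset.mem_range.1 hk) (Finset.mem_range.1 hk'), if_neg hne.symm, zero_mul,
      mul_zero]
  · intro h
    exact absurd hk h

theorem star_lexQuot_zero {p q : P} (h : (d p : ℕ) = d q) :
    star (lexQuot d S p q 0) = lexQuot d S q p 0 := by
  simp [lexQuot, h]

theorem lexQuot_pow (hS : IsLexFamily d S) {p q : P} (h : (d p : ℕ) = d q) (n : ℕ) :
    lexQuot d S p q 0 ^ n = lexQuot d S (p ^ n) (q ^ n) 0 := by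
  induction n with
  | zero => rw [pow_zero, pow_zero, pow_zero, hS.lexQuot_self]
  | succ n ih =>
    rw [pow_succ, ih, pow_succ, pow_succ, hS.lexQuot_mul_lexQuot (D := 1) (D' := 1) _ zero_lt_one _
      zero_lt_one]
    · simp
    · simp [h]
    · simp [h]

end IsLexFamily

end Quotients

/-! ### Words in a Cuntz family -/

section Words

variable {B : Type} [CStarAlgebra B] {l : ℕ}

/-- The product of the isometries of a Cuntz family along the base `l` expansion of length `N`. -/
def cuntzWord (l : ℕ) (s : ℕ → B) : ℕ → ℕ → B
  | 0, _ => 1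
  | N + 1, j => cuntzWord l s N (j / l) * s (j % l)

variable {s : ℕ → B}

/-- Concatenating base-l expansions of lengths M and N is the lexicographic rule for indices. -/
theorem cuntzWord_mul (hl : 0 < l) (M N i j : ℕ) (hj : j < l ^ N) :
    cuntzWord l s M i * cuntzWord l s N j = cuntzWord l s (M + N) (i * l ^ N + j) := by
  induction N generalizing j with
  | zero =>
    have : j = 0 := by simpa using hj
    simp [cuntzWord, this]
  | succ N ih =>
    have h1 : j / l < l ^ N := by
      rw [Nat.div_lt_iff_lt_mul hl, ← pow_succ]; exact hj
    have e : i * l ^ (N + 1) + j = j + (i * l ^ N) * l := by rw [pow_succ]; ring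
    rw [← Nat.add_assoc, cuntzWord, cuntzWord, ← mul_assoc, ih _ h1, e,
      Nat.add_mul_div_right _ _ hl, Nat.add_mul_mod_self_right, add_comm (j / l)]

theorem star_cuntzWord_mul (hl : 0 < l)
    (hs : ∀ i < l, ∀ j < l, star (s i) * s j = if i = j then 1 else 0) (N j k : ℕ)
    (hj : j < l ^ N) (hk : k < l ^ N) :
    star (cuntzWord l s N j) * cuntzWord l s N k = if j = k then 1 else 0 := by
  induction N generalizing j k with
  | zero =>
    have h1 : j = 0 := by simpa using hj
    have h2 : k = 0 := by simpa using hk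
    simp [cuntzWord, h1, h2]
  | succ N ih =>
    rw [cuntzWord, cuntzWord, star_mul, mul_assoc, ← mul_assoc (star (cuntzWord _ _ _ _)), ih]
    · have h3 : j = k ↔ j / l = k / l ∧ j % l = k % l := by
        constructor
        · rintro rfl; exact ⟨rfl, rfl⟩
        · rintro ⟨h1, h2⟩
          rw [← Nat.div_add_mod j l, h1, h2, Nat.div_add_mod]
      by_cases h : j / l = k / l
      · rw [if_pos h, one_mul, hs _ (Nat.mod_lt _ hl) _ (Nat.mod_lt _ hl)]
        simp [h3, h]
      · rw [if_neg h, zero_mul, mul_zero, if_neg fun h' => h (h3.1 h').1]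
    · rw [Nat.div_lt_iff_lt_mul hl, ← pow_succ]; exact hj
    · rw [Nat.div_lt_iff_lt_mul hl, ← pow_succ]; exact hk

theorem sum_cuntzWord_mul_star (hl : 0 < l) (hs : ∑ i ∈ Finset.range l, s i * star (s i) = 1)
    (N : ℕ) :
    ∑ j ∈ Finset.range (l ^ N), cuntzWord l s N j * star (cuntzWord l s N j) = 1 := by
  induction N with
  | zero => simp [cuntzWord]
  | succ N ih =>
    rw [pow_succ, sum_range_mul_eq, ← ih]
    refine Finset.sum_congr rfl fun k _ => ?_
    have : ∀ e ∈ Finset.range l, cuntzWord l s (N + 1) (k * l + e) *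
        star (cuntzWord l s (N + 1) (k * l + e)) =
        cuntzWord l s N k * (s e * star (s e)) * star (cuntzWord l s N k) := by
      intro e he
      rw [Finset.mem_range] at he
      rw [cuntzWord, mul_comm k l, Nat.mul_add_div hl, Nat.mul_add_mod, Nat.mod_eq_of_lt he,
        Nat.div_eq_of_lt he, add_zero, star_mul]
      simp only [mul_assoc]
    rw [Finset.sum_congr rfl this, ← Finset.sum_mul, ← Finset.mul_sum, hs, mul_one]

theorem commute_cuntzWord {x : B} (hx : ∀ i, Commute x (s i)) (N j : ℕ) :
    Commute x (cuntzWord l s N j) := by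
  induction N generalizing j with
  | zero => exact Commute.one_right x
  | succ N ih => exact (ih _).mul_right (hx _)

theorem map_cuntzWord {D : Type} [CStarAlgebra D] (f : B →⋆ₐ[ℂ] D) (N j : ℕ) :
    f (cuntzWord l s N j) = cuntzWord l (fun i => f (s i)) N j := by
  induction N generalizing j with
  | zero => exact map_one f
  | succ N ih => rw [cuntzWord, cuntzWord, map_mul, ih]

end Words

/-! ### The lexicographic family built from a Cuntz family and a unitary -/

section Isomorphism

theorem commute_star_zpow {B : Type} [CStarAlgebra B] {u : unitary B} {w : B}
    (h : Commute (u : B) w) (k : ℤ) : Commute ((u ^ k : unitary B) : B) (star w) := by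
  have h1 := (h.unitary_zpow_left (-k)).star_star
  rwa [← Unitary.coe_star, Unitary.star_eq_inv, ← zpow_neg, neg_neg] at h1

variable {B : Type} [CStarAlgebra B] {l m n : ℕ+} {a b : ℕ} {s : ℕ → B} {u : unitary B}

/-- The length `a p + b q` of an element of `ℕ²`. -/
def lexLength (a b : ℕ) (p : Multiplicative (ℕ × ℕ)) : ℕ := a * p.toAdd.1 + b * p.toAdd.2

/-- The second coordinate `x q - y p` of an element of `ℕ²`. -/
def lexTwist (x y : ℤ) (p : Multiplicative (ℕ × ℕ)) : ℤ := x * p.toAdd.2 - y * p.toAdd.1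

theorem lexLength_mul (p q : Multiplicative (ℕ × ℕ)) :
    lexLength a b (p * q) = lexLength a b p + lexLength a b q := by
  simp [lexLength]; ring

theorem lexTwist_mul (x y : ℤ) (p q : Multiplicative (ℕ × ℕ)) :
    lexTwist x y (p * q) = lexTwist x y p + lexTwist x y q := by
  simp [lexTwist]; ring

theorem powHom_eq_pow (hm : m = l ^ a) (hn : n = l ^ b) (p : Multiplicative (ℕ × ℕ)) :
    (powHom m n p : ℕ) = (l : ℕ) ^ lexLength a b p := by
  change ((m ^ p.toAdd.1 * n ^ p.toAdd.2 : ℕ+) : ℕ) = _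
  rw [hm, hn, lexLength, pow_add, pow_mul, pow_mul]
  simp

/-- The lexicographic family of words in a Cuntz family, twisted by a commuting unitary. -/
def twistedWord (l : ℕ) (a b : ℕ) (x y : ℤ) (s : ℕ → B) (u : unitary B)
    (p : Multiplicative (ℕ × ℕ)) (j : ℕ) : B :=
  cuntzWord l s (lexLength a b p) j * ((u ^ lexTwist x y p : unitary B) : B)

theorem coe_zpow_mul_star (u : unitary B) (j k : ℤ) :
    ((u ^ j : unitary B) : B) * star ((u ^ k : unitary B) : B) = ((u ^ (j - k) : unitary B) : B) := by
  rw [← Unitary.coe_star, Unitary.star_eq_inv, zpow_sub]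
  rfl

theorem isLexFamily_twistedWord (hm : m = l ^ a) (hn : n = l ^ b) (x y : ℤ)
    (hs : ∀ i < (l : ℕ), ∀ j < (l : ℕ), star (s i) * s j = if i = j then 1 else 0)
    (hs' : ∑ i ∈ Finset.range l, s i * star (s i) = 1) (hu : ∀ i, Commute (u : B) (s i)) :
    IsLexFamily (powHom m n) (twistedWord l a b x y s u) where
  map_mul {p q j k} hj hk := by
    rw [powHom_eq_pow hm hn] at hj hk
    rw [twistedWord, twistedWord, twistedWord, powHom_eq_pow hm hn, lexLength_mul, lexTwist_mul,
      ← cuntzWord_mul l.pos _ _ _ _ hk, mul_assoc, ← mul_assoc (Subtype.val _),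
      ((commute_cuntzWord hu _ _).unitary_zpow_left _).eq, zpow_add]
    simp only [mul_assoc, Submonoid.coe_mul]
  star_mul {p j k} hj hk := by
    rw [powHom_eq_pow hm hn] at hj hk
    rw [twistedWord, twistedWord, StarMul.star_mul, mul_assoc,
      ← mul_assoc (star (cuntzWord _ _ _ _)), star_cuntzWord_mul l.pos hs _ _ _ hj hk]
    split_ifs
    · rw [one_mul]
      exact Unitary.coe_star_mul_self _
    · simp
  sum_mul_star p := by
    rw [powHom_eq_pow hm hn, ← sum_cuntzWord_mul_star l.pos hs' (lexLength a b p)]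
    refine Finset.sum_congr rfl fun j _ => ?_
    rw [twistedWord, StarMul.star_mul, mul_assoc, ← mul_assoc (Subtype.val _), coe_zpow_mul_star,
      sub_self, zpow_zero, OneMemClass.coe_one, one_mul]

/-- The last letters of the longer word cancel against the shorter one, by the resolution of 1 for
words, and the twists subtract. -/
theorem lexQuot_twistedWord (hm : m = l ^ a) (hn : n = l ^ b) (x y : ℤ)
    (hs' : ∑ i ∈ Finset.range l, s i * star (s i) = 1) (hu : ∀ i, Commute (u : B) (s i))
    {p q : Multiplicative (ℕ × ℕ)} {r : ℕ} (hpq : lexLength a b p = lexLength a b q + r) (i : ℕ) :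
    lexQuot (powHom m n) (twistedWord l a b x y s u) p q i =
      cuntzWord l s r i * ((u ^ (lexTwist x y p - lexTwist x y q) : unitary B) : B) := by
  rw [lexQuot, powHom_eq_pow hm hn]
  have : ∀ k ∈ Finset.range ((l : ℕ) ^ lexLength a b q),
      twistedWord l a b x y s u p (i * (l : ℕ) ^ lexLength a b q + k) *
        star (twistedWord l a b x y s u q k) =
      cuntzWord l s r i * (cuntzWord l s (lexLength a b q) k *
        star (cuntzWord l s (lexLength a b q) k)) *
        ((u ^ (lexTwist x y p - lexTwist x y q) : unitary B) : B) := by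
    intro k hk
    rw [Finset.mem_range] at hk
    rw [twistedWord, twistedWord, hpq, add_comm _ r, ← cuntzWord_mul l.pos _ _ _ _ hk, star_mul,
      mul_assoc _ _ (star _ * star _), ← mul_assoc (Subtype.val _), coe_zpow_mul_star,
      (commute_star_zpow (commute_cuntzWord hu _ _) _).eq]
    simp only [mul_assoc]
  rw [Finset.sum_congr rfl this, ← Finset.sum_mul, ← Finset.mul_sum,
    sum_cuntzWord_mul_star l.pos hs', mul_one]

end Isomorphism

/-! ### The isomorphism with 𝓞ₗ ⊗ C(𝕋) -/

section Rational

variable {A : Type} [CStarAlgebra A] {m n l : ℕ+} {a b : ℕ} {S : Multiplicative (ℕ × ℕ) → ℕ → A}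

theorem map_lexQuot {P : Type} [CommMonoid P] {d : P →* ℕ+} {S : P → ℕ → A} {B : Type}
    [CStarAlgebra B] {T : P → ℕ → B} (f : A →⋆ₐ[ℂ] B)
    (hf : ∀ (p : P) (j : ℕ), j < d p → f (S p j) = T p j) {p q : P} {D i : ℕ}
    (hD : (d p : ℕ) = D * d q) (hi : i < D) : f (lexQuot d S p q i) = lexQuot d T p q i := by
  rw [lexQuot, map_sum, lexQuot]
  refine Finset.sum_congr rfl fun k hk => ?_
  rw [Finset.mem_range] at hk
  rw [map_mul, map_star, hf _ _ hk, hf _ _ (by rw [hD]; exact mul_add_lt hi hk)]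

theorem IsLexFamily.cuntzWord_lexQuot {P : Type} [CommMonoid P] {d : P →* ℕ+} {S : P → ℕ → A}
    (hS : IsLexFamily d S) {p q : P} {l : ℕ} (hl : 0 < l) (h : (d p : ℕ) = l * d q) {s : ℕ → A}
    (hs : ∀ i < l, s i = lexQuot d S p q i) (N j : ℕ) (hj : j < l ^ N) :
    cuntzWord l s N j = lexQuot d S (p ^ N) (q ^ N) j := by
  induction N generalizing j with
  | zero =>
    have : j = 0 := by simpa using hj
    rw [this, pow_zero, pow_zero, hS.lexQuot_self]
    rfl
  | succ N ih =>
    have h1 : j / l < l ^ N := by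
      rw [Nat.div_lt_iff_lt_mul hl, ← pow_succ]; exact hj
    have h2 : (d (p ^ N) : ℕ) = l ^ N * d (q ^ N) := by
      simp [h, mul_pow]
    rw [cuntzWord, ih _ h1, hs _ (Nat.mod_lt _ hl),
      hS.lexQuot_mul_lexQuot h2 h1 h (Nat.mod_lt _ hl), Nat.div_add_mod', ← pow_succ, ← pow_succ]

theorem IsLexFamily.coe_zpow_lexQuot {P : Type} [CommMonoid P] {d : P →* ℕ+} {S : P → ℕ → A}
    (hS : IsLexFamily d S) {p q : P} (h : (d p : ℕ) = d q) {u : unitary A}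
    (hu : (u : A) = lexQuot d S p q 0) (c : ℤ) : ((u ^ c : unitary A) : A) =
      lexQuot d S (p ^ c.toNat * q ^ (-c).toNat) (q ^ c.toNat * p ^ (-c).toNat) 0 := by
  have hstar : star (u : A) = lexQuot d S q p 0 := by rw [hu, star_lexQuot_zero h]
  obtain ⟨k, rfl | rfl⟩ := c.eq_nat_or_neg
  · rw [zpow_natCast, SubmonoidClass.coe_pow, hu, hS.lexQuot_pow h]
    simp
  · rw [zpow_neg, zpow_natCast, ← inv_pow, ← Unitary.star_eq_inv, SubmonoidClass.coe_pow,
      Unitary.coe_star, hstar, hS.lexQuot_pow h.symm]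
    simp

/-- Compressing the resolution of 1 by `s j` gives a sum of positive elements equal to 1 whose j-th
term is already 1, so the others vanish. -/
theorem IsCuntzFamily.star_mul_of_ne {l : ℕ} {s : Fin l → A} (hs : IsCuntzFamily l A s)
    {i j : Fin l} (hij : i ≠ j) : star (s i) * s j = 0 := by
  let _ := CStarAlgebra.spectralOrder A
  have := CStarAlgebra.spectralOrderedRing A
  have h1 : ∑ k, star (star (s k) * s j) * (star (s k) * s j) = 1 := by
    calc _ = star (s j) * (∑ k, s k * star (s k)) * s j := by
          rw [Finset.mul_sum, Finset.sum_mul]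
          simp only [star_mul, star_star, mul_assoc]
      _ = 1 := by rw [hs.2, mul_one, hs.1]
  rw [← Finset.add_sum_erase _ _ (Finset.mem_univ j), hs.1, star_one, one_mul,
    add_eq_left, Finset.sum_eq_zero_iff_of_nonneg fun k _ => star_mul_self_nonneg _] at h1
  exact CStarRing.star_mul_self_eq_zero_iff _ |>.1
    (h1 i (Finset.mem_erase.2 ⟨hij, Finset.mem_univ i⟩))

/-- A Cuntz family and a commuting unitary in `D` such that `D` has the universal property of
`𝓞ₗ ⊗ C(𝕋)`. -/
structure IsUniversalCuntzPair (l : ℕ) {D : Type} [CStarAlgebra D] (s : Fin l → D)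
    (u : unitary D) : Prop where
  family : IsCuntzFamily l D s
  commute : ∀ i, Commute (u : D) (s i)
  exists_lift : ∀ {B : Type} [CStarAlgebra B] {t : Fin l → B} {v : unitary B},
    IsCuntzFamily l B t → (∀ i, Commute (v : B) (t i)) →
      ∃ f : D →⋆ₐ[ℂ] B, (∀ i, f (s i) = t i) ∧ f u = v
  hom_ext : ∀ {B : Type} [CStarAlgebra B] {f g : D →⋆ₐ[ℂ] B},
    (∀ i, f (s i) = g (s i)) → f u = g u → f = g

theorem exists_isUniversalCuntzPair (l : ℕ) :
    ∃ (s : Fin l → CStarTensor (CuntzAlgebra l) C(Circle, ℂ)) (u : unitary _),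
      IsUniversalCuntzPair l s u := by
  have hι := isCuntzFamily_ι l
  have h1 := Unitary.mem_iff.1 circleCoord_mem_unitary
  refine ⟨fun i => CStarTensor.inclLeft (CStarRelations.Universal.ι i),
    ⟨CStarTensor.inclRight circleCoord, ?_⟩, ⟨?_, ?_⟩, ?_, ?_, ?_⟩
  · rw [Unitary.mem_iff, ← map_star, ← map_mul, ← map_mul, h1.1, h1.2]
    exact ⟨map_one _, map_one _⟩
  · intro i
    rw [← map_star, ← map_mul, hι.1, map_one]
  · rw [← map_one (CStarTensor.inclLeft (B := C(Circle, ℂ))), ← hι.2, map_sum]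
    refine Finset.sum_congr rfl fun i _ => ?_
    rw [map_mul, map_star]
  · exact fun i => (CStarTensor.commute_incl _ _).symm
  · exact fun ht hv => exists_cuntzTensor_hom ht hv
  · exact fun h1 h2 => cuntzTensor_hom_ext h1 h2

/-- If `m` and `n` are the powers of `l` with coprime exponents, then a C*-algebra which is
generated by a universal lexicographic family for `(m, n)` is isomorphic to `𝓞ₗ ⊗ C(𝕋)`. -/
theorem IsUniversalLexFamily.exists_inverse (hS : IsUniversalLexFamily (powHom m n) S)
    (hm : m = l ^ a) (hn : n = l ^ b) (hab : a.Coprime b) {D : Type} [CStarAlgebra D]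
    {s : Fin l → D} {u : unitary D} (hD : IsUniversalCuntzPair l s u) :
    ∃ (f : A →⋆ₐ[ℂ] D) (g : D →⋆ₐ[ℂ] A), (∀ x, g (f x) = x) ∧ ∀ y, f (g y) = y := by
  obtain ⟨x, y, hxy⟩ := Nat.isCoprime_iff_coprime.2 hab
  -- Written additively, p₁ - p₂ = (x, y) and q₁ - q₂ = (-b, a). By Bézout these form a basis of ℤ²,
  -- of lengths 1 and 0, so the corresponding fractions have dimensions l and 1.
  set p₁ : Multiplicative (ℕ × ℕ) := Multiplicative.ofAdd (x.toNat, y.toNat) with hp₁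
  set p₂ : Multiplicative (ℕ × ℕ) := Multiplicative.ofAdd ((-x).toNat, (-y).toNat) with hp₂
  set q₁ : Multiplicative (ℕ × ℕ) := Multiplicative.ofAdd (0, a) with hq₁
  set q₂ : Multiplicative (ℕ × ℕ) := Multiplicative.ofAdd (b, 0) with hq₂
  have hx := Int.toNat_sub_toNat_neg x
  have hy := Int.toNat_sub_toNat_neg y
  have hlp : lexLength a b p₁ = lexLength a b p₂ + 1 := by
    zify [lexLength, hp₁, hp₂]
    simp only [toAdd_ofAdd]
    linear_combination hxy + a * hx + b * hy
  have hlq : lexLength a b q₁ = lexLength a b q₂ := by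
    simp [lexLength, hq₁, hq₂, mul_comm]
  have hp : (powHom m n p₁ : ℕ) = l * powHom m n p₂ := by
    rw [powHom_eq_pow hm hn, powHom_eq_pow hm hn, hlp, pow_succ, mul_comm]
  have hq : (powHom m n q₁ : ℕ) = powHom m n q₂ := by
    rw [powHom_eq_pow hm hn, powHom_eq_pow hm hn, hlq]
  have hq' : (powHom m n q₁ : ℕ) = 1 * powHom m n q₂ := by rw [hq, one_mul]
  obtain ⟨v, hv⟩ : ∃ v : unitary A, (v : A) = lexQuot (powHom m n) S q₁ q₂ 0 := by
    refine ⟨⟨lexQuot (powHom m n) S q₁ q₂ 0, ?_⟩, rfl⟩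
    rw [Unitary.mem_iff]
    constructor
    · rw [hS.star_lexQuot_mul hq' zero_lt_one zero_lt_one, if_pos rfl]
    · have := hS.sum_lexQuot_mul_star hq'
      rwa [Finset.sum_range_one] at this
  have hsA : IsCuntzFamily l A fun i => lexQuot (powHom m n) S p₁ p₂ i := by
    refine ⟨fun i => ?_, ?_⟩
    · rw [hS.star_lexQuot_mul hp i.2 i.2, if_pos rfl]
    · rw [← hS.sum_lexQuot_mul_star hp, Finset.sum_range]
  -- Degrees commute, and the two products have the same index: 0 * l + i = i * 1 + 0.
  have hvA : ∀ i : Fin l, Commute (v : A) (lexQuot (powHom m n) S p₁ p₂ i) := fun i => by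
    rw [hv, Commute, SemiconjBy, hS.lexQuot_mul_lexQuot hq' zero_lt_one hp i.2,
      hS.lexQuot_mul_lexQuot hp i.2 hq' zero_lt_one, mul_comm p₁, mul_comm p₂]
    simp
  obtain ⟨g, hg₁, hg₂⟩ := hD.exists_lift hsA hvA
  obtain ⟨t, ht⟩ : ∃ t : ℕ → D, t = fun i : ℕ => if h : i < l then s ⟨i, h⟩ else 0 := ⟨_, rfl⟩
  have htC : ∀ i (hi : i < (l : ℕ)), t i = s ⟨i, hi⟩ := fun i hi => by
    rw [ht]
    exact dif_pos hi
  have ht₁ : ∀ i < (l : ℕ), ∀ j < (l : ℕ), star (t i) * t j = if i = j then 1 else 0 := by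
    intro i hi j hj
    rw [htC i hi, htC j hj]
    split_ifs with h
    · subst h
      exact hD.family.1 _
    · exact hD.family.star_mul_of_ne fun h' => h (congrArg Fin.val h')
  have ht₂ : ∑ i ∈ Finset.range l, t i * star (t i) = 1 := by
    rw [Finset.sum_range, ← hD.family.2]
    refine Finset.sum_congr rfl fun i _ => ?_
    rw [htC _ i.2]
  have htu : ∀ i, Commute (u : D) (t i) := fun i => by
    by_cases hi : i < (l : ℕ)
    · rw [htC i hi]
      exact hD.commute _
    · rw [ht]
      simp only [dif_neg hi]
      exact Commute.zero_right _
  obtain ⟨f, hf⟩ := hS.exists_lift (isLexFamily_twistedWord hm hn x y ht₁ ht₂ htu)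
  refine ⟨f, g, DFunLike.congr_fun (f := g.comp f) (g := StarAlgHom.id ℂ A)
    (hS.hom_ext fun r j hj => ?_), DFunLike.congr_fun (f := f.comp g) (g := StarAlgHom.id ℂ D)
    (hD.hom_ext (fun i => ?_) ?_)⟩
  -- Under `g` the word becomes a fraction of degree length(r) (x, y) and the power of `u` one of
  -- degree twist(r) (-b, a); their sum is `r` in ℤ².
  · change g (f (S r j)) = S r j
    have hgu : ∀ c : ℤ, g ((u ^ c : unitary D) : D) = ((v ^ c : unitary A) : A) := fun c => by
      obtain ⟨k, rfl | rfl⟩ := c.eq_nat_or_neg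
      · simp only [zpow_natCast, SubmonoidClass.coe_pow, map_pow, hg₂]
      · simp only [zpow_neg, zpow_natCast, ← Unitary.star_eq_inv, Unitary.coe_star,
          SubmonoidClass.coe_pow, map_star, map_pow, hg₂]
    have hj' := hj
    rw [powHom_eq_pow hm hn] at hj'
    have hgt : ∀ i < (l : ℕ), g (t i) = lexQuot (powHom m n) S p₁ p₂ i := fun i hi => by
      rw [htC i hi, hg₁]
    have h1 : ∀ N, (powHom m n (p₁ ^ N) : ℕ) = (l : ℕ) ^ N * powHom m n (p₂ ^ N) := fun N => by
      simp [hp, mul_pow]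
    set c := lexTwist x y r with hc
    have h2 : (powHom m n (q₁ ^ c.toNat * q₂ ^ (-c).toNat) : ℕ) =
        1 * powHom m n (q₂ ^ c.toNat * q₁ ^ (-c).toNat) := by
      simp [hq]
    rw [hf r j hj, twistedWord, map_mul, map_cuntzWord, hgu,
      hS.cuntzWord_lexQuot l.pos hp hgt _ _ hj', hS.coe_zpow_lexQuot hq hv,
      hS.lexQuot_mul_lexQuot (h1 _) hj' h2 zero_lt_one, mul_one, add_zero, ← hS.lexQuot_one]
    refine hS.lexQuot_congr (D := (l : ℕ) ^ lexLength a b r) ?_ ?_ hj' ?_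
    · rw [map_mul (powHom m n), map_mul (powHom m n) (p₂ ^ _), PNat.mul_coe, h1, h2,
        PNat.mul_coe]
      ring
    · rw [powHom_eq_pow hm hn]
      simp
    · have hc' := Int.toNat_sub_toNat_neg c
      have hc'' : c = x * r.toAdd.2 - y * r.toAdd.1 := hc
      refine Multiplicative.toAdd.injective (Prod.ext ?_ ?_)
      · simp only [hp₁, hp₂, hq₁, hq₂, lexLength, toAdd_mul, toAdd_pow, toAdd_ofAdd, toAdd_one,
          Prod.fst_add, Prod.smul_fst, Prod.fst_zero, smul_eq_mul]
        zify
        linear_combination (a * r.toAdd.1 + b * r.toAdd.2 : ℤ) * hx - b * hc' - b * hc'' +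
          r.toAdd.1 * hxy
      · simp only [hp₁, hp₂, hq₁, hq₂, lexLength, toAdd_mul, toAdd_pow, toAdd_ofAdd, toAdd_one,
          Prod.snd_add, Prod.smul_snd, Prod.snd_zero, smul_eq_mul]
        zify
        linear_combination (a * r.toAdd.1 + b * r.toAdd.2 : ℤ) * hy + a * hc' + a * hc'' +
          r.toAdd.2 * hxy
  · change f (g _) = s i
    rw [hg₁, map_lexQuot f hf hp i.2, lexQuot_twistedWord hm hn _ _ ht₂ htu hlp]
    -- The vector (x, y) has twist x y - y x = 0, so no power of `u` appears; (-b, a) has length 0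
    -- and twist x a + y b = 1, so it gives exactly `u`.
    have h0 : lexTwist x y p₁ - lexTwist x y p₂ = 0 := by
      simp only [lexTwist, hp₁, hp₂, toAdd_ofAdd]
      linear_combination x * hy - y * hx
    rw [h0, zpow_zero, OneMemClass.coe_one, mul_one, cuntzWord, cuntzWord, one_mul,
      Nat.mod_eq_of_lt i.2, htC _ i.2]
  · change f (g _) = u
    rw [hg₂, hv]
    refine (map_lexQuot f hf hq' zero_lt_one).trans ?_
    rw [lexQuot_twistedWord hm hn _ _ ht₂ htu (r := 0) (by rw [hlq, add_zero])]
    have h1 : lexTwist x y q₁ - lexTwist x y q₂ = 1 := by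
      simp only [lexTwist, hq₁, hq₂, toAdd_ofAdd]
      push_cast
      linear_combination hxy
    rw [h1, zpow_one, cuntzWord, one_mul]

end Rational

/-! ### Arithmetic of m and n -/

section Arithmetic

theorem nonempty_starAlgEquiv {m n l : ℕ+} {a b : ℕ} (hm : m = l ^ a) (hn : n = l ^ b)
    (hab : a.Coprime b) :
    Nonempty (CuntzAlgebra₂ m n ≃⋆ₐ[ℂ] CStarTensor (CuntzAlgebra l) C(Circle, ℂ)) := by
  let inst := lexCStarAlgebra (powHom m n)
  obtain ⟨s, u, hD⟩ := exists_isUniversalCuntzPair l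
  obtain ⟨f, g, hgf, hfg⟩ :=
    (isUniversalLexFamily_lexGen (powHom m n)).exists_inverse hm hn hab hD
  exact ⟨{ toFun := f
           invFun := g
           left_inv := hgf
           right_inv := hfg
           map_mul' := map_mul f
           map_add' := map_add f
           map_star' := map_star f
           map_smul' := map_smul f }⟩

/-- A coincidence of values with distinct second exponents would, after taking logarithms, express
`Real.logb m n` as a quotient of integers. -/
theorem powHom_injective {m n : ℕ+} (hm : 2 ≤ m) (hn : 2 ≤ n)
    (h : Irrational (Real.logb m n)) : Function.Injective (powHom m n) := by
  have hm' : (1 : ℝ) < m := by exact_mod_cast hm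
  have hn' : (1 : ℝ) < n := by exact_mod_cast hn
  have hlm := Real.log_pos hm'
  intro p q hpq
  have h1 : ((m ^ p.toAdd.1 * n ^ p.toAdd.2 : ℕ+) : ℝ) = (m ^ q.toAdd.1 * n ^ q.toAdd.2 : ℕ+) :=
    congrArg (fun k : ℕ+ => ((k : ℕ) : ℝ)) hpq
  push_cast at h1
  have h2 := congrArg Real.log h1
  rw [Real.log_mul (by positivity) (by positivity), Real.log_mul (by positivity) (by positivity),
    Real.log_pow, Real.log_pow, Real.log_pow, Real.log_pow] at h2
  have h3 : p.toAdd.2 = q.toAdd.2 := by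
    by_contra hne
    have hne' : ((p.toAdd.2 : ℝ) - q.toAdd.2) ≠ 0 := by
      rw [sub_ne_zero]; exact_mod_cast hne
    refine h ⟨((q.toAdd.1 : ℚ) - p.toAdd.1) / (p.toAdd.2 - q.toAdd.2), ?_⟩
    push_cast
    rw [Real.logb, div_eq_div_iff hne' hlm.ne']
    linarith
  rw [h3] at h2
  have h4 : (p.toAdd.1 : ℝ) = q.toAdd.1 :=
    mul_right_cancel₀ hlm.ne' (add_right_cancel h2)
  exact Multiplicative.toAdd.injective (Prod.ext (by exact_mod_cast h4) h3)

theorem tendsto_powHom {m n : ℕ+} (hm : 2 ≤ m) :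
    Filter.Tendsto (fun N : ℕ => (powHom m n (Multiplicative.ofAdd (N, N)) : ℕ))
      Filter.atTop Filter.atTop := by
  refine Filter.tendsto_atTop_mono (fun N => ?_) Filter.tendsto_id
  change N ≤ ((m ^ N * n ^ N : ℕ+) : ℕ)
  push_cast
  calc N ≤ 2 ^ N := Nat.lt_two_pow_self.le
    _ ≤ (m : ℕ) ^ N := Nat.pow_le_pow_left (by exact_mod_cast hm) N
    _ ≤ (m : ℕ) ^ N * (n : ℕ) ^ N := Nat.le_mul_of_pos_right _ (pow_pos n.pos N)

/-- With s a = t b + 1, the base is l = m^s / n^t: the a-th power of this quotient is m, which also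
shows that the division is exact. -/
theorem exists_eq_pow_of_pow_eq_pow {m n : ℕ+} {a b : ℕ} (hab : a.Coprime b) (ha : 0 < a)
    (hb : 0 < b) (h : n ^ a = m ^ b) : ∃ l : ℕ+, m = l ^ a ∧ n = l ^ b := by
  obtain ⟨x, y, hxy⟩ := Nat.isCoprime_iff_coprime.2 hab
  -- The Bézout coefficients are shifted by multiples of b and a large enough to make both exponents
  -- nonnegative.
  obtain ⟨s, t, hst⟩ : ∃ s t : ℕ, s * a = t * b + 1 := by
    have ha' : (1 : ℤ) ≤ a := by exact_mod_cast ha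
    have hb' : (1 : ℤ) ≤ b := by exact_mod_cast hb
    have hs : 0 ≤ x + b * (|x| + |y|) := by
      nlinarith [neg_abs_le x, abs_nonneg x, abs_nonneg y]
    have ht : 0 ≤ -y + a * (|x| + |y|) := by
      nlinarith [le_abs_self y, abs_nonneg x, abs_nonneg y]
    refine ⟨(x + b * (|x| + |y|)).toNat, (-y + a * (|x| + |y|)).toNat, ?_⟩
    zify
    rw [Int.toNat_of_nonneg hs, Int.toNat_of_nonneg ht]
    linear_combination hxy
  have h' : (n : ℕ) ^ a = (m : ℕ) ^ b := by exact_mod_cast congrArg PNat.val h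
  have key : ((m : ℕ) ^ s) ^ a = m * ((n : ℕ) ^ t) ^ a := by
    rw [← pow_mul, hst, pow_succ, mul_comm t b, pow_mul, ← h', ← pow_mul, ← pow_mul, mul_comm,
      mul_comm a t]
  have hdvd : (n : ℕ) ^ t ∣ (m : ℕ) ^ s := by
    rw [← Nat.pow_dvd_pow_iff ha.ne', key]
    exact dvd_mul_left _ _
  obtain ⟨l, hl⟩ := hdvd
  have hnt : 0 < ((n : ℕ) ^ t) ^ a := by have := n.pos; positivity
  have hm : l ^ a = m := by
    rw [hl, mul_pow, mul_comm] at key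
    exact Nat.eq_of_mul_eq_mul_right hnt key
  have hl0 : 0 < l := by
    rcases Nat.eq_zero_or_pos l with h0 | h0
    · rw [h0, zero_pow ha.ne'] at hm
      exact absurd hm.symm m.pos.ne'
    · exact h0
  have hn : l ^ b = n := by
    refine Nat.pow_left_injective ha.ne' ?_
    change (l ^ b) ^ a = (n : ℕ) ^ a
    rw [h', ← hm, ← pow_mul, ← pow_mul, mul_comm]
  exact ⟨⟨l, hl0⟩, PNat.eq (hm.symm.trans (PNat.pow_coe ⟨l, hl0⟩ a).symm),
    PNat.eq (hn.symm.trans (PNat.pow_coe ⟨l, hl0⟩ b).symm)⟩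

/-- The exponents a and b are the denominator and numerator of the reduced fraction log_m n. For
uniqueness, two bases give proportional pairs of coprime exponents, hence equal ones, and roots in
the positive integers are unique. -/
theorem existsUnique_base {m n : ℕ+} (hm : 2 ≤ m) (hn : 2 ≤ n)
    (h : ∃ q : ℚ, Real.logb m n = q) :
    ∃! l : ℕ+, ∃ a b : ℕ+, a.Coprime b ∧ m = l ^ (a : ℕ) ∧ n = l ^ (b : ℕ) := by
  have hm' : (1 : ℝ) < m := by exact_mod_cast hm
  have hn' : (1 : ℝ) < n := by exact_mod_cast hn
  have hlm := Real.log_pos hm'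
  have hln := Real.log_pos hn'
  obtain ⟨q, hq⟩ := h
  have hq0 : 0 < q := by
    have : (0 : ℝ) < q := by rw [← hq]; exact div_pos hln hlm
    exact_mod_cast this
  refine existsUnique_of_exists_of_unique ?_ ?_
  · have hnum : 0 < q.num.natAbs := Int.natAbs_pos.2 (Rat.num_pos.2 hq0).ne'
    have hcop : q.den.Coprime q.num.natAbs := q.reduced.symm
    have h1 : n ^ q.den = m ^ q.num.natAbs := by
      have h2 : (n : ℝ) ^ q.den = (m : ℝ) ^ q.num.natAbs := by
        refine Real.log_injOn_pos (Set.mem_Ioi.2 (by positivity)) (Set.mem_Ioi.2 (by positivity)) ?_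
        rw [Real.log_pow, Real.log_pow]
        have h3 : (q : ℝ) * q.den = q.num.natAbs := by
          have h4 : (q.num.natAbs : ℚ) = q.num := by
            have : (q.num.natAbs : ℤ) = q.num := Int.natAbs_of_nonneg (Rat.num_pos.2 hq0).le
            exact (Int.cast_natCast _).symm.trans (congrArg _ this)
          have h5 : q * q.den = q.num.natAbs := by rw [h4]; exact Rat.mul_den_eq_num q
          exact_mod_cast h5
        rw [← h3, ← hq, Real.logb]
        field_simp
      exact_mod_cast h2
    obtain ⟨l, hl1, hl2⟩ := exists_eq_pow_of_pow_eq_pow hcop q.den_pos hnum h1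
    exact ⟨l, ⟨q.den, q.den_pos⟩, ⟨q.num.natAbs, hnum⟩,
      PNat.coprime_coe.1 hcop, hl1, hl2⟩
  · rintro l l' ⟨a, b, hab, h1, h2⟩ ⟨a', b', hab', h1', h2'⟩
    have hl : 1 < (l : ℕ) := by
      rcases Nat.lt_or_ge 1 l with h | h
      · exact h
      · have hl1 : l = 1 := PNat.eq (le_antisymm h l.pos)
        rw [h1, hl1, one_pow] at hm
        exact absurd hm (by decide)
    have h3 : l ^ ((a : ℕ) * b') = l ^ ((b : ℕ) * a') := by
      rw [pow_mul, ← h1, pow_mul, ← h2, h1', h2', ← pow_mul, ← pow_mul, mul_comm]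
    have h4 : (a : ℕ) * b' = b * a' :=
      Nat.pow_right_injective hl (by simpa using congrArg PNat.val h3)
    have hab1 := PNat.coprime_coe.2 hab
    have hab2 := PNat.coprime_coe.2 hab'
    have h5 : (a : ℕ) = a' := by
      refine Nat.dvd_antisymm ?_ ?_
      · exact hab1.dvd_of_dvd_mul_left (h4 ▸ dvd_mul_right _ _)
      · exact hab2.dvd_of_dvd_mul_right (h4 ▸ dvd_mul_left _ _)
    rw [h1, h5] at h1'
    exact PNat.eq (Nat.pow_left_injective a'.pos.ne' (by simpa using congrArg PNat.val h1'))

end Arithmetic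

end

theorem mainTheorem3 :
    (∀ n : ℕ+, Nonempty (CuntzAlgebra₂ 1 n ≃⋆ₐ[ℂ] CStarTensor (CuntzAlgebra n) C(Circle, ℂ))) ∧
    (∀ m n : ℕ+, 2 ≤ m → 2 ≤ n → Irrational (Real.logb m n) →
      IsSimpleCStarAlgebra (CuntzAlgebra₂ m n)) ∧
    (∀ m n : ℕ+, 2 ≤ m → 2 ≤ n → (∃ q : ℚ, Real.logb m n = q) →
      (∃! l : ℕ+, ∃ a b : ℕ+, a.Coprime b ∧ m = l ^ (a : ℕ) ∧ n = l ^ (b : ℕ)) ∧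
      ∀ l : ℕ+, (∃ a b : ℕ+, a.Coprime b ∧ m = l ^ (a : ℕ) ∧ n = l ^ (b : ℕ)) →
        Nonempty (CuntzAlgebra₂ m n ≃⋆ₐ[ℂ] CStarTensor (CuntzAlgebra l) C(Circle, ℂ))) := by
  refine ⟨fun n => ?_, fun m n hm hn h => ?_, fun m n hm hn h => ⟨existsUnique_base hm hn h, ?_⟩⟩
  -- Here 1 = n^0 and n = n^1, and 0 is coprime to 1, so the common-base argument applies with l =
  -- n, including n = 1.
  · exact nonempty_starAlgEquiv (a := 0) (b := 1) (pow_zero n).symm (pow_one n).symm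
      (Nat.coprime_one_right 0)
  · exact isSimple_cuntzAlg (powHom_injective hm hn h) (tendsto_powHom hm)
  · rintro l ⟨a, b, hab, h1, h2⟩
    exact nonempty_starAlgEquiv h1 h2 (PNat.coprime_coe.2 hab)
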